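/- **Affine cellular algebras.** Let $k$ be a noetherian domain. A $k$-involution of a $k$-algebra is a $k$-linear anti-automorphism $i$ with $i^2=\mathrm{id}$. An affine $k$-algebra is a finitely generated commutative $k$-algebra. Let $A$ be a unital $k$-algebra with a $k$-involution $i$. A two-sided ideal $J$ of $A$ with $i(J)=J$ is an *affine cell ideal* if there are a free $k$-module $V$ of finite rank, an affine $k$-algebra $B$ with a $k$-involution $\sigma$, an $A$-$B$-bimodule structure on $\Delta=V\otimes_kB$ extending the regular right $B$-module structure, and an isomorphism of $A$-$A$-bimodules $\alpha:J\to\Delta\otimes_B\Delta'$ such that $\alpha\circ i=\theta\circ\alpha$, where $\theta((u\otimes b)\otimes_B(b'\otimes v))=(v\otimes\sigma(b'))\otimes_B(\sigma(b)\otimes u)$. Here $\Delta'=B\otimes_kV$ has the regular left $B$-module structure and the right $A$-module structure $x\cdot a=\tau_\sigma\big(i(a)\,\tau_\sigma^{-1}(x)\big)$, with $\tau_\sigma:\Delta\to\Delta'$, $\tau_\sigma(v\otimes b)=\sigma(b)\otimes v$. The algebra $A$ is *affine cellular* with respect to $i$ if there is a $k$-module decomposition $A=J_1'\oplus\cdots\oplus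 J_n'$ with $i(J_l')=J_l'$ such that every $J_l=J_1'\oplus\cdots\oplus J_l'$ is a two-sided ideal and $J_l/J_{l-1}$ is an affine cell ideal of $A/J_{l-1}$ (with the induced involution) for $1\le l\le n$; such a decomposition is called a *cell chain*. **Setting.** Let $k=\mathbb Z[v,v^{-1}]$, $v$ an indeterminate, and let $A$ be an associative (not necessarily unital) $k$-algebra with a $k$-involution $i$. A *generalized unit* of a ring $R$ is an injective map $X\to R$, $\lambda\mapsto1_\lambda$, from a set $X$, with $1_\lambda1_{\lambda'}=\delta_{\lambda,\lambda'}1_\lambda$ and $R=\sum_{\lambda,\lambda'}1_\lambda R1_{\lambda'}$. A basis of $R$ is *compatible* with it if it contains all $1_\lambda$ and each basis element lies in $1_\lambda R1_{\lambda'}$ for exactly one pair $(\lambda,\lambda')$. Let $A$ have a generalized unit $(1_\lambda)_{\lambda\in X}$ and a compatible $k$-basis $\mathcal B$, with structure constants $bb'=\sum_{b''}c_{b,b'}^{b''}b''$. A two-sided ideal is *based* if it is spanned by a subset of $\mathcal B$. Write $b\preceq_{LR}b'$ if $b$ lies in every based two-sided ideal containing $b'$; the classes of the equivalence relation "$b\preceq_{LR}b'$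 and $b'\preceq_{LR}b$" are the *2-cells*. For a 2-cell $\mathbf c$ let $A_{\mathbf c}$ be the $k$-span of $\mathbf c$ with the product $b\cdot b'=\sum_{b''\in\mathbf c}c_{b,b'}^{b''}b''$, and let $L$ be the $\mathbb Z[v^{-1}]$-span of $\mathbf c$. For $b\in\mathbf c$ let $a(b)\in\mathbb N\cup\{\infty\}$ be the least $n\ge0$ with $v^{-n}bL\subseteq L$ in $A_{\mathbf c}$ ($\infty$ if there is none). Assume: * ($P_1$) There are finitely many 2-cells; $a(b)<\infty$ for all $b\in\mathcal B$; for each 2-cell $\mathbf c$ and $\lambda\in X$, $a$ is constant on $\{b\in\mathbf c: b1_\lambda=b\}$. Let $A_{\mathbf c}^\infty$ be the ring with $\mathbb Z$-basis $\{t_b\}_{b\in\mathbf c}$ and product $t_bt_{b'}=\sum_{b''\in\mathbf c}\gamma_{b,b'}^{b''}t_{b''}$, where $\gamma_{b,b'}^{b''}\in\mathbb Z$ and $v^{-a(b)}c_{b,b'}^{b''}\equiv\gamma_{b,b'}^{b''}$ modulo $v^{-1}\mathbb Z[v^{-1}]$. (Set $\gamma_{b,b'}^{b''}=0$ if $b,b',b''$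 are not in one 2-cell.) * ($P_2$) For each 2-cell $\mathbf c$ there is a finite subset $\mathcal D_{\mathbf c}\subseteq\mathbf c$ such that $d\mapsto t_d$ is a generalized unit of $A_{\mathbf c}^\infty$ with which the basis $\{t_b\}$ is compatible. Put $n_{\mathbf c}=|\mathcal D_{\mathbf c}|$. * ($P_3$) For all 2-cells $\mathbf c$, all $b_2,b'\in\mathbf c$ and all $b_1,b_3\in\mathcal B$: $$\sum_{b\in\mathbf c}c_{b_1,b_2}^{b}\gamma_{b,b_3}^{b'}=\sum_{b\in\mathbf c}c_{b_1,b}^{b'}\gamma_{b_2,b_3}^{b},\qquad \sum_{b\in\mathbf c}\gamma_{b_1,b_2}^{b}c_{b,b_3}^{b'}=\sum_{b\in\mathbf c}\gamma_{b_1,b}^{b'}c_{b_2,b_3}^{b}.$$ * ($P_4$) For each 2-cell $\mathbf c$ there are a group $G_{\mathbf c}$, a finite product of general linear groups over $\mathbb C$, and a bijection $b\leftrightarrow(j,l,s)$ of $\mathbf c$ with $\{1,\dots,n_{\mathbf c}\}^2\times\mathrm{Irr}\,G_{\mathbf c}$ ($\mathrm{Irr}$: isomorphism classes of irreducible rational representations)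 such that: (a) if $b\leftrightarrow(j,l,s)$, then $i(b)\in\mathbf c$ and $i(b)\leftrightarrow(l,j,s^*)$, where $s^*$ is the dual of $s$; (b) $t_b\mapsto E_{jl}(s)$ is a ring isomorphism from $A_{\mathbf c}^\infty$ onto the ring of $n_{\mathbf c}\times n_{\mathbf c}$ matrices over the representation ring $B_{\mathbf c}$ of $G_{\mathbf c}$, that is, onto the free abelian group on the triples with $(j,l,s)(p,q,s')=\delta_{l,p}\sum_{s''}m_{s,s'}^{s''}(j,q,s'')$, where $m_{s,s'}^{s''}$ is the multiplicity of $s''$ in $s\otimes s'$. **Theorem.** Under these assumptions $A$ has an identity element, and $A$ is affine cellular with respect to $i$, both as a $k$-algebra and as a $\mathbb Z$-algebra. More precisely, the 2-cells can be numbered $\mathbf c_1,\dots,\mathbf c_f$ such that $b\preceq_{LR}b'$ with $b\in\mathbf c_j$, $b'\in\mathbf c_l$ implies $j\le l$, and such that $A=A_{\mathbf c_1}\oplus\cdots\oplus A_{\mathbf c_f}$ is a cell chain over $k$. Moreover, for each 2-cell $\mathbf c$ and each labelling as in $P_4$, $B_{\mathbf c}$ is a finitely generated commutative ring with an involution $\sigma$,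 $\sigma(s)=s^*$, and there is a matrix $\Psi_{\mathbf c}\in M_{n_{\mathbf c}}(k\otimes_{\mathbb Z}B_{\mathbf c})$ such that the $k$-linear bijection $\Theta:A_{\mathbf c}\to M_{n_{\mathbf c}}(k\otimes_{\mathbb Z}B_{\mathbf c})$ sending $b\leftrightarrow(j,l,s)$ to $E_{jl}(s)$ satisfies $\Theta(x\cdot y)=\Theta(x)\Psi_{\mathbf c}\Theta(y)$ for all $x,y\in A_{\mathbf c}$, and $\Theta(i(b))=E_{lj}(\sigma(s))$. -/

import Mathlib

open scoped TensorProduct LaurentPolynomial MonoidAlgebra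

noncomputable section

namespace CellTheory

universe u w

/-! ## Involutions and affine cellular algebras -/

/-- A `k`-involution on a (not necessarily unital) `k`-algebra `A`: a `k`-linear
anti-automorphism with square the identity. -/
structure KInvolution (k : Type*) (A : Type*) [CommRing k] [NonUnitalRing A] [Module k A]
    extends A →ₗ[k] A where
  map_mul_rev' : ∀ x y : A, toFun (x * y) = toFun y * toFun x
  involutive' : ∀ x : A, toFun (toFun x) = x

instance {k A : Type*} [CommRing k] [NonUnitalRing A] [Module k A] :
    CoeFun (KInvolution k A) (fun _ => A → A) := ⟨fun i => i.toLinearMap⟩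

/-- A `k`-involution, regarded only as a `ℤ`-involution. -/
def KInvolution.toInt {k A : Type*} [CommRing k] [NonUnitalRing A] [Module k A]
    (i : KInvolution k A) : KInvolution ℤ A where
  toLinearMap := i.toLinearMap.toAddMonoidHom.toIntLinearMap
  map_mul_rev' := i.map_mul_rev'
  involutive' := i.involutive'

section Twist

variable {k : Type*} {B V : Type*} [CommRing k] [CommRing B] [Algebra k B]
  [AddCommGroup V] [Module k V] (σ : KInvolution k B)

/-- The `σ`-semilinear map `b ⊗ v ↦ σ b ⊗ v`. -/
def twist : B ⊗[k] V →ₗ[k] B ⊗[k] V := σ.toLinearMap.rTensor V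

theorem twist_tmul (b : B) (v : V) : twist (V := V) σ (b ⊗ₜ[k] v) = σ b ⊗ₜ[k] v := by
  simp [twist]

theorem twist_smul (b : B) (x : B ⊗[k] V) : twist σ (b • x) = σ b • twist σ x := by
  induction x using TensorProduct.induction_on with
  | zero => simp
  | tmul c v =>
    rw [TensorProduct.smul_tmul', twist_tmul, twist_tmul, TensorProduct.smul_tmul',
      smul_eq_mul, smul_eq_mul, mul_comm b c]
    exact congrArg (fun z => z ⊗ₜ[k] v) (σ.map_mul_rev' c b)
  | add x y hx hy => rw [smul_add, map_add, map_add, hx, hy, smul_add]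

theorem twist_twist (x : B ⊗[k] V) : twist σ (twist σ x) = x := by
  induction x using TensorProduct.induction_on with
  | zero => simp
  | tmul c v =>
    rw [twist_tmul, twist_tmul]
    exact congrArg (fun z => z ⊗ₜ[k] v) (σ.involutive' c)
  | add x y hx hy => rw [map_add, map_add, hx, hy]

/-- The conjugate of a `B`-linear endomorphism of `B ⊗ V` by `b ⊗ v ↦ σ b ⊗ v`;
it is again `B`-linear. -/
def conjTwist (f : Module.End B (B ⊗[k] V)) : Module.End B (B ⊗[k] V) where
  toFun x := twist σ (f (twist σ x))
  map_add' x y := by simp only [map_add]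
  map_smul' b x := by
    rw [twist_smul, map_smul, twist_smul]
    exact congrArg (fun z => z • twist σ (f (twist σ x))) (σ.involutive' b)

/-- The additive map of `Δ ⊗_B Δ'` with
`(u ⊗ b) ⊗_B (b' ⊗ v) ↦ (v ⊗ σ b') ⊗_B (σ b ⊗ u)`.
Both `Δ = V ⊗ B` and `Δ' = B ⊗ V` are written as `B ⊗ V`, the commutative ring `B` acting on
the factor `B`. -/
def flip : (B ⊗[k] V) ⊗[B] (B ⊗[k] V) →+ (B ⊗[k] V) ⊗[B] (B ⊗[k] V) :=
  TensorProduct.liftAddHom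
    { toFun := fun x =>
        { toFun := fun y => twist σ y ⊗ₜ[B] twist σ x
          map_zero' := by simp
          map_add' := fun y z => by rw [map_add, TensorProduct.add_tmul] }
      map_zero' := by ext y; simp
      map_add' := fun x z => by
        ext y
        simp [TensorProduct.tmul_add] }
    (fun b x y => by
      change twist σ y ⊗ₜ[B] twist σ (b • x) = twist σ (b • y) ⊗ₜ[B] twist σ x
      rw [twist_smul, twist_smul, TensorProduct.smul_tmul])

theorem flip_tmul (b b' : B) (x y : V) :
    flip σ ((b ⊗ₜ[k] x) ⊗ₜ[B] (b' ⊗ₜ[k] y)) = (σ b' ⊗ₜ[k] y) ⊗ₜ[B] (σ b ⊗ₜ[k] x) := by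
  change twist σ (b' ⊗ₜ[k] y) ⊗ₜ[B] twist σ (b ⊗ₜ[k] x) = _
  rw [twist_tmul, twist_tmul]

end Twist

/-- `J` is an affine cell ideal of the unital `k`-algebra `A` with `k`-involution `i`: it is an
`i`-stable two-sided ideal and there are a free `k`-module `V` of finite rank, a finitely
generated commutative `k`-algebra `B` with a `k`-involution `σ`, an `A`-`B`-bimodule structure on
`Δ = V ⊗ B` extending the regular `B`-structure (that is, an algebra homomorphism `φ` from `A` to
the `B`-linear endomorphisms of `Δ`) and an isomorphism `α : J → Δ ⊗_B Δ'` of `A`-`A`-bimodules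
which intertwines `i` with `flip σ`.  Here `Δ' = B ⊗ V` is the left `B`-module on which `a : A`
acts from the right by transporting the action of `i a` on `Δ` along the `σ`-semilinear bijection
`V ⊗ B → B ⊗ V`, `v ⊗ b ↦ σ b ⊗ v`.
Both `Δ` and `Δ'` are written as `B ⊗ V`.  (A finitely generated module or algebra over
`k : Type u` has an isomorphic copy in `Type u`.) -/
def IsAffineCellIdeal (k : Type u) {A : Type w} [CommRing k] [Ring A] [Algebra k A]
    (i : KInvolution k A) (J : Ideal A) : Prop :=
  J.IsTwoSided ∧ (i : A → A) '' (J : Set A) = J ∧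
  ∃ (V : Type u) (_ : AddCommGroup V) (_ : Module k V) (_ : Module.Free k V)
    (_ : Module.Finite k V)
    (B : Type u) (_ : CommRing B) (_ : Algebra k B) (_ : Algebra.FiniteType k B)
    (σ : KInvolution k B)
    (φ : A →ₐ[k] Module.End B (B ⊗[k] V))
    (α : J ≃ₗ[k] (B ⊗[k] V) ⊗[B] (B ⊗[k] V)),
    (∀ (a : A) (x y : J), (y : A) = a * x → α y = (φ a).rTensor (B ⊗[k] V) (α x)) ∧
    (∀ (a : A) (x y : J), (y : A) = x * a →
      α y = (conjTwist σ (φ (i a))).lTensor (B ⊗[k] V) (α x)) ∧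
    (∀ x y : J, (y : A) = i x → α y = flip σ (α x))

/-- The `k`-module decomposition `A = J'₁ ⊕ ⋯ ⊕ J'ₙ` is a cell chain for `(A, i)`: each summand
is `i`-stable, the partial sums `J l` are two-sided ideals, and each `J (l + 1) / J l` is an
affine cell ideal of `A / J l` with the induced involution. -/
def IsCellChain (k : Type u) {A : Type w} [CommRing k] [Ring A] [Algebra k A]
    (i : KInvolution k A) {n : ℕ} (J' : Fin n → Submodule k A) : Prop :=
  DirectSum.IsInternal J' ∧ (∀ l, (J' l).map i.toLinearMap = J' l) ∧
  ∃ (J : Fin (n + 1) → Ideal A) (_ : ∀ l, (J l).IsTwoSided),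
    (∀ l, (J l).restrictScalars k = ⨆ m : {m : Fin n // m.castSucc < l}, J' m) ∧
    ∀ l : Fin n, ∃ j : KInvolution k (A ⧸ J l.castSucc),
      (∀ a : A, j (Ideal.Quotient.mk (J l.castSucc) a) = Ideal.Quotient.mk (J l.castSucc) (i a)) ∧
      IsAffineCellIdeal k j ((J l.succ).map (Ideal.Quotient.mk (J l.castSucc)))

/-- Affine cellularity of a unital `k`-algebra with respect to a `k`-involution. -/
def IsAffineCellular (k : Type u) {A : Type w} [CommRing k] [Ring A] [Algebra k A]
    (i : KInvolution k A) : Prop :=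
  ∃ (n : ℕ) (J' : Fin n → Submodule k A), IsCellChain k i J'

/-- The unital ring given by a non-unital ring together with a two-sided identity element. -/
abbrev ringOfUnit {A : Type*} [NonUnitalRing A] (u : A) (hu : ∀ a : A, u * a = a ∧ a * u = a) :
    Ring A :=
  { ‹NonUnitalRing A› with
    one := u
    one_mul := fun a => (hu a).1
    mul_one := fun a => (hu a).2 }

/-- The algebra structure over `k` on the unital ring of `ringOfUnit`. -/
abbrev algebraOfUnit (k : Type*) {A : Type*} [CommRing k] [NonUnitalRing A] [Module k A]
    [IsScalarTower k A A] [SMulCommClass k A A] (u : A) (hu : ∀ a : A, u * a = a ∧ a * u = a) :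
    letI := ringOfUnit u hu
    Algebra k A :=
  letI := ringOfUnit u hu
  Algebra.ofModule (fun r x y => smul_mul_assoc r x y) (fun r x y => mul_smul_comm r x y)

/-! ## Algebras given by structure constants, generalized units -/

/-- The free `S`-module on `I` with the bilinear product `b b' = ∑ b'', m b b' b'' • b''`
on basis elements. -/
def StructAlg {S I : Type*} [CommRing S] (_m : I → I → I →₀ S) : Type _ := I →₀ S

namespace StructAlg

variable {S I : Type*} [CommRing S] (m : I → I → I →₀ S)

instance : AddCommGroup (StructAlg m) := inferInstanceAs (AddCommGroup (I →₀ S))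
instance : Module S (StructAlg m) := inferInstanceAs (Module S (I →₀ S))

/-- The bilinear multiplication. -/
def mulHom : (I →₀ S) →ₗ[S] (I →₀ S) →ₗ[S] (I →₀ S) :=
  Finsupp.linearCombination S (fun b => Finsupp.linearCombination S (fun b' => m b b'))

instance : NonUnitalNonAssocRing (StructAlg m) :=
  { (inferInstance : AddCommGroup (StructAlg m)) with
    mul := fun x y => mulHom m x y
    left_distrib := fun x y z => (mulHom m x).map_add y z
    right_distrib := fun x y z => LinearMap.map_add₂ (mulHom m) x y z
    zero_mul := fun x => LinearMap.map_zero₂ (mulHom m) x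
    mul_zero := fun x => (mulHom m x).map_zero }

/-- The basis element indexed by `b`. -/
def of (b : I) : StructAlg m := (Finsupp.single b 1 : I →₀ S)

theorem of_mul_of (b b' : I) : of m b * of m b' = (m b b' : I →₀ S) := by
  change mulHom m (Finsupp.single b 1) (Finsupp.single b' 1) = _
  simp [mulHom]

end StructAlg

/-- `e : X → R` is a generalized unit for `R`. -/
def IsGeneralizedUnit {X R : Type*} [NonUnitalNonAssocRing R] (e : X → R) : Prop :=
  Function.Injective e ∧
  (∀ x, e x * e x = e x) ∧ (∀ x y, x ≠ y → e x * e y = 0) ∧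
  AddSubgroup.closure {a : R | ∃ (x y : X) (r : R), a = e x * r * e y} = ⊤

/-- The family `b` of elements of `R` is compatible with the generalized unit `e`. -/
def IsCompatible {X ι R : Type*} [NonUnitalNonAssocRing R] (e : X → R) (b : ι → R) : Prop :=
  (∀ x, e x ∈ Set.range b) ∧
  ∀ j, ∃! p : X × X, ∃ r : R, b j = e p.1 * r * e p.2

/-! ## Cells, the `a`-function and the asymptotic ring -/

/-- `k = ℤ[v, v⁻¹]`; the indeterminate `v` is `LaurentPolynomial.T 1`. -/
abbrev K : Type := ℤ[T;T⁻¹]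

/-- The subring `ℤ[v⁻¹]` of `k`. -/
def Kminus : Subalgebra ℤ K := Algebra.adjoin ℤ {LaurentPolynomial.T (-1)}

section Cells

variable {A : Type*} [NonUnitalRing A] [Module K A] {ι : Type*} (β : Module.Basis ι K A)

/-- The span of the basis elements indexed by `S` is a two-sided ideal. -/
def IsBasedIdeal (S : Set ι) : Prop :=
  ∀ x ∈ Submodule.span K (β '' S), ∀ a : A,
    a * x ∈ Submodule.span K (β '' S) ∧ x * a ∈ Submodule.span K (β '' S)

/-- `b ⪯_LR b'`: `b` lies in every based two-sided ideal which contains `b'`. -/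
def LRLe (b b' : ι) : Prop :=
  ∀ S : Set ι, IsBasedIdeal β S → β b' ∈ Submodule.span K (β '' S) →
    β b ∈ Submodule.span K (β '' S)

/-- The 2-cell of `b`. -/
def twoCell (b : ι) : Set ι := {b' | LRLe β b' b ∧ LRLe β b b'}

/-- The set of all 2-cells. -/
def twoCells : Set (Set ι) := Set.range (twoCell β)

/-- For `b, b' ∈ c`, the family of the structure constants `c_{b,b'}^{b''}`, `b'' ∈ c`. -/
def cellCoeff (c : Set ι) (b b' : c) : c →₀ K :=
  (β.repr (β b * β b')).subtypeDomain (· ∈ c)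

/-- The algebra `A_c`: the free `k`-module on `c`, with product
`b b' = ∑_{b'' ∈ c} c_{b,b'}^{b''} b''`. -/
abbrev CellAlg (c : Set ι) : Type _ := StructAlg (cellCoeff β c)

/-- The `ℤ[v⁻¹]`-submodule `L` of `A_c` generated by `c`. -/
def cellLattice (c : Set ι) : Submodule Kminus (CellAlg β c) :=
  Submodule.span Kminus (Set.range (StructAlg.of (cellCoeff β c)))

/-- `v⁻ⁿ b L ⊆ L`, for `b ∈ c`. -/
def IsBound (c : Set ι) (b : c) (n : ℕ) : Prop :=
  ∀ x ∈ cellLattice β c,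
    (LaurentPolynomial.T (-(n : ℤ)) : K) • (StructAlg.of (cellCoeff β c) b * x) ∈ cellLattice β c

/-- The function `a` on the 2-cell `c`: the smallest `n` with `v⁻ⁿ b L ⊆ L`, or `∞` if there is
none. -/
def aFun (c : Set ι) (b : c) : ℕ∞ := ⨅ (n : ℕ) (_ : IsBound β c b n), (n : ℕ∞)

/-- `γ_{b,b'}^{b''}`, as a function of `b'' ∈ c`: the constant coefficient of
`v^{-a(b)} c_{b,b'}^{b''}`. When `a(b)` is finite, the latter lies in `ℤ[v⁻¹]`, so that
`γ_{b,b'}^{b''}` is its residue modulo `v⁻¹ ℤ[v⁻¹]`. -/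
def asymCoeff (c : Set ι) (b b' : c) : c →₀ ℤ :=
  (cellCoeff β c b b').mapRange
    (fun f => ((LaurentPolynomial.T (-((aFun β c b).toNat : ℤ)) : K) * f).coeff 0) (by simp)

/-- The asymptotic ring of the 2-cell `c`, with `ℤ`-basis `t_b = StructAlg.of _ b`, `b ∈ c`. -/
abbrev AsymRing (c : Set ι) : Type _ := StructAlg (asymCoeff β c)

/-- The basis element `t_b` of the asymptotic ring. -/
abbrev tElt (c : Set ι) (b : c) : AsymRing β c := StructAlg.of (asymCoeff β c) b

/-- Property `P₁`. The 2-cells are partially ordered by `⪯_LR`, so that for (a) only their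
finiteness has to be required. -/
structure PropertyP1 {X : Type*} (e : X → A) : Prop where
  finite_cells : (twoCells β).Finite
  finite_a : ∀ c ∈ twoCells β, ∀ b : c, aFun β c b ≠ ⊤
  const_a : ∀ c ∈ twoCells β, ∀ (x : X) (b b' : c),
    β b * e x = β b → β b' * e x = β b' → aFun β c b = aFun β c b'

/-- `{t_d | d ∈ D}` is a generalized unit of the asymptotic ring of `c`, and the basis
`{t_b | b ∈ c}` is compatible with it. -/
def IsUnitSet (c : Set ι) (D : Finset c) : Prop :=
  IsGeneralizedUnit (fun d : D => tElt β c d) ∧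
  IsCompatible (fun d : D => tElt β c d) (tElt β c)

/-- Property `P₂`. -/
def PropertyP2 : Prop := ∀ c ∈ twoCells β, ∃ D : Finset c, IsUnitSet β c D

/-- Property `P₃`. As `γ` is the family of structure constants of the asymptotic ring of `c`
(outside of `c` it is zero, and the equations are trivial), its arguments range over `c`.
All the sums have only finitely many nonzero terms. -/
structure PropertyP3 : Prop where
  left : ∀ c ∈ twoCells β, ∀ (b₁ : ι) (b₂ b₃ b' : c),
    ∑ᶠ b : c, β.repr (β b₁ * β b₂) b * (asymCoeff β c b b₃ b' : K) =
      ∑ᶠ b : c, β.repr (β b₁ * β b) b' * (asymCoeff β c b₂ b₃ b : K)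
  right : ∀ c ∈ twoCells β, ∀ (b₁ b₂ b' : c) (b₃ : ι),
    ∑ᶠ b : c, (asymCoeff β c b₁ b₂ b : K) * β.repr (β b * β b₃) b' =
      ∑ᶠ b : c, (asymCoeff β c b₁ b b' : K) * β.repr (β b₂ * β b₃) b

end Cells

/-! ## Rational representations of products of general linear groups -/

/-- The group `GL_{m 0}(ℂ) × ⋯ × GL_{m (r-1)}(ℂ)`. -/
abbrev GLProd {r : ℕ} (m : Fin r → ℕ) : Type := ∀ q : Fin r, GL (Fin (m q)) ℂ

section Rep

variable {r : ℕ} (m : Fin r → ℕ)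

/-- The algebra of regular functions on the algebraic group `GLProd m`: it is generated by the
matrix entries and the inverses of the determinants. -/
def regularFunctions : Subalgebra ℂ (GLProd m → ℂ) :=
  Algebra.adjoin ℂ
    ({f | ∃ (q : Fin r) (a b : Fin (m q)), f = fun g => (g q : Matrix _ _ ℂ) a b} ∪
      {f | ∃ q : Fin r, f = fun g => ((g q : Matrix (Fin (m q)) (Fin (m q)) ℂ).det)⁻¹})

/-- A representation is rational if all its matrix coefficients are regular functions. -/
def IsRational {W : Type*} [AddCommGroup W] [Module ℂ W]
    (ρ : Representation ℂ (GLProd m) W) : Prop :=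
  ∀ (x : W) (f : Module.Dual ℂ W), (fun g => f (ρ g x)) ∈ regularFunctions m

/-- An irreducible rational representation on some `ℂ^d`. -/
structure IrrRep where
  dim : ℕ
  ρ : Representation ℂ (GLProd m) (Fin dim → ℂ)
  rational : IsRational m ρ
  irreducible : ρ.IsIrreducible

/-- Isomorphism of representations, as modules over the group algebra. -/
instance irrSetoid : Setoid (IrrRep m) where
  r s t := Nonempty (s.ρ.asModule ≃ₗ[ℂ[GLProd m]] t.ρ.asModule)
  iseqv := ⟨fun _ => ⟨LinearEquiv.refl _ _⟩, fun ⟨f⟩ => ⟨f.symm⟩, fun ⟨f⟩ ⟨g⟩ => ⟨f.trans g⟩⟩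

/-- `Irr G`: the isomorphism classes of irreducible rational representations. -/
def Irr : Type := Quotient (irrSetoid m)

variable {m}

/-- A representative of an isomorphism class. -/
def Irr.rep (s : Irr m) : Representation ℂ (GLProd m) (Fin (Quotient.out s).dim → ℂ) :=
  (Quotient.out s).ρ

/-- `t` is the class of the dual representation of `s`. -/
def IsDual (s t : Irr m) : Prop :=
  Nonempty (t.rep.asModule ≃ₗ[ℂ[GLProd m]] s.rep.dual.asModule)

theorem exists_compositionSeries {W : Type} [AddCommGroup W] [Module ℂ W]
    [FiniteDimensional ℂ W] (ρ : Representation ℂ (GLProd m) W) :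
    ∃ S : CompositionSeries (Submodule ℂ[GLProd m] ρ.asModule),
      RelSeries.head S = ⊥ ∧ RelSeries.last S = ⊤ := by
  have : FiniteDimensional ℂ ρ.asModule := inferInstanceAs (FiniteDimensional ℂ W)
  have : IsNoetherian ℂ[GLProd m] ρ.asModule := isNoetherian_of_tower ℂ inferInstance
  have : IsArtinian ℂ[GLProd m] ρ.asModule := isArtinian_of_tower ℂ inferInstance
  exact exists_compositionSeries_of_isNoetherian_isArtinian _ _

/-- A chosen composition series of a finite-dimensional representation. -/
def compSeries {W : Type} [AddCommGroup W] [Module ℂ W]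
    [FiniteDimensional ℂ W] (ρ : Representation ℂ (GLProd m) W) :
    CompositionSeries (Submodule ℂ[GLProd m] ρ.asModule) :=
  (exists_compositionSeries ρ).choose

/-- The `j`-th factor of the chosen composition series is isomorphic to `s`. -/
def IsFactor {W : Type} [AddCommGroup W] [Module ℂ W] [FiniteDimensional ℂ W]
    (ρ : Representation ℂ (GLProd m) W) (j : Fin (compSeries ρ).length) (s : Irr m) : Prop :=
  Nonempty ((↥(compSeries ρ j.succ) ⧸
      (compSeries ρ j.castSucc).submoduleOf (compSeries ρ j.succ))
    ≃ₗ[ℂ[GLProd m]] s.rep.asModule)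

theorem IsFactor.eq {W : Type} [AddCommGroup W] [Module ℂ W] [FiniteDimensional ℂ W]
    {ρ : Representation ℂ (GLProd m) W} {j : Fin (compSeries ρ).length} {s t : Irr m}
    (hs : IsFactor ρ j s) (ht : IsFactor ρ j t) : s = t := by
  obtain ⟨f⟩ := hs
  obtain ⟨g⟩ := ht
  rw [← Quotient.out_eq s, ← Quotient.out_eq t]
  exact Quotient.sound ⟨f.symm.trans g⟩

/-- The multiplicity of `s` as a composition factor of `ρ` (by the Jordan-Hölder theorem it does
not depend on the composition series; rational representations being completely reducible, it is
the number of summands isomorphic to `s` in a decomposition into irreducible ones). -/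
def multiplicity {W : Type} [AddCommGroup W] [Module ℂ W] [FiniteDimensional ℂ W]
    (ρ : Representation ℂ (GLProd m) W) (s : Irr m) : ℕ :=
  Nat.card {j : Fin (compSeries ρ).length // IsFactor ρ j s}

theorem multiplicity_finite {W : Type} [AddCommGroup W] [Module ℂ W] [FiniteDimensional ℂ W]
    (ρ : Representation ℂ (GLProd m) W) :
    (Function.support fun s => (multiplicity ρ s : ℤ)).Finite := by
  have h : (⋃ j : Fin (compSeries ρ).length, {s : Irr m | IsFactor ρ j s}).Finite :=
    Set.finite_iUnion fun j => Set.Subsingleton.finite fun s hs t ht => IsFactor.eq hs ht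
  refine h.subset fun s hs => ?_
  have hs' : multiplicity ρ s ≠ 0 := fun h0 => hs (by simp [h0])
  have hn : Nonempty {j : Fin (compSeries ρ).length // IsFactor ρ j s} :=
    (Nat.card_ne_zero.mp hs').1
  obtain ⟨j, hj⟩ := hn
  exact Set.mem_iUnion.mpr ⟨j, hj⟩

/-- The family of the multiplicities `c_{s,s'}^{s''}` of `s''` in `s ⊗ s'`. -/
def tensorCoeff (s s' : Irr m) : Irr m →₀ ℤ :=
  Finsupp.ofSupportFinite (fun s'' => (multiplicity (s.rep.tprod s'.rep) s'' : ℤ))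
    (multiplicity_finite _)

variable (m)

/-- The representation ring of `GLProd m`: the free abelian group on `Irr m` with
`s s' = ∑ c_{s,s'}^{s''} s''`. -/
abbrev RepRing : Type := StructAlg (tensorCoeff (m := m))

/-- The structure constants of `J_c`:
`(j,l,s) (p,q,s') = δ_{l,p} ∑ c_{s,s'}^{s''} (j,q,s'')`. -/
def matCoeff (n : ℕ) (x y : Fin n × Fin n × Irr m) : Fin n × Fin n × Irr m →₀ ℤ :=
  if x.2.1 = y.1 then
    (tensorCoeff x.2.2 y.2.2).embDomain
      ⟨fun s => (x.1, y.2.1, s), fun _ _ h => by simpa using h⟩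
  else 0

/-- The ring `J_c`, with basis the triples `(j,l,s)`; it is the ring of `n × n` matrices over the
representation ring, `(j,l,s)` being the matrix with `s` in position `(j,l)` and zero elsewhere. -/
abbrev MatRing (n : ℕ) : Type := StructAlg (matCoeff m n)

end Rep

section P4

variable {A : Type*} [NonUnitalRing A] [Module K A] (i : KInvolution K A)
  {ι : Type*} (β : Module.Basis ι K A)

/-- The labelling `E : b ↦ (j,l,s)` of the 2-cell `c` by `{1,…,n}² × Irr G`, where `G` is the
product of the `GL_{m q}(ℂ)`, has the properties (a) and (b) required in property `P₄`. -/
structure IsLabelling (c : Set ι) (n : ℕ) {r : ℕ} (m : Fin r → ℕ)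
    (E : c ≃ Fin n × Fin n × Irr m) : Prop where
  card_eq : ∃ D : Finset c, IsUnitSet β c D ∧ D.card = n
  invol : ∀ b : c, ∃ b' : c, i (β b) = β b' ∧
    (E b').1 = (E b).2.1 ∧ (E b').2.1 = (E b).1 ∧ IsDual (E b).2.2 (E b').2.2
  asym : ∃ F : AsymRing β c ≃+* MatRing m n,
    ∀ b : c, F (tElt β c b) = StructAlg.of (matCoeff m n) (E b)

/-- Property `P₄`. -/
def PropertyP4 : Prop :=
  ∀ c ∈ twoCells β, ∃ (n r : ℕ) (m : Fin r → ℕ) (E : c ≃ Fin n × Fin n × Irr m),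
    IsLabelling i β c n m E

/-- The algebra `A_c` of the 2-cell `c` is the generalized matrix algebra `(M_n(k ⊗ R), Ψ)`, that
is, matrices with the product `x Ψ y`, where `R` is the representation ring of `G` (a finitely
generated commutative ring). The basis element `b` with label `(j,l,s)` is the
matrix with entry `s` at `(j,l)`, and its image under `i` is the matrix with entry `σ s` at
`(l,j)`, where `σ` is the involution of `R` with `σ s` the dual of `s`. -/
def IsGenMatrixCell (c : Set ι) (n : ℕ) {r : ℕ} (m : Fin r → ℕ)
    (E : c ≃ Fin n × Fin n × Irr m) : Prop :=
  ∃ (R : Type) (_ : CommRing R) (_ : Algebra.FiniteType ℤ R) (ψ : RepRing m ≃+* R)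
    (σ : KInvolution ℤ R)
    (Ψ : Matrix (Fin n) (Fin n) (K ⊗[ℤ] R))
    (Θ : CellAlg β c ≃ₗ[K] Matrix (Fin n) (Fin n) (K ⊗[ℤ] R)),
    (∀ s t : Irr m, IsDual s t →
      σ (ψ (StructAlg.of tensorCoeff s)) = ψ (StructAlg.of tensorCoeff t)) ∧
    (∀ x y : CellAlg β c, Θ (x * y) = Θ x * Ψ * Θ y) ∧
    (∀ b : c, Θ (StructAlg.of (cellCoeff β c) b) =
      Matrix.single (E b).1 (E b).2.1 (1 ⊗ₜ ψ (StructAlg.of tensorCoeff (E b).2.2))) ∧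
    (∀ b b' : c, i (β b) = β b' → Θ (StructAlg.of (cellCoeff β c) b') =
      Matrix.single (E b).2.1 (E b).1 (1 ⊗ₜ σ (ψ (StructAlg.of tensorCoeff (E b).2.2))))

end P4

end CellTheory

end

open CellTheory

/-! Fix a 2-cell `c` with a labelling and let `R` be the representation ring of its group. By P₄(b)
the asymptotic ring of `c`, with scalars extended to `K`, is the matrix ring over `K ⊗ R`; in
particular it has an identity. P₃ says that the left action of `A` on the span of `c`, taken modulo
the other basis elements, commutes with right multiplication in the asymptotic ring, and
symmetrically for the right action. A map commuting with all right multiplications of a unital ring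
is left multiplication by its value at the identity. Hence `a : A` acts on the cell by a matrix
`leftMat a` on the left and by a matrix `rightMat a` on the right (`IsLabelling.cellTheta_cellLeft`,
`IsLabelling.cellTheta_cellRight`), and the product of the cell algebra is `x Ψ y`, where `Ψ` is the
right matrix of the element of the cell corresponding to the identity matrix.

By P₄(a) the involution `i` becomes the `σ`-transpose of matrices, so `rightMat a` is the
`σ`-transpose of `leftMat (i a)` (`IsLabelling.rightMat_eq`). As matrices over `B` form the tensor
product `Δ ⊗_B Δ'` of two free modules of rank `n`, these formulas are the axioms of an affine cell
ideal (`isAffineCellIdeal_of_matrix`). Downward closed sets of basis elements span two-sided ideals,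
so an increasing numbering of the cells yields the cell chain. The same data serve over `ℤ`, because
`K` is a finitely generated ring.

This needs `R` to be a finitely generated commutative ring on which duality is an involution.
Characters restricted to the diagonal torus embed `R` in the integral Laurent polynomials
(`charMap_injective`, `charRing_le_torusRing`). The latter are integral over the image, by exterior
powers and inverse determinants, and the Artin–Tate lemma applies (`charRing_finiteType`). Duality
becomes inversion on the torus.

For the identity of `A` it suffices that `X` is finite. Each `1_λ` lying in `c` must occur in the
identity of the asymptotic ring of `c`, which has finite support, and there are finitely many cells.
-/

noncomputable section

namespace CellTheory

universe u w

/-! ## Traces of module actions -/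

section ActTrace

variable (k : Type*) {H : Type*} [Field k] [Ring H] [Algebra k H]
  (N : Type*) [AddCommGroup N] [Module k N] [Module H N] [IsScalarTower k H N]

/-- The trace of the action of `x : H` on the `H`-module `N`. -/
def actTrace (x : H) : k := LinearMap.trace k N (Algebra.lsmul k k N x)

variable {N} in
theorem actTrace_congr {N' : Type*} [AddCommGroup N'] [Module k N'] [Module H N']
    [IsScalarTower k H N'] (e : N ≃ₗ[H] N') (x : H) : actTrace k N x = actTrace k N' x := by
  have := LinearMap.trace_conj' (Algebra.lsmul k k N x) (e.restrictScalars k)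
  rw [actTrace, actTrace, ← this]
  congr 1
  ext y
  simp [LinearEquiv.conj_apply]

/-- Composing `f` with the decomposition of the identity writes it as two composites; cyclicity of
the trace moves each of them to `P` and to `Q`. -/
theorem trace_eq_add_of_split {P Q N : Type*} [AddCommGroup P] [Module k P] [AddCommGroup Q]
    [Module k Q] [AddCommGroup N] [Module k N] [FiniteDimensional k P] [FiniteDimensional k Q]
    [FiniteDimensional k N] (a : P →ₗ[k] N) (r : N →ₗ[k] P) (p : N →ₗ[k] Q) (s : Q →ₗ[k] N)
    (h : a ∘ₗ r + s ∘ₗ p = LinearMap.id) (f : N →ₗ[k] N) :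
    LinearMap.trace k N f
      = LinearMap.trace k P (r ∘ₗ f ∘ₗ a) + LinearMap.trace k Q (p ∘ₗ f ∘ₗ s) := by
  have h1 : f = (f ∘ₗ a) ∘ₗ r + (f ∘ₗ s) ∘ₗ p := by
    rw [LinearMap.comp_assoc, LinearMap.comp_assoc, ← LinearMap.comp_add, h, LinearMap.comp_id]
  conv_lhs => rw [h1]
  rw [map_add, LinearMap.trace_comp_comm' (f ∘ₗ a) r, LinearMap.trace_comp_comm' (f ∘ₗ s) p]

/-- A `k`-linear section of the quotient map suffices. It need not be `H`-linear, since only the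
diagonal blocks contribute to the trace. -/
theorem actTrace_eq_add_quotient [FiniteDimensional k N] (P : Submodule H N) (x : H) :
    actTrace k N x = actTrace k P x + actTrace k (N ⧸ P) x := by
  have : FiniteDimensional k P :=
    FiniteDimensional.of_injective (P.subtype.restrictScalars k) Subtype.val_injective
  have : FiniteDimensional k (N ⧸ P) :=
    Module.Finite.of_surjective (P.mkQ.restrictScalars k) P.mkQ_surjective
  obtain ⟨s, hs⟩ := (P.mkQ.restrictScalars k).exists_rightInverse_of_surjective
    (LinearMap.range_eq_top.mpr P.mkQ_surjective)
  have hs' : ∀ y, P.mkQ (s y) = y := fun y => LinearMap.congr_fun hs y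
  let r : N →ₗ[k] P :=
    { toFun := fun y => ⟨y - s (P.mkQ y), by
        have : P.mkQ (y - s (P.mkQ y)) = 0 := by rw [map_sub, hs', sub_self]
        rwa [← LinearMap.mem_ker, Submodule.ker_mkQ] at this⟩
      map_add' := fun y z => by
        ext
        simp only [map_add, Submodule.coe_add]
        abel
      map_smul' := fun c y => by
        ext
        have : P.mkQ (c • y) = c • P.mkQ y := (P.mkQ.restrictScalars k).map_smul c y
        simp only [this, map_smul, RingHom.id_apply]
        exact (smul_sub c y _).symm }
  rw [actTrace, trace_eq_add_of_split k (P.subtype.restrictScalars k) r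
    (P.mkQ.restrictScalars k) s (by ext y; simp [r])]
  congr 1
  · rw [actTrace]
    congr 1
    ext y
    have : P.mkQ (x • (y : N)) = 0 := by
      rw [← LinearMap.mem_ker, Submodule.ker_mkQ]
      exact P.smul_mem x y.2
    simp only [LinearMap.comp_apply, r, LinearMap.coe_mk, AddHom.coe_mk,
      LinearMap.coe_restrictScalars, Submodule.subtype_apply, Algebra.lsmul_coe, this, map_zero,
      sub_zero, Submodule.coe_smul]
  · rw [actTrace]
    congr 1
    ext y
    simp only [LinearMap.comp_apply, LinearMap.coe_restrictScalars, Algebra.lsmul_coe, map_smul,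
      hs']

theorem sum_sub_eq_last_sub_zero {n : ℕ} (g : Fin (n + 1) → k) :
    ∑ j : Fin n, (g j.succ - g j.castSucc) = g (Fin.last n) - g 0 := by
  induction n with
  | zero => simp
  | succ n ih =>
    rw [Fin.sum_univ_castSucc]
    have := ih (fun j => g j.castSucc)
    simp only [Fin.succ_castSucc, Fin.succ_last, Fin.castSucc_zero] at this ⊢
    rw [this]
    ring

/-- By additivity the trace on each factor is a difference of traces on consecutive members of the
series, and the sum telescopes. -/
theorem actTrace_eq_sum_compositionSeries [FiniteDimensional k N]
    (S : CompositionSeries (Submodule H N)) (h0 : RelSeries.head S = ⊥)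
    (h1 : RelSeries.last S = ⊤) (x : H) :
    actTrace k N x = ∑ j : Fin S.length,
      actTrace k (↥(S j.succ) ⧸ (S j.castSucc).submoduleOf (S j.succ)) x := by
  have hfin : ∀ P : Submodule H N, FiniteDimensional k P := fun P =>
    FiniteDimensional.of_injective (P.subtype.restrictScalars k) Subtype.val_injective
  have hstep : ∀ j : Fin S.length,
      actTrace k (↥(S j.succ) ⧸ (S j.castSucc).submoduleOf (S j.succ)) x
        = actTrace k (S j.succ) x - actTrace k (S j.castSucc) x := fun j => by
    rw [actTrace_eq_add_quotient k (S j.succ) ((S j.castSucc).submoduleOf (S j.succ)) x,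
      actTrace_congr k (Submodule.submoduleOfEquivOfLe (S.strictMono.monotone
        (Fin.castSucc_lt_succ (i := j)).le)) x]
    ring
  simp_rw [hstep]
  rw [sum_sub_eq_last_sub_zero k (fun j => actTrace k (S j) x)]
  have e0 : S 0 = ⊥ := h0
  have e1 : S (Fin.last _) = ⊤ := h1
  rw [e0, e1, actTrace_congr k (Submodule.topEquiv (R := H) (M := N)) x]
  have : actTrace k (⊥ : Submodule H N) x = 0 := by
    rw [actTrace, Subsingleton.elim (Algebra.lsmul k k (⊥ : Submodule H N) x) 0, map_zero]
  rw [this, sub_zero]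

/-- Pairwise non-isomorphic simple modules admit an element acting as the identity on one of them
and as zero on the other ones. -/
theorem exists_smul_eq_ite {σ : Type*} [Finite σ] [DecidableEq σ] (M : σ → Type*)
    [∀ s, AddCommGroup (M s)] [∀ s, Module k (M s)] [∀ s, Module H (M s)]
    [∀ s, IsScalarTower k H (M s)] [∀ s, FiniteDimensional k (M s)]
    [∀ s, IsSimpleModule H (M s)] (hM : ∀ s t, Nonempty (M s ≃ₗ[H] M t) → s = t) (s₀ : σ) :
    ∃ x : H, ∀ s (y : M s), x • y = if s = s₀ then y else 0 := by
  have := Fintype.ofFinite σ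
  classical
  -- Schur's lemma: an off-diagonal component of an endomorphism is bijective or zero, and it cannot
  -- be bijective.
  have hg : ∀ (g : Module.End H (∀ s, M s)) (s t : σ), s ≠ t → ∀ y : M s,
      g (Pi.single s y) t = 0 := fun g s t hst y => by
    rcases ((LinearMap.proj t).comp (g.comp (LinearMap.single H M s))).bijective_or_eq_zero
      with h | h
    · exact absurd (hM s t ⟨LinearEquiv.ofBijective _ h⟩) hst
    · exact LinearMap.congr_fun h y
  have hsum : ∀ (g : Module.End H (∀ s, M s)) (y : ∀ s, M s) (t : σ),
      g y t = g (Pi.single t (y t)) t := fun g y t => by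
    conv_lhs => rw [← Finset.univ_sum_single y, map_sum, Finset.sum_apply]
    exact Finset.sum_eq_single t (fun s _ hs => hg g s t hs _) (by simp)
  -- Endomorphisms being diagonal, the projection to the component `s₀` commutes with all of them,
  -- so the density theorem applies to it. Density on a finite `k`-basis determines the action
  -- everywhere.
  let f : Module.End (Module.End H (∀ s, M s)) (∀ s, M s) :=
    { toFun := fun y => Pi.single s₀ (y s₀)
      map_add' := fun y z => by rw [Pi.add_apply, Pi.single_add]
      map_smul' := fun g y => by
        ext t
        simp only [Module.End.smul_def, RingHom.id_apply]
        by_cases ht : t = s₀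
        · subst ht
          rw [Pi.single_eq_same, hsum g y t]
        · rw [Pi.single_eq_of_ne ht, hg g s₀ t (Ne.symm ht)] }
  let b := Module.finBasis k (∀ s, M s)
  obtain ⟨x, hx⟩ := jacobson_density f (Finset.univ.image b)
  have hx' : ∀ y, f y = x • y := fun y => by
    have h1 : (LinearMap.single k M s₀ ∘ₗ LinearMap.proj s₀ : (∀ s, M s) →ₗ[k] ∀ s, M s)
        = Algebra.lsmul k k _ x :=
      b.ext fun j => hx (b j) (Finset.mem_image_of_mem _ (Finset.mem_univ j))
    exact LinearMap.congr_fun h1 y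
  refine ⟨x, fun s y => ?_⟩
  have := congrFun (hx' (Pi.single s y)) s
  rw [Pi.smul_apply, Pi.single_eq_same] at this
  rw [← this]
  change Pi.single s₀ _ s = _
  split_ifs with h
  · subst h
    simp
  · exact Pi.single_eq_of_ne h _

/-- Evaluating a relation at an element that acts as the identity on `M s` and as zero on the other
modules involved leaves the coefficient of `s` times `dim M s`, which is nonzero in characteristic
zero. -/
theorem linearIndependent_actTrace [CharZero k] {σ : Type*} (M : σ → Type*)
    [∀ s, AddCommGroup (M s)] [∀ s, Module k (M s)] [∀ s, Module H (M s)]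
    [∀ s, IsScalarTower k H (M s)] [∀ s, FiniteDimensional k (M s)]
    [∀ s, IsSimpleModule H (M s)] (hM : ∀ s t, Nonempty (M s ≃ₗ[H] M t) → s = t) :
    LinearIndependent k (fun s (x : H) => actTrace k (M s) x) := by
  classical
  rw [linearIndependent_iff']
  intro S z hz s hs
  obtain ⟨x, hx⟩ := exists_smul_eq_ite k (fun t : S => M t) (H := H)
    (fun t t' h => Subtype.ext (hM t t' h)) ⟨s, hs⟩
  have h1 : ∀ t : S, actTrace k (M t) x
      = if t = ⟨s, hs⟩ then (Module.finrank k (M t) : k) else 0 := fun t => by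
    rw [actTrace]
    split_ifs with h
    · rw [← LinearMap.trace_id]
      congr 1
      ext y
      simp [hx t y, h]
    · rw [← map_zero (LinearMap.trace k (M t))]
      congr 1
      ext y
      simp [hx t y, h]
  have h2 := congrFun hz x
  rw [Finset.sum_apply, ← Finset.sum_coe_sort] at h2
  simp only [Pi.smul_apply, h1, smul_eq_mul, mul_ite, mul_zero, Pi.zero_apply,
    Finset.sum_ite_eq', Finset.mem_univ, if_true] at h2
  have : Nontrivial (M s) := IsSimpleModule.nontrivial H (M s)
  exact (mul_eq_zero.mp h2).resolve_right
    (Nat.cast_ne_zero.mpr (Module.finrank_pos (R := k) (M := M s)).ne')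

end ActTrace

/-! ## Triangular form -/

/-- An eigenvector of the transpose is a linear form with invariant kernel. Induction gives a basis
of this hyperplane; a vector outside it is put first, so that the later columns have no component
along it. -/
theorem exists_basis_lowerTriangular {k : Type*} [Field k] [IsAlgClosed k] (n : ℕ) :
    ∀ (V : Type*) [AddCommGroup V] [Module k V] [FiniteDimensional k V],
      Module.finrank k V = n → ∀ f : V →ₗ[k] V,
        ∃ b : Module.Basis (Fin n) k V, ∀ i j, i < j → b.repr (f (b j)) i = 0 := by
  induction n with
  | zero =>
    intro V _ _ _ hV f
    exact ⟨Module.finBasisOfFinrankEq k V hV, fun i => i.elim0⟩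
  | succ n ih =>
    intro V _ _ _ hV f
    have : Nontrivial V := Module.nontrivial_of_finrank_pos (R := k) (by omega)
    obtain ⟨c, hc⟩ := Module.End.exists_eigenvalue (Module.Dual.transpose (R := k) f)
    obtain ⟨φ, hφ⟩ := hc.exists_hasEigenvector
    have hφf : ∀ x, φ (f x) = c * φ x := fun x => LinearMap.congr_fun hφ.apply_eq_smul x
    obtain ⟨y, hy⟩ : ∃ y, φ y ≠ 0 := by
      by_contra! h
      exact hφ.2 (LinearMap.ext h)
    have hN : Module.finrank k (LinearMap.ker φ) = n := by
      have h1 := φ.finrank_range_add_finrank_ker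
      have h2 : LinearMap.range φ = ⊤ := by
        refine LinearMap.range_eq_top.mpr fun z => ⟨(z / φ y) • y, ?_⟩
        rw [map_smul, smul_eq_mul, div_mul_cancel₀ _ hy]
      rw [h2, finrank_top, Module.finrank_self] at h1
      omega
    have hf : ∀ x ∈ LinearMap.ker φ, f x ∈ LinearMap.ker φ := fun x hx => by
      rw [LinearMap.mem_ker] at hx ⊢
      rw [hφf, hx, mul_zero]
    obtain ⟨b, hb⟩ := ih _ hN (f.restrict hf)
    let B : Module.Basis (Fin (n + 1)) k V := Module.Basis.mkFinCons y b
      (fun d x hx h => by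
        have := congrArg φ h
        rw [map_add, LinearMap.mem_ker.mp hx, map_smul, add_zero, map_zero, smul_eq_mul] at this
        exact (mul_eq_zero.mp this).resolve_right hy)
      (fun z => ⟨-(φ z / φ y), by
        rw [LinearMap.mem_ker, map_add, map_smul, smul_eq_mul, neg_mul, div_mul_cancel₀ _ hy,
          add_neg_cancel]⟩)
    have hB : ∀ j, B (Fin.succ j) = b j := fun j => by
      simp [B]
    have hrepr : ∀ x : LinearMap.ker φ, B.repr x = ∑ j, b.repr x j • Finsupp.single j.succ 1 :=
      fun x => by
        conv_lhs => rw [← b.sum_repr x]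
        simp only [Submodule.coe_sum, Submodule.coe_smul, ← hB, map_sum, map_smul,
          Module.Basis.repr_self]
    refine ⟨B, fun i j hij => ?_⟩
    induction j using Fin.cases with
    | zero => exact absurd hij (Fin.not_lt_zero i)
    | succ j =>
      have h1 : f (B j.succ) = (f.restrict hf (b j) : V) := by
        rw [hB]
        rfl
      rw [h1, hrepr, Finsupp.finsetSum_apply]
      refine Finset.sum_eq_zero fun l _ => ?_
      induction i using Fin.cases with
      | zero => simp
      | succ i =>
        rw [Finsupp.smul_apply, Finsupp.single_apply]
        split_ifs with h
        · rw [Fin.succ_injective _ h, hb i j (Fin.succ_lt_succ_iff.mp hij), zero_smul]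
        · rw [smul_zero]

theorem exists_conj_lowerTriangular {n : ℕ} (M : Matrix (Fin n) (Fin n) ℂ) :
    ∃ P : GL (Fin n) ℂ, ∀ i j, i < j →
      ((P : Matrix (Fin n) (Fin n) ℂ) * M * ((P⁻¹ : GL (Fin n) ℂ) : Matrix (Fin n) (Fin n) ℂ)) i j
        = 0 := by
  obtain ⟨b, hb⟩ := exists_basis_lowerTriangular n (Fin n → ℂ) (Module.finrank_fin_fun ℂ)
    (Matrix.toLin' M)
  let e := Pi.basisFun ℂ (Fin n)
  refine ⟨⟨b.toMatrix e, e.toMatrix b, b.toMatrix_mul_toMatrix_flip e,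
    e.toMatrix_mul_toMatrix_flip b⟩, fun i j hij => ?_⟩
  have h1 : M = LinearMap.toMatrix e e (Matrix.toLin' M) := by
    simp only [e, LinearMap.toMatrix_eq_toMatrix', LinearMap.toMatrix'_toLin']
  change (b.toMatrix e * M * e.toMatrix b) i j = 0
  conv_lhs => rw [h1]
  rw [basis_toMatrix_mul_linearMap_toMatrix_mul_basis_toMatrix, LinearMap.toMatrix_apply]
  exact hb i j hij

/-! ## The diagonal torus and regular functions -/

section Torus

variable {r : ℕ} (m : Fin r → ℕ)

/-- The torus of diagonal matrices in `GLProd m`. -/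
abbrev Torus : Type := ∀ q : Fin r, (Fin (m q) → ℂ)ˣ

/-- The embedding of the torus of diagonal matrices. -/
def torusHom : Torus m →* GLProd m where
  toFun t q := Units.map (Matrix.diagonalRingHom (Fin (m q)) ℂ).toMonoidHom (t q)
  map_one' := by
    ext q : 1
    exact map_one _
  map_mul' s t := by
    ext q : 1
    exact map_mul _ _ _

variable {m}

theorem coe_torusHom (t : Torus m) (q : Fin r) :
    (torusHom m t q : Matrix (Fin (m q)) (Fin (m q)) ℂ) = Matrix.diagonal (t q : Fin (m q) → ℂ) :=
  rfl

theorem coe_torusHom_inv (t : Torus m) (q : Fin r) :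
    (((torusHom m t)⁻¹ : GLProd m) q : Matrix (Fin (m q)) (Fin (m q)) ℂ)
      = Matrix.diagonal (((t q)⁻¹ : (Fin (m q) → ℂ)ˣ) : Fin (m q) → ℂ) := by
  rw [← map_inv]
  rfl

/-- The cocharacter of the torus with entries `z ^ a`. -/
def powTorus (z : ℂˣ) : Torus m := fun _ =>
  ⟨fun a => (z : ℂ) ^ (a : ℕ), fun a => ((z⁻¹ : ℂˣ) : ℂ) ^ (a : ℕ), by
    ext a; simp, by ext a; simp⟩

-- Regular functions are continuous for entrywise convergence. The inverse determinants cause no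
-- trouble, because the limit is again invertible.
open Filter Topology in
theorem tendsto_of_mem_regularFunctions {f : GLProd m → ℂ} (hf : f ∈ regularFunctions m)
    {u : ℕ → GLProd m} {g : GLProd m}
    (hentry : ∀ q a b, Tendsto (fun n => (u n q : Matrix (Fin (m q)) (Fin (m q)) ℂ) a b) atTop
      (𝓝 ((g q : Matrix (Fin (m q)) (Fin (m q)) ℂ) a b))) :
    Tendsto (fun n => f (u n)) atTop (𝓝 (f g)) := by
  induction hf using Algebra.adjoin_induction with
  | mem f hf =>
    rcases hf with ⟨q, a, b, rfl⟩ | ⟨q, rfl⟩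
    · exact hentry q a b
    · refine Tendsto.inv₀ ?_ ?_
      · have h1 : Tendsto (fun n => (u n q : Matrix (Fin (m q)) (Fin (m q)) ℂ)) atTop
            (𝓝 (g q : Matrix (Fin (m q)) (Fin (m q)) ℂ)) :=
          tendsto_pi_nhds.mpr fun a => tendsto_pi_nhds.mpr fun b => hentry q a b
        exact ((Continuous.matrix_det continuous_id).tendsto _).comp h1
      · exact ((Matrix.isUnit_iff_isUnit_det _).mp (g q).isUnit).ne_zero
  | algebraMap c => exact tendsto_const_nhds
  | add f g _ _ hf hg => exact hf.add hg
  | mul f g _ _ hf hg => exact hf.mul hg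

open Filter Topology in
/-- A conjugation invariant regular function is determined by its restriction to the torus. -/
theorem exists_torus_eq (g : GLProd m) : ∃ t : Torus m, ∀ f ∈ regularFunctions m,
    (∀ x y, f (x * y * x⁻¹) = f y) → f g = f (torusHom m t) := by
  choose P hP using fun q => exists_conj_lowerTriangular (g q : Matrix (Fin (m q)) (Fin (m q)) ℂ)
  let h : GLProd m := P * g * P⁻¹
  have hlow : ∀ q i j, i < j → (h q : Matrix (Fin (m q)) (Fin (m q)) ℂ) i j = 0 :=
    fun q i j hij => hP q i j hij
  have hdiag : ∀ q a, (h q : Matrix (Fin (m q)) (Fin (m q)) ℂ) a a ≠ 0 := fun q => by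
    have h1 := ((Matrix.isUnit_iff_isUnit_det _).mp (h q).isUnit).ne_zero
    rw [Matrix.det_of_isLowerTriangular _ fun i j hij => hlow q i j hij] at h1
    exact fun a => Finset.prod_ne_zero_iff.mp h1 a (Finset.mem_univ a)
  let t : Torus m := fun q => ⟨fun a => (h q : Matrix (Fin (m q)) (Fin (m q)) ℂ) a a,
    fun a => ((h q : Matrix (Fin (m q)) (Fin (m q)) ℂ) a a)⁻¹,
    by ext a; simp [hdiag], by ext a; simp [hdiag]⟩
  refine ⟨t, fun f hf hconj => ?_⟩
  -- Conjugation by the diagonal matrix with entries `z ^ (n * a)` multiplies the entry `(a, b)` by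
  -- `z ^ (n * (a - b))`. For `|z| < 1` the part strictly below the diagonal tends to zero and the
  -- diagonal stays, so the conjugates of `h` converge to its diagonal part while `f` stays constant
  -- on them.
  let z : ℂˣ := Units.mk0 (1 / 2) (by norm_num)
  let u : ℕ → GLProd m := fun n =>
    torusHom m (powTorus (z ^ n)) * h * (torusHom m (powTorus (z ^ n)))⁻¹
  have h1 : ∀ n, f (u n) = f g := fun n => by rw [hconj, hconj]
  have h2 : Tendsto (fun n => f (u n)) atTop (𝓝 (f (torusHom m t))) := by
    refine tendsto_of_mem_regularFunctions hf fun q a b => ?_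
    have hu : ∀ n, (u n q : Matrix (Fin (m q)) (Fin (m q)) ℂ) a b
        = ((z : ℂ) ^ n) ^ (a : ℕ) * (h q : Matrix (Fin (m q)) (Fin (m q)) ℂ) a b
          * (((z : ℂ) ^ n)⁻¹) ^ (b : ℕ) := fun n => by
      simp only [u, Pi.mul_apply, Units.val_mul]
      rw [coe_torusHom, coe_torusHom_inv, Matrix.mul_diagonal, Matrix.diagonal_mul]
      simp [powTorus]
    simp only [hu]
    rw [coe_torusHom]
    rcases lt_trichotomy a b with hab | rfl | hab
    · rw [hlow q a b hab, Matrix.diagonal_apply_ne _ hab.ne]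
      simp
    · rw [Matrix.diagonal_apply_eq]
      refine tendsto_const_nhds.congr fun n => ?_
      have : ((z : ℂ) ^ n) ^ (a : ℕ) ≠ 0 := pow_ne_zero _ (pow_ne_zero _ z.ne_zero)
      change (h q : Matrix (Fin (m q)) (Fin (m q)) ℂ) a a = _
      rw [inv_pow]
      field_simp
    · rw [Matrix.diagonal_apply_ne _ hab.ne']
      have hz : Tendsto (fun n : ℕ => ((z : ℂ) ^ ((a : ℕ) - (b : ℕ))) ^ n) atTop (𝓝 0) := by
        refine tendsto_pow_atTop_nhds_zero_of_norm_lt_one ?_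
        have hab' : (a : ℕ) - (b : ℕ) ≠ 0 := Nat.sub_ne_zero_of_lt hab
        rw [norm_pow]
        refine pow_lt_one₀ (norm_nonneg _) ?_ hab'
        simp only [z, Units.val_mk0]
        norm_num
      have := hz.mul_const ((h q : Matrix (Fin (m q)) (Fin (m q)) ℂ) a b)
      rw [zero_mul] at this
      refine this.congr fun n => ?_
      have hne : (z : ℂ) ≠ 0 := z.ne_zero
      rw [pow_sub₀ _ hne (le_of_lt hab), mul_pow, inv_pow, inv_pow, ← pow_mul, ← pow_mul,
        ← pow_mul, ← pow_mul, mul_comm (b : ℕ) n, mul_comm (a : ℕ) n]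
      ring
  refine tendsto_nhds_unique ?_ h2
  simp only [h1]
  exact tendsto_const_nhds

theorem character_mem_regularFunctions {W : Type*} [AddCommGroup W] [Module ℂ W]
    [FiniteDimensional ℂ W] {ρ : Representation ℂ (GLProd m) W} (hρ : IsRational m ρ) :
    ρ.character ∈ regularFunctions m := by
  let b := Module.finBasis ℂ W
  have : ρ.character = ∑ j, fun g => b.coord j (ρ g (b j)) := by
    ext g
    rw [Representation.character, LinearMap.trace_eq_matrix_trace ℂ b, Matrix.trace,
      Finset.sum_apply]
    simp [LinearMap.toMatrix_apply]
  rw [this]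
  exact Subalgebra.sum_mem _ fun j _ => hρ _ _

theorem eq_zero_of_torus {f : GLProd m → ℂ} (hf : f ∈ regularFunctions m)
    (hc : ∀ x y, f (x * y * x⁻¹) = f y) (h : ∀ t, f (torusHom m t) = 0) : f = 0 := by
  ext g
  obtain ⟨t, ht⟩ := exists_torus_eq g
  rw [ht f hf hc, h]
  rfl

end Torus

/-! ### Weights of the torus and integrality of characters -/

section Weights

variable {r : ℕ} (m : Fin r → ℕ)

variable {m} in
/-- The coordinate functions on the torus. -/
def torusCoord (q : Fin r) (a : Fin (m q)) : Torus m →* ℂ :=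
  (Pi.evalMonoidHom (fun _ : Fin (m q) => ℂ) a).comp
    ((Units.coeHom (Fin (m q) → ℂ)).comp (Pi.evalMonoidHom (fun q => (Fin (m q) → ℂ)ˣ) q))

variable {m} in
/-- The inverses of the coordinate functions on the torus. -/
def torusCoordInv (q : Fin r) (a : Fin (m q)) : Torus m →* ℂ :=
  (torusCoord q a).comp invMonoidHom

variable {m} in
theorem torusCoord_apply (q : Fin r) (a : Fin (m q)) (t : Torus m) :
    torusCoord q a t = (t q : Fin (m q) → ℂ) a := rfl

variable {m} in
theorem torusCoordInv_apply (q : Fin r) (a : Fin (m q)) (t : Torus m) :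
    torusCoordInv q a t = (((t q)⁻¹ : (Fin (m q) → ℂ)ˣ) : Fin (m q) → ℂ) a := rfl

variable {m} in
theorem torusCoord_mul_inv (q : Fin r) (a : Fin (m q)) (t : Torus m) :
    torusCoord q a t * torusCoordInv q a t = 1 := by
  rw [torusCoord_apply, torusCoordInv_apply, ← Pi.mul_apply, Units.mul_inv, Pi.one_apply]

/-- The coordinates and their inverses. -/
def coordSet : Set (Torus m →* ℂ) :=
  {χ | ∃ (q : Fin r) (a : Fin (m q)), χ = torusCoord q a ∨ χ = torusCoordInv q a}

theorem coordSet_finite : (coordSet m).Finite := by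
  have : coordSet m =
      Set.range (fun p : Σ q : Fin r, Fin (m q) => torusCoord p.1 p.2) ∪
        Set.range (fun p : Σ q : Fin r, Fin (m q) => torusCoordInv p.1 p.2) := by
    ext χ
    constructor
    · rintro ⟨q, a, rfl | rfl⟩
      · exact Or.inl ⟨⟨q, a⟩, rfl⟩
      · exact Or.inr ⟨⟨q, a⟩, rfl⟩
    · rintro (⟨⟨q, a⟩, rfl⟩ | ⟨⟨q, a⟩, rfl⟩)
      · exact ⟨q, a, Or.inl rfl⟩
      · exact ⟨q, a, Or.inr rfl⟩
  rw [this]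
  exact (Set.finite_range _).union (Set.finite_range _)

/-- The ring of integral Laurent polynomials, as functions on the torus. -/
def torusRing : Subalgebra ℤ (Torus m → ℂ) :=
  Algebra.adjoin ℤ (MonoidHom.coeFn (Torus m) ℂ '' coordSet m)

/-- The group of weights of the torus. -/
def weights : Submonoid (Torus m →* ℂ) := Submonoid.closure (coordSet m)

variable {m}

theorem coe_mem_torusRing {χ : Torus m →* ℂ} (h : χ ∈ weights m) :
    (χ : Torus m → ℂ) ∈ torusRing m := by
  induction h using Submonoid.closure_induction with
  | mem χ hχ => exact Algebra.subset_adjoin ⟨χ, hχ, rfl⟩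
  | one => exact Subalgebra.one_mem _
  | mul χ χ' _ _ h h' => exact Subalgebra.mul_mem _ h h'

theorem adjoin_coordSet_eq_span :
    Subalgebra.toSubmodule (Algebra.adjoin ℂ (MonoidHom.coeFn (Torus m) ℂ '' coordSet m))
      = Submodule.span ℂ (MonoidHom.coeFn (Torus m) ℂ '' (weights m : Set (Torus m →* ℂ))) := by
  rw [Algebra.adjoin_eq_span, weights, ← MonoidHom.map_mclosure]
  rfl

/-- On diagonal matrices the entries restrict to coordinates or to zero, and an inverse determinant
restricts to a product of inverse coordinates. -/
theorem comp_torusHom_mem_span {f : GLProd m → ℂ} (hf : f ∈ regularFunctions m) :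
    (fun t => f (torusHom m t)) ∈
      Submodule.span ℂ (MonoidHom.coeFn (Torus m) ℂ '' (weights m : Set (Torus m →* ℂ))) := by
  rw [← adjoin_coordSet_eq_span, Subalgebra.mem_toSubmodule]
  have hc : ∀ χ ∈ coordSet m, (χ : Torus m → ℂ) ∈
      Algebra.adjoin ℂ (MonoidHom.coeFn (Torus m) ℂ '' coordSet m) :=
    fun χ hχ => Algebra.subset_adjoin ⟨χ, hχ, rfl⟩
  induction hf using Algebra.adjoin_induction with
  | mem f hf =>
    rcases hf with ⟨q, a, b, rfl⟩ | ⟨q, rfl⟩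
    · by_cases hab : a = b
      · subst hab
        convert hc _ ⟨q, a, Or.inl rfl⟩ using 1
        ext t
        beta_reduce
        rw [coe_torusHom, Matrix.diagonal_apply_eq, torusCoord_apply]
      · convert Subalgebra.zero_mem _ using 1
        ext t
        beta_reduce
        rw [coe_torusHom, Matrix.diagonal_apply_ne _ hab, Pi.zero_apply]
    · convert Subalgebra.prod_mem _ (fun (a : Fin (m q)) (_ : a ∈ Finset.univ) =>
        hc _ ⟨q, a, Or.inr rfl⟩) using 1
      ext t
      beta_reduce
      rw [coe_torusHom, Matrix.det_diagonal, Finset.prod_apply, ← Finset.prod_inv_distrib]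
      refine Finset.prod_congr rfl fun a _ => ?_
      exact inv_eq_of_mul_eq_one_right (torusCoord_mul_inv q a t)
  | algebraMap c => exact Subalgebra.algebraMap_mem _ c
  | add f g _ _ hf hg => exact Subalgebra.add_mem _ hf hg
  | mul f g _ _ hf hg => exact Subalgebra.mul_mem _ hf hg

/-- The trace of a projection is the dimension of its range. -/
theorem trace_of_isIdempotentElem {κ : Type*} [Fintype κ] [DecidableEq κ] {P : Matrix κ κ ℂ}
    (h : P * P = P) : ∃ n : ℕ, P.trace = n := by
  have h1 : IsIdempotentElem (Matrix.toLin' P) := by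
    change Matrix.toLin' P * Matrix.toLin' P = _
    rw [Module.End.mul_eq_comp, ← Matrix.toLin'_mul, h]
  refine ⟨Module.finrank ℂ (LinearMap.range (Matrix.toLin' P)), ?_⟩
  rw [← Matrix.trace_toLin'_eq, (LinearMap.IsIdempotentElem.isProj_range _ h1).trace]

/-- The character of a rational representation is, on the torus, an integral Laurent polynomial. -/
theorem character_torus_mem_torusRing {W : Type*} [AddCommGroup W] [Module ℂ W]
    [FiniteDimensional ℂ W] {ρ : Representation ℂ (GLProd m) W} (hρ : IsRational m ρ) :
    (fun t => ρ.character (torusHom m t)) ∈ torusRing m := by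
  classical
  let b := Module.finBasis ℂ W
  have hex : ∀ i j, ∃ c : (Torus m →* ℂ) →₀ ℂ, (c.support : Set (Torus m →* ℂ)) ⊆ weights m ∧
      ∀ t, b.coord i (ρ (torusHom m t) (b j)) = c.sum fun χ z => z * χ t := fun i j => by
    obtain ⟨c, hc, h⟩ := (Finsupp.mem_span_image_iff_linearCombination ℂ).mp
      (comp_torusHom_mem_span (hρ (b j) (b.coord i)))
    refine ⟨c, (Finsupp.mem_supported ℂ c).mp hc, fun t => ?_⟩
    rw [← congrFun h t, Finsupp.linearCombination_apply, Finsupp.sum, Finset.sum_apply]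
    rfl
  choose c hcs hc using hex
  let S : Finset (Torus m →* ℂ) :=
    Finset.univ.biUnion fun p : Fin (Module.finrank ℂ W) × Fin (Module.finrank ℂ W) =>
      (c p.1 p.2).support
  have hSw : ∀ χ ∈ S, χ ∈ weights m := fun χ hχ => by
    obtain ⟨p, _, hp⟩ := Finset.mem_biUnion.mp hχ
    exact hcs _ _ hp
  have hS : ∀ i j t, b.coord i (ρ (torusHom m t) (b j)) = ∑ χ ∈ S, c i j χ * χ t :=
    fun i j t => by
      rw [hc]
      exact Finsupp.sum_of_support_subset _ (fun χ hχ =>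
        Finset.mem_biUnion.mpr ⟨(i, j), Finset.mem_univ _, hχ⟩) _ (by simp)
  -- `P χ` collects the coefficients of `χ` in the matrix entries of the torus action. It turns out
  -- to be idempotent, so that its trace is a natural number.
  let P : (Torus m →* ℂ) → Matrix (Fin (Module.finrank ℂ W)) (Fin (Module.finrank ℂ W)) ℂ :=
    fun χ => Matrix.of fun i j => c i j χ
  have hM : ∀ t, LinearMap.toMatrix b b (ρ (torusHom m t)) = ∑ χ ∈ S, χ t • P χ := fun t => by
    ext i j
    rw [LinearMap.toMatrix_apply, Matrix.sum_apply, ← Module.Basis.coord_apply, hS]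
    exact Finset.sum_congr rfl fun χ _ => mul_comm _ _
  -- Dedekind's independence of characters permits comparing coefficients.
  have hind := linearIndependent_iff'.mp (linearIndependent_monoidHom (Torus m) ℂ) S
  have hmul : ∀ t t', ∑ χ ∈ S, χ t • χ t' • P χ = ∑ χ ∈ S, χ t • ∑ μ ∈ S, μ t' • (P χ * P μ) :=
    fun t t' => by
      have h1 := hM (t * t')
      rw [map_mul, map_mul, LinearMap.toMatrix_mul, hM, hM] at h1
      simp only [map_mul, mul_smul] at h1
      rw [← h1, Finset.sum_mul]
      refine Finset.sum_congr rfl fun χ _ => ?_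
      rw [smul_mul_assoc, Finset.mul_sum]
      simp only [mul_smul_comm]
  -- Multiplicativity of the action is compared first in the variable `t`, here, and then in `t'`;
  -- the coefficient of `χ` in the second comparison is the idempotency of `P χ`.
  have h1 : ∀ t', ∀ χ ∈ S, χ t' • P χ = ∑ μ ∈ S, μ t' • (P χ * P μ) := fun t' χ hχ => by
    ext i j
    rw [← sub_eq_zero]
    refine hind (fun χ => (χ t' • P χ) i j - (∑ μ ∈ S, μ t' • (P χ * P μ)) i j) ?_ χ hχ
    ext t
    have := congrFun (congrFun (hmul t t') i) j
    rw [Matrix.sum_apply, Matrix.sum_apply] at this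
    rw [Finset.sum_apply, Pi.zero_apply, ← sub_eq_zero.mpr this, ← Finset.sum_sub_distrib]
    refine Finset.sum_congr rfl fun χ _ => ?_
    simp only [Pi.smul_apply, smul_eq_mul, Matrix.smul_apply]
    ring
  have h2 : ∀ χ ∈ S, P χ * P χ = P χ := fun χ hχ => by
    ext i j
    have := hind (fun μ => (P χ * P μ) i j - if μ = χ then P χ i j else 0) (by
      ext t'
      have := congrFun (congrFun (h1 t' χ hχ) i) j
      rw [Matrix.sum_apply] at this
      rw [Finset.sum_apply, Pi.zero_apply]
      simp only [Pi.smul_apply, smul_eq_mul, Matrix.smul_apply, sub_mul, Finset.sum_sub_distrib,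
        ite_mul, zero_mul, Finset.sum_ite_eq', hχ, if_true] at this ⊢
      rw [sub_eq_zero, mul_comm, this]
      exact Finset.sum_congr rfl fun _ _ => mul_comm _ _) χ hχ
    simp only [if_true] at this
    exact sub_eq_zero.mp this
  have h3 : (fun t => ρ.character (torusHom m t)) = ∑ χ ∈ S, (P χ).trace • (χ : Torus m → ℂ) := by
    ext t
    rw [Representation.character, LinearMap.trace_eq_matrix_trace ℂ b, hM, Matrix.trace_sum,
      Finset.sum_apply]
    refine Finset.sum_congr rfl fun χ _ => ?_
    rw [Matrix.trace_smul, Pi.smul_apply, smul_eq_mul, smul_eq_mul, mul_comm]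
  rw [h3]
  refine Subalgebra.sum_mem _ fun χ hχ => ?_
  obtain ⟨n, hn⟩ := trace_of_isIdempotentElem (h2 χ hχ)
  rw [hn, Nat.cast_smul_eq_nsmul]
  exact nsmul_mem (coe_mem_torusRing (hSw χ hχ)) n

end Weights

/-! ## Characters of rational representations -/

section CharacterSum

variable {r : ℕ} {m : Fin r → ℕ}

theorem single_smul_asModule {W : Type*} [AddCommGroup W] [Module ℂ W]
    (ρ : Representation ℂ (GLProd m) W) (g : GLProd m) (x : ρ.asModule) :
    ρ.asModuleEquiv (MonoidAlgebra.single g (1 : ℂ) • x) = ρ g (ρ.asModuleEquiv x) := by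
  rw [Representation.asModuleEquiv_map_smul, Representation.asAlgebraHom_single_one]

theorem character_eq_actTrace {W : Type*} [AddCommGroup W] [Module ℂ W]
    (ρ : Representation ℂ (GLProd m) W) (g : GLProd m) :
    ρ.character g = actTrace ℂ ρ.asModule (MonoidAlgebra.single g (1 : ℂ)) := by
  rw [Representation.character, actTrace, ← LinearMap.trace_conj' _ ρ.asModuleEquiv]
  congr 1
  ext x
  change ρ g x = ρ.asModuleEquiv (MonoidAlgebra.single g (1 : ℂ) • ρ.asModuleEquiv.symm x)
  rw [single_smul_asModule, LinearEquiv.apply_symm_apply]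

/-- All matrix coefficients of the `ℂ[G]`-module `M` are regular functions. -/
def IsRationalModule (M : Type*) [AddCommGroup M] [Module ℂ M] [Module ℂ[GLProd m] M] : Prop :=
  ∀ (x : M) (f : Module.Dual ℂ M),
    (fun g : GLProd m => f (MonoidAlgebra.single g (1 : ℂ) • x)) ∈ regularFunctions m

theorem IsRational.asModule {W : Type*} [AddCommGroup W] [Module ℂ W]
    {ρ : Representation ℂ (GLProd m) W} (h : IsRational m ρ) :
    IsRationalModule (m := m) ρ.asModule := fun x f => by
  convert h (ρ.asModuleEquiv x) (f ∘ₗ ρ.asModuleEquiv.symm.toLinearMap) using 1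
  ext g
  change _ = f (ρ.asModuleEquiv.symm (ρ g (ρ.asModuleEquiv x)))
  rw [← single_smul_asModule, LinearEquiv.symm_apply_apply]

section

variable {M : Type*} [AddCommGroup M] [Module ℂ M] [Module ℂ[GLProd m] M]
  [IsScalarTower ℂ ℂ[GLProd m] M]

/-- Linear forms on a subspace extend to the whole space, so its matrix coefficients are among those
of `M`. -/
theorem IsRationalModule.submodule (h : IsRationalModule (m := m) M)
    (P : Submodule ℂ[GLProd m] M) : IsRationalModule (m := m) P := fun x f => by
  obtain ⟨f', hf'⟩ := LinearMap.exists_extend (p := P.restrictScalars ℂ) f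
  convert h x f' using 1
  ext g
  exact (LinearMap.congr_fun hf' _).symm

theorem IsRationalModule.quotient (h : IsRationalModule (m := m) M)
    (P : Submodule ℂ[GLProd m] M) : IsRationalModule (m := m) (M ⧸ P) := fun x f => by
  obtain ⟨y, rfl⟩ := P.mkQ_surjective x
  exact h y (f ∘ₗ P.mkQ.restrictScalars ℂ)

/-- The group elements span the group algebra, so equivariance need only be known for them. -/
theorem asAlgebraHom_smul_eq {M' : Type*} [AddCommGroup M'] [Module ℂ M']
    (ρ : Representation ℂ (GLProd m) M') (e : M →ₗ[ℂ] M')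
    (h : ∀ g x, e (MonoidAlgebra.single g (1 : ℂ) • x) = ρ g (e x)) (a : ℂ[GLProd m]) (x : M) :
    e (a • x) = ρ.asAlgebraHom a (e x) := by
  have h1 : ∀ y : M, (e ∘ₗ (Algebra.lsmul ℂ ℂ M a)) y = (ρ.asAlgebraHom a ∘ₗ e) y := fun y => by
    induction a using MonoidAlgebra.induction_linear with
    | zero => simp
    | add a b ha hb => simpa [add_smul] using congrArg₂ (· + ·) ha hb
    | single g c =>
      have : MonoidAlgebra.single g c = c • MonoidAlgebra.single g (1 : ℂ) := by simp
      change e (MonoidAlgebra.single g c • y) = ρ.asAlgebraHom (MonoidAlgebra.single g c) (e y)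
      rw [Representation.asAlgebraHom_single, this, smul_assoc, map_smul, h]
      rfl
  exact h1 x

/-- A simple finite-dimensional rational module is isomorphic to a chosen representative of an
isomorphism class. -/
theorem IsRationalModule.exists_irr [FiniteDimensional ℂ M] [IsSimpleModule ℂ[GLProd m] M]
    (h : IsRationalModule (m := m) M) :
    ∃ s : Irr m, Nonempty (M ≃ₗ[ℂ[GLProd m]] s.rep.asModule) := by
  -- The classes in `Irr m` are represented on spaces `ℂ^d`, so the action is transported there
  -- along a basis.
  let e : M ≃ₗ[ℂ] (Fin (Module.finrank ℂ M) → ℂ) := (Module.finBasis ℂ M).equivFun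
  let ρ : Representation ℂ (GLProd m) (Fin (Module.finrank ℂ M) → ℂ) :=
    { toFun := fun g => e.conj (Representation.ofModule' M g)
      map_one' := by
        rw [map_one]
        exact e.conj_id
      map_mul' := fun g g' => by
        rw [map_mul]
        exact e.conj_comp _ _ }
  have hρ : ∀ g x, e (MonoidAlgebra.single g (1 : ℂ) • x) = ρ g (e x) := fun g x => by
    change _ = e (Representation.ofModule' M g (e.symm (e x)))
    rw [LinearEquiv.symm_apply_apply]
    rfl
  let E : M ≃ₗ[ℂ[GLProd m]] ρ.asModule :=
    { toFun := fun x => ρ.asModuleEquiv.symm (e x)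
      invFun := fun x => e.symm (ρ.asModuleEquiv x)
      left_inv := fun x => by simp
      right_inv := fun x => by simp
      map_add' := fun x y => by simp
      map_smul' := fun a x => by
        rw [RingHom.id_apply, LinearEquiv.symm_apply_eq, Representation.asModuleEquiv_map_smul,
          LinearEquiv.apply_symm_apply]
        exact asAlgebraHom_smul_eq ρ e.toLinearMap hρ a x }
  have hirr : ρ.IsIrreducible := by
    rw [Representation.irreducible_iff_isSimpleModule_asModule]
    exact IsSimpleModule.congr E.symm
  have hrat : IsRational m ρ := fun x f => by
    convert h (e.symm x) (f ∘ₗ e.toLinearMap) using 1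
    ext g
    rw [LinearMap.comp_apply, LinearEquiv.coe_coe, hρ, LinearEquiv.apply_symm_apply]
  let S : IrrRep m := ⟨_, ρ, hrat, hirr⟩
  obtain ⟨e'⟩ := Quotient.exact (Quotient.out_eq (⟦S⟧ : Irr m))
  exact ⟨⟦S⟧, ⟨E.trans e'.symm⟩⟩

theorem finiteDimensional_submodule [FiniteDimensional ℂ M] (P : Submodule ℂ[GLProd m] M) :
    FiniteDimensional ℂ P :=
  FiniteDimensional.of_injective (P.subtype.restrictScalars ℂ) Subtype.val_injective

theorem finiteDimensional_quotient [FiniteDimensional ℂ M] (P : Submodule ℂ[GLProd m] M) :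
    FiniteDimensional ℂ (M ⧸ P) :=
  Module.Finite.of_surjective (P.mkQ.restrictScalars ℂ) P.mkQ_surjective

theorem IsRationalModule.exists_irr_of_covBy [FiniteDimensional ℂ M]
    (h : IsRationalModule (m := m) M) {P Q : Submodule ℂ[GLProd m] M} (hPQ : P ⋖ Q) :
    ∃ s : Irr m, Nonempty ((Q ⧸ P.submoduleOf Q) ≃ₗ[ℂ[GLProd m]] s.rep.asModule) := by
  have := finiteDimensional_submodule Q
  have := finiteDimensional_quotient (P.submoduleOf Q)
  have : IsSimpleModule ℂ[GLProd m] (Q ⧸ P.submoduleOf Q) :=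
    (covBy_iff_quot_is_simple hPQ.le).mp hPQ
  exact ((h.submodule Q).quotient _).exists_irr

end

theorem Irr.rep_isRational (s : Irr m) : IsRational m s.rep := (Quotient.out s).rational

instance (s : Irr m) : IsSimpleModule ℂ[GLProd m] s.rep.asModule :=
  (Representation.irreducible_iff_isSimpleModule_asModule _).mp (Quotient.out s).irreducible

theorem Irr.eq_of_equiv {s t : Irr m}
    (h : Nonempty (s.rep.asModule ≃ₗ[ℂ[GLProd m]] t.rep.asModule)) : s = t := by
  rw [← Quotient.out_eq s, ← Quotient.out_eq t]
  exact Quotient.sound h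

/-- The family of the multiplicities of the irreducible representations in `ρ`. -/
def multFinsupp {W : Type} [AddCommGroup W] [Module ℂ W] [FiniteDimensional ℂ W]
    (ρ : Representation ℂ (GLProd m) W) : Irr m →₀ ℤ :=
  Finsupp.ofSupportFinite (fun s => (multiplicity ρ s : ℤ)) (multiplicity_finite ρ)

theorem IsRational.exists_isFactor {W : Type} [AddCommGroup W] [Module ℂ W]
    [FiniteDimensional ℂ W] {ρ : Representation ℂ (GLProd m) W} (hρ : IsRational m ρ)
    (j : Fin (compSeries ρ).length) : ∃ s : Irr m, IsFactor ρ j s := by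
  have hfd : FiniteDimensional ℂ ρ.asModule := inferInstanceAs (FiniteDimensional ℂ W)
  exact hρ.asModule.exists_irr_of_covBy ((compSeries ρ).step j)

theorem multFinsupp_eq_sum_single {W : Type} [AddCommGroup W] [Module ℂ W]
    [FiniteDimensional ℂ W] {ρ : Representation ℂ (GLProd m) W}
    {s : Fin (compSeries ρ).length → Irr m} (hs : ∀ j, IsFactor ρ j (s j)) :
    multFinsupp ρ = ∑ j, Finsupp.single (s j) (1 : ℤ) := by
  classical
  ext t
  have h1 : ∀ j, IsFactor ρ j t ↔ s j = t :=
    fun j => ⟨fun h => IsFactor.eq (hs j) h, fun h => h ▸ hs j⟩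
  rw [Finsupp.finsetSum_apply]
  simp only [Finsupp.single_apply, Finset.sum_boole]
  change (multiplicity ρ t : ℤ) = _
  simp only [multiplicity, h1, Nat.card_eq_fintype_card, Fintype.card_subtype]

/-- Traces add up along the chosen composition series, and each factor, being simple and rational,
is isomorphic to a representative. Complete reducibility is not needed. -/
theorem character_eq_sum {W : Type} [AddCommGroup W] [Module ℂ W] [FiniteDimensional ℂ W]
    {ρ : Representation ℂ (GLProd m) W} (hρ : IsRational m ρ) (g : GLProd m) :
    ρ.character g = (multFinsupp ρ).sum fun s z => (z : ℂ) * s.rep.character g := by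
  have hfd : FiniteDimensional ℂ ρ.asModule := inferInstanceAs (FiniteDimensional ℂ W)
  have hS := (exists_compositionSeries ρ).choose_spec
  choose s hs using hρ.exists_isFactor
  have h1 : (multFinsupp ρ).sum (fun s z => (z : ℂ) * s.rep.character g)
      = ∑ j, (s j).rep.character g := by
    rw [multFinsupp_eq_sum_single hs,
      ← Finsupp.sum_finsetSum_index (by simp) (by intros; push_cast; ring)]
    exact Finset.sum_congr rfl fun j _ => by
      rw [Finsupp.sum_single_index (by simp), Int.cast_one, one_mul]
  rw [h1, character_eq_actTrace, actTrace_eq_sum_compositionSeries ℂ _ (compSeries ρ) hS.1 hS.2]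
  refine Finset.sum_congr rfl fun j _ => ?_
  rw [character_eq_actTrace]
  obtain ⟨e⟩ := hs j
  exact actTrace_congr ℂ e _

/-- In bases of the two factors, the matrix coefficients are linear combinations of products of
matrix coefficients of the factors. -/
theorem IsRational.tprod {W W' : Type*} [AddCommGroup W] [Module ℂ W] [AddCommGroup W']
    [Module ℂ W'] [FiniteDimensional ℂ W] [FiniteDimensional ℂ W']
    {ρ : Representation ℂ (GLProd m) W} {ρ' : Representation ℂ (GLProd m) W'}
    (h : IsRational m ρ) (h' : IsRational m ρ') : IsRational m (ρ.tprod ρ') := fun x f => by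
  induction x using TensorProduct.induction_on with
  | zero =>
    simp only [map_zero]
    exact Subalgebra.zero_mem (regularFunctions m)
  | add x y hx hy =>
    simp only [map_add]
    exact Subalgebra.add_mem _ hx hy
  | tmul w w' =>
    let b := Module.finBasis ℂ W
    let b' := Module.finBasis ℂ W'
    have : (fun g => f (ρ.tprod ρ' g (w ⊗ₜ[ℂ] w'))) = ∑ i, ∑ j, f (b i ⊗ₜ[ℂ] b' j) •
        ((fun g => b.coord i (ρ g w)) * fun g => b'.coord j (ρ' g w')) := by
      ext g
      rw [Representation.tprod_apply, TensorProduct.map_tmul]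
      conv_lhs => rw [← b.sum_repr (ρ g w), ← b'.sum_repr (ρ' g w')]
      simp only [TensorProduct.sum_tmul, TensorProduct.tmul_sum, map_sum, Finset.sum_apply,
        Pi.smul_apply, Pi.mul_apply, TensorProduct.smul_tmul_smul, map_smul, smul_eq_mul,
        Module.Basis.coord_apply]
      rw [Finset.sum_comm]
      refine Finset.sum_congr rfl fun i _ => Finset.sum_congr rfl fun j _ => mul_comm _ _
    rw [this]
    exact Subalgebra.sum_mem _ fun i _ => Subalgebra.sum_mem _ fun j _ =>
      Subalgebra.smul_mem _ (Subalgebra.mul_mem _ (h _ _) (h' _ _)) _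

end CharacterSum

/-! ## The character map on the representation ring -/

section CharMap

variable {r : ℕ} (m : Fin r → ℕ)

/-- The additive map from the representation ring to functions on the torus, given by
characters. -/
def charMap : RepRing m →ₗ[ℤ] (Torus m → ℂ) :=
  (Finsupp.linearCombination ℤ fun (s : Irr m) t => s.rep.character (torusHom m t) :
    (Irr m →₀ ℤ) →ₗ[ℤ] (Torus m → ℂ))

variable {m}

theorem charMap_of (s : Irr m) :
    charMap m (StructAlg.of tensorCoeff s) = fun t => s.rep.character (torusHom m t) := by
  change Finsupp.linearCombination ℤ _ (Finsupp.single s 1) = _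
  simp

theorem charMap_multFinsupp {W : Type} [AddCommGroup W] [Module ℂ W] [FiniteDimensional ℂ W]
    {ρ : Representation ℂ (GLProd m) W} (hρ : IsRational m ρ) :
    charMap m (multFinsupp ρ : Irr m →₀ ℤ) = fun t => ρ.character (torusHom m t) := by
  ext t
  rw [character_eq_sum hρ]
  change Finsupp.linearCombination ℤ
    (fun (s : Irr m) (t : Torus m) => s.rep.character (torusHom m t)) _ t = _
  rw [Finsupp.linearCombination_apply, Finsupp.sum, Finsupp.sum, Finset.sum_apply]
  simp

/-- On basis elements the multiplicities in the tensor product sum to its character, which is the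
product of the two characters. Together with injectivity this supplies the associativity and
commutativity of the representation ring. -/
theorem charMap_mul (x y : RepRing m) : charMap m (x * y) = charMap m x * charMap m y := by
  have h1 : ∀ s t : Irr m, charMap m (StructAlg.of tensorCoeff s * StructAlg.of tensorCoeff t)
      = charMap m (StructAlg.of tensorCoeff s) * charMap m (StructAlg.of tensorCoeff t) :=
    fun s t => by
      rw [StructAlg.of_mul_of, charMap_of, charMap_of]
      refine (charMap_multFinsupp (s.rep_isRational.tprod t.rep_isRational)).trans ?_
      rw [Representation.char_tensor]
      rfl
  let L : (Irr m →₀ ℤ) →ₗ[ℤ] (Irr m →₀ ℤ) →ₗ[ℤ] (Torus m → ℂ) :=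
    (StructAlg.mulHom tensorCoeff).compr₂ (charMap m)
  let L' : (Irr m →₀ ℤ) →ₗ[ℤ] (Irr m →₀ ℤ) →ₗ[ℤ] (Torus m → ℂ) :=
    (LinearMap.mul ℤ (Torus m → ℂ)).compl₁₂ (charMap m) (charMap m)
  have h2 : L = L' := by
    refine Finsupp.lhom_ext' fun s => LinearMap.ext_ring (Finsupp.lhom_ext' fun t =>
      LinearMap.ext_ring ?_)
    exact h1 s t
  exact LinearMap.congr_fun (LinearMap.congr_fun h2 x) y

theorem charMap_injective : Function.Injective (charMap m) := by
  rw [injective_iff_map_eq_zero]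
  intro c hc
  let c' : Irr m →₀ ℤ := c
  have hc' : ∀ t, ∑ s ∈ c'.support, (c' s : ℂ) * s.rep.character (torusHom m t) = 0 := fun t => by
    have := congrFun hc t
    change Finsupp.linearCombination ℤ
      (fun (s : Irr m) (t : Torus m) => s.rep.character (torusHom m t)) c' t = _ at this
    rw [Finsupp.linearCombination_apply, Finsupp.sum, Finset.sum_apply] at this
    simpa using this
  -- A combination of characters is a conjugation invariant regular function, so vanishing on the
  -- torus propagates to the group. By linearity the traces then satisfy the same relation on the
  -- group algebra, where independence is available.
  have hreg : (∑ s ∈ c'.support, (c' s : ℂ) • s.rep.character) = 0 := by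
    refine eq_zero_of_torus (Subalgebra.sum_mem _ fun s _ => Subalgebra.smul_mem _
      (character_mem_regularFunctions s.rep_isRational) _) (fun x y => ?_) (fun t => ?_)
    · rw [Finset.sum_apply, Finset.sum_apply]
      refine Finset.sum_congr rfl fun s _ => ?_
      rw [Pi.smul_apply, Pi.smul_apply, Representation.char_mul_comm, inv_mul_cancel_left]
    · rw [Finset.sum_apply]
      exact hc' t
  have hind := linearIndependent_iff'.mp (linearIndependent_actTrace ℂ (H := ℂ[GLProd m])
    (fun s : Irr m => s.rep.asModule) fun s t h => Irr.eq_of_equiv h) c'.support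
    (fun s => (c' s : ℂ)) (by
      ext h
      rw [Finset.sum_apply, Pi.zero_apply]
      induction h using MonoidAlgebra.induction_linear with
      | zero => simp [actTrace]
      | add a b ha hb =>
        simp only [Pi.smul_apply, smul_eq_mul] at ha hb ⊢
        simp only [actTrace, map_add, mul_add, Finset.sum_add_distrib] at ha hb ⊢
        rw [ha, hb, add_zero]
      | single g z =>
        have h1 : MonoidAlgebra.single g z = z • MonoidAlgebra.single g (1 : ℂ) := by simp
        have h2 := congrFun hreg g
        rw [Finset.sum_apply] at h2
        simp only [Pi.smul_apply, smul_eq_mul, character_eq_actTrace, Pi.zero_apply] at h2 ⊢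
        rw [h1]
        simp only [actTrace, map_smul, smul_eq_mul] at h2 ⊢
        rw [← mul_zero z, ← h2, Finset.mul_sum]
        exact Finset.sum_congr rfl fun s _ => by ring)
  have : c' = 0 := Finsupp.ext fun s => by
    by_cases hs : s ∈ c'.support
    · exact_mod_cast hind s hs
    · exact Finsupp.notMem_support_iff.mp hs
  exact this

theorem isRational_trivial : IsRational m (Representation.trivial ℂ (GLProd m) ℂ) := fun x f => by
  simp only [Representation.trivial_apply]
  exact Subalgebra.algebraMap_mem _ (f x)

variable (m) in
/-- The ring of virtual characters of `GLProd m`, as functions on the torus. -/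
def charRing : Subalgebra ℤ (Torus m → ℂ) where
  carrier := Set.range (charMap m)
  mul_mem' := by
    rintro _ _ ⟨x, rfl⟩ ⟨y, rfl⟩
    exact ⟨x * y, charMap_mul x y⟩
  add_mem' := by
    rintro _ _ ⟨x, rfl⟩ ⟨y, rfl⟩
    exact ⟨x + y, map_add _ x y⟩
  algebraMap_mem' z := by
    -- The constant `z` is `z` times the character of the trivial representation.
    refine ⟨z • (multFinsupp (Representation.trivial ℂ (GLProd m) ℂ) : Irr m →₀ ℤ), ?_⟩
    refine ((charMap m).map_smul z _).trans ?_
    rw [charMap_multFinsupp isRational_trivial, Algebra.algebraMap_eq_smul_one]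
    congr 1
    ext t
    rw [Representation.character]
    change LinearMap.trace ℂ ℂ (LinearMap.id) = 1
    rw [LinearMap.trace_id]
    simp

theorem mem_charRing {W : Type} [AddCommGroup W] [Module ℂ W] [FiniteDimensional ℂ W]
    {ρ : Representation ℂ (GLProd m) W} (hρ : IsRational m ρ) :
    (fun t => ρ.character (torusHom m t)) ∈ charRing m :=
  ⟨_, charMap_multFinsupp hρ⟩

theorem charRing_le_torusRing : charRing m ≤ torusRing m := by
  rintro _ ⟨x, rfl⟩
  let x' : Irr m →₀ ℤ := x
  change Finsupp.linearCombination ℤ _ x' ∈ _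
  rw [Finsupp.linearCombination_apply]
  exact Subalgebra.sum_mem _ fun s _ => Subalgebra.smul_mem _
    (character_torus_mem_torusRing s.rep_isRational) _

variable (m) in
/-- The representation ring is isomorphic to the ring of virtual characters. -/
def repRingEquiv : RepRing m ≃+* charRing m :=
  { Equiv.ofInjective (charMap m) charMap_injective with
    map_mul' := fun x y => Subtype.ext (charMap_mul x y)
    map_add' := fun x y => Subtype.ext (map_add (charMap m) x y) }

end CharMap

/-! ### Finite generation of the character ring -/

section FiniteType

variable {r : ℕ} {m : Fin r → ℕ}

theorem entry_mem_regularFunctions (q : Fin r) (a b : Fin (m q)) :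
    (fun g : GLProd m => (g q : Matrix (Fin (m q)) (Fin (m q)) ℂ) a b) ∈ regularFunctions m :=
  Algebra.subset_adjoin (Or.inl ⟨q, a, b, rfl⟩)

theorem detInv_mem_regularFunctions (q : Fin r) :
    (fun g : GLProd m => ((g q : Matrix (Fin (m q)) (Fin (m q)) ℂ).det)⁻¹) ∈ regularFunctions m :=
  Algebra.subset_adjoin (Or.inr ⟨q, rfl⟩)

/-- The `j`-th exterior power of the natural representation of the `q`-th factor. -/
def extRep (q : Fin r) (j : ℕ) :
    Representation ℂ (GLProd m) (⋀[ℂ]^j (Fin (m q) → ℂ)) where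
  toFun g := exteriorPower.map j (Matrix.toLin' (g q : Matrix (Fin (m q)) (Fin (m q)) ℂ))
  map_one' := by
    rw [Pi.one_apply, Units.val_one, Matrix.toLin'_one, exteriorPower.map_id]
    rfl
  map_mul' g h := by
    rw [Pi.mul_apply, Units.val_mul, Matrix.toLin'_mul]
    exact exteriorPower.map_comp (n := j)
      (Matrix.toLin' (h q : Matrix (Fin (m q)) (Fin (m q)) ℂ))
      (Matrix.toLin' (g q : Matrix (Fin (m q)) (Fin (m q)) ℂ))

theorem extRep_apply (q : Fin r) (j : ℕ) (g : GLProd m) :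
    extRep q j g =
      exteriorPower.map j (Matrix.toLin' (g q : Matrix (Fin (m q)) (Fin (m q)) ℂ)) := rfl

/-- On a pure wedge, multilinear expansion in the standard basis gives a polynomial in the matrix
entries of the group element; pure wedges span. -/
theorem extRep_isRational (q : Fin r) (j : ℕ) : IsRational m (extRep (m := m) q j) := fun x f => by
  have hx : x ∈ Submodule.span ℂ (Set.range (exteriorPower.ιMulti ℂ j)) :=
    exteriorPower.ιMulti_span ℂ j (Fin (m q) → ℂ) ▸ Submodule.mem_top
  induction hx using Submodule.span_induction with
  | zero =>
    simp only [map_zero]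
    exact Subalgebra.zero_mem (regularFunctions m)
  | add x y _ _ hx hy =>
    simp only [map_add]
    exact Subalgebra.add_mem _ hx hy
  | smul c x _ hx =>
    simp only [map_smul]
    exact Subalgebra.smul_mem _ hx c
  | mem x hx =>
    obtain ⟨v, rfl⟩ := hx
    let F : MultilinearMap ℂ (fun _ : Fin j => Fin (m q) → ℂ) ℂ :=
      f.compMultilinearMap (exteriorPower.ιMulti ℂ j).toMultilinearMap
    have h1 : (fun g : GLProd m => f (extRep q j g (exteriorPower.ιMulti ℂ j v)))
        = ∑ p : Fin j → Fin (m q), F (fun i => Pi.single (p i) 1) •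
          ∏ i, (fun g : GLProd m =>
            ((g q : Matrix (Fin (m q)) (Fin (m q)) ℂ).mulVec (v i)) (p i)) := by
      ext g
      rw [extRep_apply, exteriorPower.map_apply_ιMulti]
      have h2 : (fun i => Matrix.toLin' (g q : Matrix (Fin (m q)) (Fin (m q)) ℂ) (v i))
          = fun i => ∑ a, ((g q : Matrix (Fin (m q)) (Fin (m q)) ℂ).mulVec (v i)) a •
            (Pi.single a 1 : Fin (m q) → ℂ) := by
        ext i : 1
        rw [Matrix.toLin'_apply]
        exact ((Pi.basisFun ℂ (Fin (m q))).sum_repr _).symm.trans (by simp)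
      change F (fun i => Matrix.toLin' (g q : Matrix (Fin (m q)) (Fin (m q)) ℂ) (v i)) = _
      rw [h2, MultilinearMap.map_sum, Finset.sum_apply]
      refine Finset.sum_congr rfl fun p _ => ?_
      rw [F.map_smul_univ, Pi.smul_apply, Finset.prod_apply, smul_eq_mul, smul_eq_mul, mul_comm]
    rw [h1]
    refine Subalgebra.sum_mem _ fun p _ => Subalgebra.smul_mem _ (Subalgebra.prod_mem _
      fun i _ => ?_) _
    have h3 : (fun g : GLProd m =>
          ((g q : Matrix (Fin (m q)) (Fin (m q)) ℂ).mulVec (v i)) (p i))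
        = ∑ b, v i b • fun g : GLProd m => (g q : Matrix (Fin (m q)) (Fin (m q)) ℂ) (p i) b := by
      ext g
      simp [Matrix.mulVec, dotProduct, mul_comm]
    rw [h3]
    exact Subalgebra.sum_mem _ fun b _ => Subalgebra.smul_mem _
      (entry_mem_regularFunctions q (p i) b) _

-- Wedges of distinct standard basis vectors are eigenvectors of the torus, with the product of the
-- corresponding coordinates as eigenvalue. The trace is therefore an elementary symmetric
-- polynomial.
open Finset in
theorem extRep_character_torus (q : Fin r) (j : ℕ) (t : Torus m) :
    (extRep q j).character (torusHom m t)
      = ∑ s ∈ Finset.powersetCard j (univ : Finset (Fin (m q))), ∏ a ∈ s, torusCoord q a t := by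
  let b := (Pi.basisFun ℂ (Fin (m q))).exteriorPower j
  have hb : ∀ s, extRep q j (torusHom m t) (b s)
      = (∏ a ∈ (s : Finset (Fin (m q))), torusCoord q a t) • b s := fun s => by
    rw [extRep_apply]
    simp only [b, exteriorPower.basis_apply]
    rw [exteriorPower.ιMulti_family, exteriorPower.map_apply_ιMulti]
    have h1 : (Matrix.toLin' (torusHom m t q : Matrix (Fin (m q)) (Fin (m q)) ℂ)) ∘
        (Pi.basisFun ℂ (Fin (m q)) ∘ Set.powersetCard.ofFinEmbEquiv.symm s)
        = fun i => torusCoord q (Set.powersetCard.ofFinEmbEquiv.symm s i) t •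
          (Pi.basisFun ℂ (Fin (m q)) ∘ Set.powersetCard.ofFinEmbEquiv.symm s) i := by
      ext i a
      rw [coe_torusHom]
      simp only [Function.comp_apply, Matrix.toLin'_apply, Pi.basisFun_apply,
        Matrix.mulVec_diagonal, Pi.smul_apply, smul_eq_mul, torusCoord_apply, Pi.single_apply]
      split_ifs with h
      · rw [h]
      · simp
    rw [h1]
    refine ((exteriorPower.ιMulti ℂ j).toMultilinearMap.map_smul_univ _ _).trans ?_
    congr 1
    rw [← Finset.prod_image (f := fun a => torusCoord q a t) (s := Finset.univ)
      (g := fun i => Set.powersetCard.ofFinEmbEquiv.symm s i)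
      (fun _ _ _ _ h => (Set.powersetCard.ofFinEmbEquiv.symm s).injective h)]
    refine Finset.prod_congr ?_ fun _ _ => rfl
    ext a
    simp only [Finset.mem_image, Finset.mem_univ, true_and]
    exact Set.powersetCard.mem_range_ofFinEmbEquiv_symm_iff_mem s a
  rw [Representation.character, LinearMap.trace_eq_matrix_trace ℂ b, Matrix.trace]
  have h2 : ∀ s : Set.powersetCard (Fin (m q)) j,
      (LinearMap.toMatrix b b (extRep q j (torusHom m t))).diag s
        = ∏ a ∈ (s : Finset (Fin (m q))), torusCoord q a t := fun s => by
    rw [Matrix.diag_apply, LinearMap.toMatrix_apply, hb]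
    simp
  simp only [h2]
  refine Finset.sum_bij (fun s _ => (s : Finset (Fin (m q)))) (fun s _ => ?_)
    (fun s _ s' _ h => Subtype.ext h) (fun s hs => ?_) (fun _ _ => rfl)
  · exact Finset.mem_powersetCard.mpr ⟨Finset.subset_univ _, Set.powersetCard.card_eq s⟩
  · exact ⟨⟨s, (Finset.mem_powersetCard.mp hs).2⟩, Finset.mem_univ _, rfl⟩

-- The coordinates of one factor are the roots of a monic polynomial whose coefficients are, up to
-- sign, elementary symmetric polynomials, hence characters of exterior powers.
open Finset Polynomial in
theorem isIntegral_torusCoord (q : Fin r) (a : Fin (m q)) :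
    IsIntegral (charRing m) (torusCoord q a : Torus m → ℂ) := by
  let x : Fin (m q) → (Torus m → ℂ) := fun a => torusCoord q a
  let M : Multiset (Torus m → ℂ) := (Finset.univ : Finset (Fin (m q))).val.map x
  let p : (Torus m → ℂ)[X] := (M.map fun y => X - C y).prod
  have hp : p.Monic := monic_multiset_prod_of_monic _ _ fun y _ => monic_X_sub_C y
  have hesymm : ∀ j, M.esymm j ∈ charRing m := fun j => by
    convert mem_charRing (extRep_isRational (m := m) q j) using 1
    ext t
    rw [extRep_character_torus, Finset.esymm_map_val, Finset.sum_apply]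
    simp only [Finset.prod_apply]
    rfl
  have hlift : p ∈ lifts (algebraMap (charRing m) (Torus m → ℂ)) := by
    rw [lifts_iff_coeff_lifts]
    intro k
    by_cases hk : k ≤ Multiset.card M
    · rw [Multiset.prod_X_sub_C_coeff M hk]
      exact ⟨⟨_, Subalgebra.mul_mem _ (Subalgebra.pow_mem _
        (Subalgebra.neg_mem _ (Subalgebra.one_mem _)) _) (hesymm _)⟩, rfl⟩
    · rw [coeff_eq_zero_of_natDegree_lt]
      · exact ⟨0, map_zero _⟩
      · rw [show p.natDegree = _ from natDegree_multiset_prod_X_sub_C_eq_card M]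
        omega
  obtain ⟨P, hP, -, hmonic⟩ := lifts_and_natDegree_eq_and_monic hlift hp
  refine ⟨P, hmonic, ?_⟩
  rw [← eval_map, hP, eval_multiset_prod]
  refine Multiset.prod_eq_zero (Multiset.mem_map.mpr ⟨X - C (x a), Multiset.mem_map.mpr
    ⟨x a, Multiset.mem_map.mpr ⟨a, Finset.mem_univ_val a, rfl⟩, rfl⟩, by simp [x]⟩)

/-- The inverse of the determinant of the `q`-th factor, as a representation. -/
def detInvRep (q : Fin r) : Representation ℂ (GLProd m) ℂ where
  toFun g := ((g q : Matrix (Fin (m q)) (Fin (m q)) ℂ).det)⁻¹ • LinearMap.id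
  map_one' := by
    rw [Pi.one_apply, Units.val_one, Matrix.det_one, inv_one, one_smul]
    rfl
  map_mul' g h := by
    rw [Pi.mul_apply, Units.val_mul, Matrix.det_mul]
    ext
    simp [mul_comm]

theorem detInvRep_isRational (q : Fin r) : IsRational m (detInvRep (m := m) q) := fun x f => by
  have : (fun g : GLProd m => f (detInvRep q g x))
      = f x • fun g : GLProd m => ((g q : Matrix (Fin (m q)) (Fin (m q)) ℂ).det)⁻¹ := by
    ext g
    change f (((g q : Matrix (Fin (m q)) (Fin (m q)) ℂ).det)⁻¹ • x) = _
    rw [map_smul, Pi.smul_apply, smul_eq_mul, smul_eq_mul, mul_comm]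
  rw [this]
  exact Subalgebra.smul_mem _ (detInv_mem_regularFunctions q) _

/-- An inverse coordinate is the inverse determinant, which is a character, times the product of the
other coordinates. -/
theorem isIntegral_torusCoordInv (q : Fin r) (a : Fin (m q)) :
    IsIntegral (charRing m) (torusCoordInv q a : Torus m → ℂ) := by
  have h1 : (torusCoordInv q a : Torus m → ℂ) =
      (fun t => (detInvRep q).character (torusHom m t)) *
        ∏ b ∈ Finset.univ.erase a, (torusCoord q b : Torus m → ℂ) := by
    ext t
    rw [Pi.mul_apply, Finset.prod_apply, Representation.character]
    change _ = LinearMap.trace ℂ ℂ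
      (((torusHom m t q : Matrix (Fin (m q)) (Fin (m q)) ℂ).det)⁻¹ • LinearMap.id) * _
    rw [map_smul, LinearMap.trace_id, coe_torusHom, Matrix.det_diagonal,
      ← Finset.mul_prod_erase Finset.univ _ (Finset.mem_univ a)]
    have h2 : ∀ b, (t q : Fin (m q) → ℂ) b ≠ 0 := fun b =>
      left_ne_zero_of_mul_eq_one (torusCoord_mul_inv q b t)
    have h3 : ∏ b ∈ Finset.univ.erase a, (t q : Fin (m q) → ℂ) b ≠ 0 :=
      Finset.prod_ne_zero_iff.mpr fun b _ => h2 b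
    have h4 : torusCoordInv q a t = ((t q : Fin (m q) → ℂ) a)⁻¹ :=
      (inv_eq_of_mul_eq_one_right (torusCoord_mul_inv q a t)).symm
    rw [h4]
    simp only [torusCoord_apply, Module.finrank_self, Nat.cast_one, smul_eq_mul, mul_one, mul_inv]
    rw [mul_assoc, inv_mul_cancel₀ h3, mul_one]
  rw [h1]
  refine IsIntegral.mul ?_ (IsIntegral.prod _ fun b _ => isIntegral_torusCoord q b)
  exact isIntegral_algebraMap
    (x := (⟨_, mem_charRing (detInvRep_isRational (m := m) q)⟩ : charRing m))

/-- Artin–Tate: `torusRing m` is finitely generated over the noetherian ring `ℤ`, and it is integral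
and of finite type, hence a finite module, over `charRing m`. -/
theorem charRing_finiteType : Algebra.FiniteType ℤ (charRing m) := by
  let _ : Algebra (charRing m) (torusRing m) :=
    (Subalgebra.inclusion (charRing_le_torusRing (m := m))).toRingHom.toAlgebra
  have : IsScalarTower ℤ (charRing m) (torusRing m) := inferInstance
  have htower : IsScalarTower (charRing m) (torusRing m) (Torus m → ℂ) :=
    IsScalarTower.of_algebraMap_eq fun _ => rfl
  have hC : Algebra.FiniteType ℤ (torusRing m) :=
    (Subalgebra.fg_iff_finiteType _).mp
      (Subalgebra.fg_def.mpr ⟨_, (coordSet_finite m).image _, rfl⟩)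
  have hint : Algebra.IsIntegral (charRing m) (torusRing m) := by
    have hle : torusRing m ≤ (integralClosure (charRing m) (Torus m → ℂ)).restrictScalars ℤ := by
      refine Algebra.adjoin_le ?_
      rintro _ ⟨χ, ⟨q, a, rfl | rfl⟩, rfl⟩
      · exact isIntegral_torusCoord q a
      · exact isIntegral_torusCoordInv q a
    refine ⟨fun x => ?_⟩
    have hx : IsIntegral (charRing m) (algebraMap (torusRing m) (Torus m → ℂ) x) := hle x.2
    exact (isIntegral_algebraMap_iff Subtype.val_injective).mp hx
  have : Algebra.FiniteType (charRing m) (torusRing m) :=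
    Algebra.FiniteType.of_restrictScalars_finiteType ℤ _ _
  have hfin : Module.Finite (charRing m) (torusRing m) := Algebra.IsIntegral.finite
  exact ⟨fg_of_fg_of_fg ℤ (charRing m) (torusRing m) hC.out hfin.fg_top
    (fun x y h => Subtype.ext (congrArg (Subtype.val : torusRing m → _) h))⟩

end FiniteType

/-! ### Duality as inversion on the torus -/

section Dual

variable {r : ℕ} {m : Fin r → ℕ}

theorem charMap_of_isDual {s t : Irr m} (h : IsDual s t) (x : Torus m) :
    charMap m (StructAlg.of tensorCoeff t) x = charMap m (StructAlg.of tensorCoeff s) x⁻¹ := by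
  obtain ⟨e⟩ := h
  simp only [charMap_of]
  rw [map_inv, ← Representation.char_dual, character_eq_actTrace, character_eq_actTrace]
  exact actTrace_congr ℂ e _

/-- The involution of the ring of virtual characters, given by duality. -/
def charInvolution (hdual : ∀ s : Irr m, ∃ t, IsDual s t) : KInvolution ℤ (charRing m) where
  -- For inversion of the argument, multiplicativity and involutivity are immediate; the stability
  -- of the character ring is where the dual classes are needed.
  toFun f := ⟨fun x => (f : Torus m → ℂ) x⁻¹, by
    obtain ⟨_, c, rfl⟩ := f
    have : ∀ c : Irr m →₀ ℤ, (fun x => charMap m c x⁻¹) ∈ charRing m := fun c => by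
      induction c using Finsupp.induction_linear with
      | zero =>
        convert Subalgebra.zero_mem (charRing m) using 1
        ext x
        exact congrFun (map_zero (charMap m)) _
      | add c d hc hd =>
        convert Subalgebra.add_mem _ hc hd using 1
        ext x
        exact congrFun (map_add (charMap m) _ _) _
      | single s z =>
        obtain ⟨t, ht⟩ := hdual s
        refine ⟨(z • StructAlg.of tensorCoeff t : RepRing m), ?_⟩
        ext x
        have h2 := charMap_of_isDual ht x
        have h3 : (Finsupp.single s z : Irr m →₀ ℤ) = z • Finsupp.single s 1 := by simp
        have h4 := congrFun ((charMap m).map_smul z (StructAlg.of tensorCoeff t)) x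
        have h5 := congrFun ((charMap m).map_smul z (StructAlg.of tensorCoeff s)) x⁻¹
        rw [h4, Pi.smul_apply, h2, h3]
        exact h5.symm
    exact this c⟩
  map_add' _ _ := rfl
  map_smul' _ _ := rfl
  map_mul_rev' f g := by
    ext x
    exact mul_comm _ _
  involutive' f := by
    ext x
    exact congrArg (f : Torus m → ℂ) (inv_inv x)

theorem charInvolution_repRingEquiv (hdual : ∀ s : Irr m, ∃ t, IsDual s t) {s t : Irr m}
    (h : IsDual s t) :
    charInvolution hdual (repRingEquiv m (StructAlg.of tensorCoeff s))
      = repRingEquiv m (StructAlg.of tensorCoeff t) := by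
  ext x
  exact (charMap_of_isDual h x).symm

end Dual

/-! ## Affine cell ideals given by matrices -/

theorem KInvolution.map_one {k B : Type*} [CommRing k] [Ring B] [Module k B]
    (σ : KInvolution k B) : σ 1 = 1 := by
  have h := σ.map_mul_rev' (σ 1) 1
  have h1 : σ (σ (1 : B)) = 1 := σ.involutive' 1
  have h2 : σ (σ (1 : B) * 1) = σ 1 * σ (σ 1) := h
  rw [mul_one, h1, mul_one] at h2
  exact h2.symm

section MatrixModel

variable {k : Type u} {B : Type u} [CommRing k] [CommRing B] [Algebra k B] (n : ℕ)

/-- The standard basis of `B ⊗ kⁿ`. -/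
def deltaBasis (k B : Type u) [CommRing k] [CommRing B] [Algebra k B] (n : ℕ) :
    Module.Basis (Fin n) B (B ⊗[k] (Fin n → k)) :=
  Algebra.TensorProduct.basis B (Pi.basisFun k (Fin n))

theorem deltaBasis_apply (p : Fin n) :
    deltaBasis k B n p = 1 ⊗ₜ[k] (Pi.single p 1 : Fin n → k) := by
  simp [deltaBasis]

variable (k B) in
/-- The matrix algebra is isomorphic to `Δ ⊗_B Δ'`. -/
def matrixEquivTensor :
    Matrix (Fin n) (Fin n) B ≃ₗ[B] (B ⊗[k] (Fin n → k)) ⊗[B] (B ⊗[k] (Fin n → k)) :=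
  (LinearEquiv.curry B B (Fin n) (Fin n)).symm.trans
    ((deltaBasis k B n).tensorProduct (deltaBasis k B n)).equivFun.symm

theorem matrixEquivTensor_single (p q : Fin n) (c : B) :
    matrixEquivTensor k B n (Matrix.single p q c)
      = c • (deltaBasis k B n p ⊗ₜ[B] deltaBasis k B n q) := by
  have : (LinearEquiv.curry B B (Fin n) (Fin n)).symm (Matrix.single p q c)
      = Pi.single (p, q) c := by
    ext ⟨a, b⟩
    change Matrix.single p q c a b = _
    simp only [Matrix.single_apply, Pi.single_apply, Prod.mk.injEq, eq_comm]
  change ((deltaBasis k B n).tensorProduct (deltaBasis k B n)).equivFun.symm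
    ((LinearEquiv.curry B B (Fin n) (Fin n)).symm (Matrix.single p q c)) = _
  rw [this]
  simp [Module.Basis.equivFun_symm_apply, Pi.single_apply]

variable {n}

theorem matrixEquivTensor_mul_left (M N : Matrix (Fin n) (Fin n) B) :
    matrixEquivTensor k B n (M * N)
      = (Matrix.toLin (deltaBasis k B n) (deltaBasis k B n) M).rTensor _
          (matrixEquivTensor k B n N) := by
  induction N using Matrix.induction_on' with
  | h_zero => simp
  | h_add N N' h h' => rw [mul_add, map_add, map_add, map_add, h, h']
  | h_std_basis p q c =>
    have h1 : M * Matrix.single p q c = ∑ s, Matrix.single s q (M s p * c) := by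
      ext a b
      rw [Matrix.sum_apply]
      by_cases hb : b = q
      · subst hb
        simp [Matrix.single_apply, Matrix.mul_apply]
      · simp [Matrix.mul_apply, Ne.symm hb]
    rw [h1, map_sum, matrixEquivTensor_single, map_smul, LinearMap.rTensor_tmul, Matrix.toLin_self,
      TensorProduct.sum_tmul, Finset.smul_sum]
    refine Finset.sum_congr rfl fun s _ => ?_
    rw [matrixEquivTensor_single, ← TensorProduct.smul_tmul', smul_smul, mul_comm]

variable (σ : KInvolution k B)

/-- The `σ`-transpose of a matrix. -/
def sigmaTranspose (M : Matrix (Fin n) (Fin n) B) : Matrix (Fin n) (Fin n) B := M.transpose.map σ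

theorem sigmaTranspose_apply (M : Matrix (Fin n) (Fin n) B) (p q : Fin n) :
    sigmaTranspose σ M p q = σ (M q p) := rfl

theorem sigmaTranspose_single (p q : Fin n) (c : B) :
    sigmaTranspose σ (Matrix.single p q c) = Matrix.single q p (σ c) := by
  ext a b
  rw [sigmaTranspose_apply, Matrix.single_apply, Matrix.single_apply, apply_ite σ]
  simp only [and_comm]
  congr 1
  exact map_zero σ.toLinearMap

theorem sigmaTranspose_add (M N : Matrix (Fin n) (Fin n) B) :
    sigmaTranspose σ (M + N) = sigmaTranspose σ M + sigmaTranspose σ N := by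
  ext a b
  exact map_add σ.toLinearMap _ _

theorem sigmaTranspose_zero :
    sigmaTranspose σ (0 : Matrix (Fin n) (Fin n) B) = 0 := by
  ext a b
  exact map_zero σ.toLinearMap

theorem conjTwist_toLin (M : Matrix (Fin n) (Fin n) B) (q : Fin n) :
    conjTwist σ (Matrix.toLin (deltaBasis k B n) (deltaBasis k B n) M) (deltaBasis k B n q)
      = ∑ s, σ (M s q) • deltaBasis k B n s := by
  have h1 : ∀ s, twist σ (deltaBasis k B n s) = deltaBasis k B n s := fun s => by
    rw [deltaBasis_apply, twist_tmul, σ.map_one]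
  change twist σ (Matrix.toLin _ _ M (twist σ (deltaBasis k B n q))) = _
  rw [h1, Matrix.toLin_self, map_sum]
  exact Finset.sum_congr rfl fun s _ => by rw [twist_smul, h1]

/-- The right action on `Δ'` is transported from `Δ` along a `σ`-semilinear bijection; this is what
turns the matrix of the action into its `σ`-transpose. -/
theorem matrixEquivTensor_mul_right (M N : Matrix (Fin n) (Fin n) B) :
    matrixEquivTensor k B n (N * sigmaTranspose σ M)
      = (conjTwist σ (Matrix.toLin (deltaBasis k B n) (deltaBasis k B n) M)).lTensor _
          (matrixEquivTensor k B n N) := by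
  induction N using Matrix.induction_on' with
  | h_zero => simp
  | h_add N N' h h' => rw [add_mul, map_add, map_add, map_add, h, h']
  | h_std_basis p q c =>
    have h1 : Matrix.single p q c * sigmaTranspose σ M
        = ∑ s, Matrix.single p s (c * σ (M s q)) := by
      ext a b
      rw [Matrix.sum_apply]
      by_cases ha : a = p
      · subst ha
        simp [Matrix.single_apply, Matrix.mul_apply, sigmaTranspose_apply]
      · simp [Matrix.mul_apply, Ne.symm ha]
    rw [h1, map_sum, matrixEquivTensor_single, map_smul, LinearMap.lTensor_tmul, conjTwist_toLin,
      TensorProduct.tmul_sum, Finset.smul_sum]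
    refine Finset.sum_congr rfl fun s _ => ?_
    rw [matrixEquivTensor_single, TensorProduct.tmul_smul, smul_smul]

theorem matrixEquivTensor_sigmaTranspose (N : Matrix (Fin n) (Fin n) B) :
    matrixEquivTensor k B n (sigmaTranspose σ N) = flip σ (matrixEquivTensor k B n N) := by
  induction N using Matrix.induction_on' with
  | h_zero => rw [sigmaTranspose_zero, map_zero, map_zero]
  | h_add N N' h h' => rw [sigmaTranspose_add, map_add, map_add, map_add, h, h']
  | h_std_basis p q c =>
    have h1 : c • (deltaBasis k B n p ⊗ₜ[B] deltaBasis k B n q)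
        = (c ⊗ₜ[k] Pi.single p 1) ⊗ₜ[B] (1 ⊗ₜ[k] Pi.single q 1) := by
      rw [deltaBasis_apply, deltaBasis_apply, TensorProduct.smul_tmul' c (1 ⊗ₜ[k] Pi.single p 1),
        TensorProduct.smul_tmul', smul_eq_mul, mul_one]
    rw [sigmaTranspose_single, matrixEquivTensor_single, matrixEquivTensor_single, h1, flip_tmul,
      σ.map_one, ← TensorProduct.tmul_smul, deltaBasis_apply, deltaBasis_apply,
      TensorProduct.smul_tmul', smul_eq_mul, mul_one]

/-- A criterion for affine cell ideals in terms of matrices. -/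
theorem isAffineCellIdeal_of_matrix {A : Type w} [Ring A] [Algebra k A] (i : KInvolution k A)
    (J : Ideal A) (hJ : J.IsTwoSided) (hi : (i : A → A) '' (J : Set A) = J)
    [Algebra.FiniteType k B] (φ : A →ₐ[k] Matrix (Fin n) (Fin n) B)
    (θ : J ≃ₗ[k] Matrix (Fin n) (Fin n) B)
    (hl : ∀ (a : A) (x y : J), (y : A) = a * x → θ y = φ a * θ x)
    (hr : ∀ (a : A) (x y : J), (y : A) = x * a → θ y = θ x * sigmaTranspose σ (φ (i a)))
    (hinv : ∀ x y : J, (y : A) = i x → θ y = sigmaTranspose σ (θ x)) :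
    IsAffineCellIdeal k i J := by
  let L := Matrix.toLinAlgEquiv (deltaBasis k B n)
  -- `L` is an isomorphism of `B`-algebras, so compatibility with the scalars of `k` is checked
  -- through `B`.
  let Φ : A →ₐ[k] Module.End B (B ⊗[k] (Fin n → k)) :=
    { (L : Matrix (Fin n) (Fin n) B →+* Module.End B (B ⊗[k] (Fin n → k))).comp
        (φ : A →+* Matrix (Fin n) (Fin n) B) with
      commutes' := fun c => by
        change L (φ (algebraMap k A c)) = _
        rw [φ.commutes, IsScalarTower.algebraMap_apply k B (Matrix (Fin n) (Fin n) B),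
          L.commutes]
        ext x
        simp [Module.algebraMap_end_apply] }
  refine ⟨hJ, hi, Fin n → k, inferInstance, inferInstance, inferInstance, inferInstance, B,
    inferInstance, inferInstance, inferInstance, σ, Φ,
    θ.trans ((matrixEquivTensor k B n).restrictScalars k), fun a x y h => ?_, fun a x y h => ?_,
    fun x y h => ?_⟩
  · change matrixEquivTensor k B n (θ y) = _
    rw [hl a x y h, matrixEquivTensor_mul_left]
    rfl
  · change matrixEquivTensor k B n (θ y) = _
    rw [hr a x y h, matrixEquivTensor_mul_right]
    rfl
  · change matrixEquivTensor k B n (θ y) = _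
    rw [hinv x y h, matrixEquivTensor_sigmaTranspose]
    rfl

end MatrixModel

/-! ## The character ring as an abstract ring -/

section CharacterRing

variable {r : ℕ} (m : Fin r → ℕ)

/-- The ring of the virtual characters of `GLProd m`, restricted to the torus. -/
def CharacterRing : Type := charRing m

instance : CommRing (CharacterRing m) := inferInstanceAs (CommRing (charRing m))

instance : Algebra.FiniteType ℤ (CharacterRing m) := charRing_finiteType

/-- The representation ring is isomorphic to the character ring. -/
def repEquiv : RepRing m ≃+* CharacterRing m := repRingEquiv m

variable {m}

/-- The involution of the character ring which exchanges dual representations. -/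
def dualInvolution (hdual : ∀ s : Irr m, ∃ t, IsDual s t) : KInvolution ℤ (CharacterRing m) :=
  charInvolution hdual

theorem dualInvolution_repEquiv (hdual : ∀ s : Irr m, ∃ t, IsDual s t) {s t : Irr m}
    (h : IsDual s t) :
    dualInvolution hdual (repEquiv m (StructAlg.of tensorCoeff s))
      = repEquiv m (StructAlg.of tensorCoeff t) :=
  charInvolution_repRingEquiv hdual h

end CharacterRing

/-! ## Matrices over the extended character ring -/

section MatrixBasis

variable {r : ℕ} (m : Fin r → ℕ) (n : ℕ)

/-- The `ℤ`-basis of the character ring given by the irreducible characters. -/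
def charBasis : Module.Basis (Irr m) ℤ (CharacterRing m) :=
  Module.Basis.ofRepr
    ((repEquiv m).symm.toAddEquiv.toIntLinearEquiv : CharacterRing m ≃ₗ[ℤ] (Irr m →₀ ℤ))

theorem charBasis_apply (s : Irr m) :
    charBasis m s = repEquiv m (StructAlg.of tensorCoeff s) := rfl

theorem linearCombination_charBasis (f : Irr m →₀ ℤ) :
    Finsupp.linearCombination ℤ (charBasis m) f = repEquiv m (f : RepRing m) :=
  (charBasis m).linearCombination_repr (repEquiv m f) ▸ by
    congr 1
    exact ((repEquiv m).symm_apply_apply (f : RepRing m)).symm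

/-- The character ring, with scalars extended to `K`. -/
abbrev ScalarRing : Type := K ⊗[ℤ] CharacterRing m

/-- The `K`-basis of the matrix ring consisting of the matrices with a single nonzero entry, which
is an irreducible character. -/
def matBasis :
    Module.Basis (Fin n × Fin n × Irr m) K (Matrix (Fin n) (Fin n) (ScalarRing m)) :=
  (Algebra.TensorProduct.basis K (charBasis m)).matrix (Fin n) (Fin n)

variable {m n}

theorem matBasis_apply (x : Fin n × Fin n × Irr m) :
    matBasis m n x = Matrix.single x.1 x.2.1
      (1 ⊗ₜ[ℤ] repEquiv m (StructAlg.of tensorCoeff x.2.2)) := by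
  obtain ⟨j, l, s⟩ := x
  rw [matBasis, Module.Basis.matrix_apply, Algebra.TensorProduct.basis_apply, charBasis_apply]

/-- Coefficientwise extension of scalars from `ℤ` to `K`. -/
def castK {I : Type*} (f : I →₀ ℤ) : I →₀ K := f.mapRange (fun z : ℤ => (z : K)) Int.cast_zero

theorem castK_apply {I : Type*} (f : I →₀ ℤ) (x : I) : castK f x = (f x : K) := rfl

/-- This identifies the ring given by the structure constants `matCoeff` with actual matrices, where
associativity and the identity element are available. -/
theorem matBasis_mul (x y : Fin n × Fin n × Irr m) :
    matBasis m n x * matBasis m n y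
      = Finsupp.linearCombination K (matBasis m n) (castK (matCoeff m n x y)) := by
  rw [matBasis_apply, matBasis_apply, matCoeff]
  split_ifs with h
  · rw [h, Matrix.single_mul_single_same, Algebra.TensorProduct.tmul_mul_tmul, one_mul, ← map_mul,
      StructAlg.of_mul_of, castK, ← Finsupp.embDomain_mapRange, Finsupp.linearCombination_embDomain,
      ← linearCombination_charBasis]
    simp only [Finsupp.linearCombination_apply, Function.comp_def]
    rw [Finsupp.sum_mapRange_index (by simp), Finsupp.sum, Finsupp.sum, TensorProduct.tmul_sum]
    refine (map_sum (Matrix.singleAddMonoidHom x.1 y.2.1 :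
      ScalarRing m →+ Matrix (Fin n) (Fin n) (ScalarRing m)) _ _).trans ?_
    refine Finset.sum_congr rfl fun s _ => ?_
    simp only [matBasis_apply, charBasis_apply,
      Matrix.singleAddMonoidHom_apply, Matrix.smul_single, TensorProduct.tmul_smul]
    congr 1
    exact (Int.cast_smul_eq_zsmul K _ _).symm
  · rw [Matrix.single_mul_single_of_ne _ _ _ _ h]
    simp [castK]

end MatrixBasis

/-! ## The action on a two-sided cell -/

theorem mulHom_single {S I : Type*} [CommRing S] (μ : I → I → I →₀ S) (b b' : I) :
    StructAlg.mulHom μ (Finsupp.single b 1) (Finsupp.single b' 1) = μ b b' := by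
  simp [StructAlg.mulHom]

section CellAction

variable {A : Type*} [NonUnitalRing A] [Module K A] {ι : Type*} (β : Module.Basis ι K A)
  (c : Set ι)

/-- The inclusion of the span of `c`. -/
def cellIncl : (c →₀ K) →ₗ[K] A := Finsupp.linearCombination K fun b : c => β b

/-- The projection to the span of `c`. -/
def cellProj : A →ₗ[K] (c →₀ K) := Finsupp.lsubtypeDomain c ∘ₗ β.repr.toLinearMap

variable {c}

theorem cellProj_apply (a : A) (b : c) : cellProj β c a b = β.repr a b := rfl

theorem cellIncl_single (b : c) (z : K) : cellIncl β c (Finsupp.single b z) = z • β b := by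
  simp [cellIncl]

theorem repr_cellIncl_mem (x : c →₀ K) (b : c) : β.repr (cellIncl β c x) b = x b := by
  classical
  induction x using Finsupp.induction_linear with
  | zero => simp
  | add x y hx hy => simp [hx, hy]
  | single b' z =>
    rw [cellIncl_single, map_smul, Module.Basis.repr_self, Finsupp.smul_apply,
      Finsupp.single_apply, Finsupp.single_apply, smul_eq_mul, mul_ite, mul_one, mul_zero]
    simp only [Subtype.ext_iff]

theorem repr_cellIncl_notMem (x : c →₀ K) {b : ι} (hb : b ∉ c) :
    β.repr (cellIncl β c x) b = 0 := by
  classical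
  induction x using Finsupp.induction_linear with
  | zero => simp
  | add x y hx hy => simp [hx, hy]
  | single b' z =>
    rw [cellIncl_single, map_smul, Module.Basis.repr_self, Finsupp.smul_apply,
      Finsupp.single_apply, if_neg (fun h : (b' : ι) = b => hb (h ▸ b'.2)), smul_zero]

theorem cellProj_cellIncl (x : c →₀ K) : cellProj β c (cellIncl β c x) = x :=
  Finsupp.ext fun b => repr_cellIncl_mem β x b

theorem cellIncl_mem (x : c →₀ K) {S : Set ι} (h : c ⊆ S) :
    cellIncl β c x ∈ Submodule.span K (β '' S) := by
  rw [Module.Basis.mem_span_image]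
  intro b hb
  by_contra hbS
  exact (Finsupp.mem_support_iff.mp hb) (repr_cellIncl_notMem β x fun hc => hbS (h hc))

theorem cellProj_eq_zero {S : Set ι} (h : Disjoint S c) {a : A}
    (ha : a ∈ Submodule.span K (β '' S)) : cellProj β c a = 0 := by
  refine Finsupp.ext fun b => ?_
  rw [Module.Basis.mem_span_image] at ha
  by_contra hb
  exact Set.disjoint_left.mp h (ha (Finsupp.mem_support_iff.mpr hb)) b.2

theorem sub_cellIncl_cellProj_mem {S : Set ι} {a : A}
    (ha : a ∈ Submodule.span K (β '' (S ∪ c))) :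
    a - cellIncl β c (cellProj β c a) ∈ Submodule.span K (β '' S) := by
  rw [Module.Basis.mem_span_image] at ha ⊢
  intro b hb
  rw [Finset.mem_coe, Finsupp.mem_support_iff, map_sub, Finsupp.sub_apply] at hb
  by_cases hbc : b ∈ c
  · exact absurd (sub_eq_zero.mpr (repr_cellIncl_mem β (cellProj β c a) ⟨b, hbc⟩).symm) hb
  · rw [repr_cellIncl_notMem β _ hbc, sub_zero] at hb
    exact (ha (Finsupp.mem_support_iff.mpr hb)).resolve_right hbc

variable [IsScalarTower K A A] [SMulCommClass K A A]

variable (c) in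
/-- The left action of `A` on the span of `c`, modulo the other basis elements. -/
def cellLeft : A →ₗ[K] (c →₀ K) →ₗ[K] (c →₀ K) :=
  ((LinearMap.mul K A).compl₂ (cellIncl β c)).compr₂ (cellProj β c)

variable (c) in
/-- The right action of `A` on the span of `c`, modulo the other basis elements. -/
def cellRight : A →ₗ[K] (c →₀ K) →ₗ[K] (c →₀ K) :=
  ((LinearMap.mul K A).flip.compl₂ (cellIncl β c)).compr₂ (cellProj β c)

theorem cellLeft_apply (a : A) (x : c →₀ K) :
    cellLeft β c a x = cellProj β c (a * cellIncl β c x) := rfl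

theorem cellRight_apply (a : A) (x : c →₀ K) :
    cellRight β c a x = cellProj β c (cellIncl β c x * a) := rfl

variable (c) in
/-- The product of the asymptotic ring, with scalars extended to `K`. -/
def asymMul : (c →₀ K) →ₗ[K] (c →₀ K) →ₗ[K] (c →₀ K) :=
  StructAlg.mulHom fun b b' => castK (asymCoeff β c b b')

end CellAction

/-! ### The actions commute with the asymptotic product -/

section AsymAction

variable {A : Type*} [NonUnitalRing A] [Module K A] {ι : Type*} (β : Module.Basis ι K A)
  {c : Set ι}

theorem asymMul_single (b b' : c) :
    asymMul β c (Finsupp.single b 1) (Finsupp.single b' 1) = castK (asymCoeff β c b b') :=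
  mulHom_single _ b b'

theorem finsum_mul_eq_sum {I : Type*} (f : I →₀ K) (g : I → K) :
    ∑ᶠ b, f b * g b = f.sum fun b z => z * g b :=
  finsum_eq_sum_of_support_subset _ fun b hb => by
    rw [Finset.mem_coe, Finsupp.mem_support_iff]
    exact fun h => hb (by simp only [h, zero_mul])

/-- A linear map, evaluated at `x`, is the sum of its values at the basis elements. -/
theorem linearMap_apply_eq_sum {I J : Type*} (f : (I →₀ K) →ₗ[K] (J →₀ K)) (x : I →₀ K) (j : J) :
    f x j = x.sum fun b z => z * f (Finsupp.single b 1) j := by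
  conv_lhs => rw [← Finsupp.sum_single x, Finsupp.sum, map_sum, Finsupp.finsetSum_apply]
  refine Finset.sum_congr rfl fun b _ => ?_
  rw [← mul_one (x b), ← smul_eq_mul, ← Finsupp.smul_single, map_smul, Finsupp.smul_apply,
    smul_eq_mul, smul_eq_mul, mul_one]

variable [IsScalarTower K A A] [SMulCommClass K A A]

theorem cellLeft_basis (b₁ : ι) (b b' : c) :
    cellLeft β c (β b₁) (Finsupp.single b 1) b' = β.repr (β b₁ * β b) b' := by
  rw [cellLeft_apply, cellIncl_single, one_smul, cellProj_apply]

theorem cellRight_basis (b₁ : ι) (b b' : c) :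
    cellRight β c (β b₁) (Finsupp.single b 1) b' = β.repr (β b * β b₁) b' := by
  rw [cellRight_apply, cellIncl_single, one_smul, cellProj_apply]

variable {β}

/-- On basis elements, the coefficients of the two sides are the two sums in the first equation of
P₃; the rest is trilinearity. -/
theorem cellLeft_asymMul (h : PropertyP3 β) (hc : c ∈ twoCells β) (a : A) (x y : c →₀ K) :
    cellLeft β c a (asymMul β c x y) = asymMul β c (cellLeft β c a x) y := by
  have key : ∀ (b₁ : ι) (b₂ b₃ : c),
      cellLeft β c (β b₁) (asymMul β c (Finsupp.single b₂ 1) (Finsupp.single b₃ 1))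
        = asymMul β c (cellLeft β c (β b₁) (Finsupp.single b₂ 1)) (Finsupp.single b₃ 1) := by
    intro b₁ b₂ b₃
    refine Finsupp.ext fun b' => ?_
    have h1 := h.left c hc b₁ b₂ b₃ b'
    have h2 := finsum_mul_eq_sum (cellLeft β c (β b₁) (Finsupp.single b₂ 1))
      (fun b => (asymCoeff β c b b₃ b' : K))
    have h3 := finsum_mul_eq_sum (castK (asymCoeff β c b₂ b₃))
      (fun b => β.repr (β b₁ * β b) b')
    simp only [cellLeft_basis, castK_apply] at h2 h3
    rw [asymMul_single, linearMap_apply_eq_sum,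
      ← LinearMap.flip_apply (asymMul β c), linearMap_apply_eq_sum ((asymMul β c).flip _)]
    simp only [LinearMap.flip_apply, asymMul_single, cellLeft_basis, castK_apply]
    rw [← h2, ← h3, h1]
    exact finsum_congr fun b => mul_comm _ _
  induction x using Finsupp.induction_linear with
  | zero => simp
  | add x x' hx hx' => simp only [map_add, LinearMap.add_apply, hx, hx']
  | single b z =>
    have h1 : Finsupp.single b z = z • Finsupp.single b 1 := by simp
    rw [h1]
    simp only [map_smul, LinearMap.smul_apply]
    congr 1
    induction y using Finsupp.induction_linear with
    | zero => simp
    | add y y' hy hy' => simp only [map_add, hy, hy']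
    | single b' z' =>
      have h2 : Finsupp.single b' z' = z' • Finsupp.single b' 1 := by simp
      rw [h2]
      simp only [map_smul]
      congr 1
      exact LinearMap.congr_fun (β.ext
        (f₁ := (cellLeft β c).flip (asymMul β c (Finsupp.single b 1) (Finsupp.single b' 1)))
      (f₂ := (asymMul β c).flip (Finsupp.single b' 1) ∘ₗ
        (cellLeft β c).flip (Finsupp.single b 1))
        fun b₁ => key b₁ b b') a

/-- The mirror image, from the second equation of P₃. -/
theorem cellRight_asymMul (h : PropertyP3 β) (hc : c ∈ twoCells β) (a : A) (x y : c →₀ K) :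
    cellRight β c a (asymMul β c x y) = asymMul β c x (cellRight β c a y) := by
  have key : ∀ (b₁ : ι) (b₂ b₃ : c),
      cellRight β c (β b₁) (asymMul β c (Finsupp.single b₂ 1) (Finsupp.single b₃ 1))
        = asymMul β c (Finsupp.single b₂ 1) (cellRight β c (β b₁) (Finsupp.single b₃ 1)) := by
    intro b₁ b₂ b₃
    refine Finsupp.ext fun b' => ?_
    have h1 := h.right c hc b₂ b₃ b' b₁
    have h2 := finsum_mul_eq_sum (castK (asymCoeff β c b₂ b₃))
      (fun b => β.repr (β b * β b₁) b')
    have h3 := finsum_mul_eq_sum (cellRight β c (β b₁) (Finsupp.single b₃ 1))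
      (fun b => (asymCoeff β c b₂ b b' : K))
    simp only [cellRight_basis, castK_apply] at h2 h3
    rw [asymMul_single, linearMap_apply_eq_sum, linearMap_apply_eq_sum (asymMul β c _)]
    simp only [asymMul_single, cellRight_basis, castK_apply]
    rw [← h2, ← h3, h1]
    exact finsum_congr fun b => mul_comm _ _
  induction x using Finsupp.induction_linear with
  | zero => simp
  | add x x' hx hx' => simp only [map_add, LinearMap.add_apply, hx, hx']
  | single b z =>
    have h1 : Finsupp.single b z = z • Finsupp.single b 1 := by simp
    rw [h1]
    simp only [map_smul, LinearMap.smul_apply]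
    congr 1
    induction y using Finsupp.induction_linear with
    | zero => simp
    | add y y' hy hy' => simp only [map_add, hy, hy']
    | single b' z' =>
      have h2 : Finsupp.single b' z' = z' • Finsupp.single b' 1 := by simp
      rw [h2]
      simp only [map_smul]
      congr 1
      exact LinearMap.congr_fun (β.ext
        (f₁ := (cellRight β c).flip (asymMul β c (Finsupp.single b 1) (Finsupp.single b' 1)))
      (f₂ := asymMul β c (Finsupp.single b 1) ∘ₗ
        (cellRight β c).flip (Finsupp.single b' 1))
        fun b₁ => key b₁ b b') a

end AsymAction

/-! ## The matrix model of a labelled cell -/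

section Labelled

variable {A : Type*} [NonUnitalRing A] [Module K A] {i : KInvolution K A}
  {ι : Type*} {β : Module.Basis ι K A} {c : Set ι} {n r : ℕ} {m : Fin r → ℕ}

/-- The identification of the span of a cell with a ring of matrices, given by a labelling. -/
def cellTheta (E : c ≃ Fin n × Fin n × Irr m) :
    (c →₀ K) ≃ₗ[K] Matrix (Fin n) (Fin n) (ScalarRing m) :=
  (Finsupp.domLCongr E).trans (matBasis m n).repr.symm

theorem cellTheta_single (E : c ≃ Fin n × Fin n × Irr m) (b : c) :
    cellTheta E (Finsupp.single b 1) = matBasis m n (E b) := by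
  rw [cellTheta, LinearEquiv.trans_apply, Finsupp.domLCongr_single, Module.Basis.repr_symm_single,
    one_smul]

variable {E : c ≃ Fin n × Fin n × Irr m}

/-- A ring isomorphism carrying one basis to another identifies the structure constants. -/
theorem IsLabelling.domCongr_asymCoeff (h : IsLabelling i β c n m E) (b b' : c) :
    Finsupp.domLCongr (R := ℤ) E (asymCoeff β c b b') = matCoeff m n (E b) (E b') := by
  obtain ⟨F, hF⟩ := h.asym
  have h1 : ∀ x : c →₀ ℤ, F (x : AsymRing β c)
      = (Finsupp.domLCongr (R := ℤ) E x : Fin n × Fin n × Irr m →₀ ℤ) := by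
    let F' : (c →₀ ℤ) →ₗ[ℤ] (Fin n × Fin n × Irr m →₀ ℤ) :=
      (F.toAddEquiv.toAddMonoidHom : (c →₀ ℤ) →+ (Fin n × Fin n × Irr m →₀ ℤ)).toIntLinearMap
    have h2 : F' = (Finsupp.domLCongr (R := ℤ) E).toLinearMap := by
      refine Finsupp.lhom_ext' fun b => LinearMap.ext_ring ?_
      refine (hF b).trans ?_
      change Finsupp.single (E b) 1 = Finsupp.domLCongr (R := ℤ) E (Finsupp.single b 1)
      rw [Finsupp.domLCongr_single]
    exact fun x => LinearMap.congr_fun h2 x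
  have h3 : F (tElt β c b * tElt β c b')
      = StructAlg.of (matCoeff m n) (E b) * StructAlg.of (matCoeff m n) (E b') := by
    rw [map_mul, hF, hF]
  rw [StructAlg.of_mul_of, StructAlg.of_mul_of] at h3
  exact (h1 _).symm.trans h3

theorem IsLabelling.cellTheta_asymMul (h : IsLabelling i β c n m E) (x y : c →₀ K) :
    cellTheta E (asymMul β c x y) = cellTheta E x * cellTheta E y := by
  have key : ∀ b b' : c,
      cellTheta E (asymMul β c (Finsupp.single b 1) (Finsupp.single b' 1))
        = cellTheta E (Finsupp.single b 1) * cellTheta E (Finsupp.single b' 1) := by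
    intro b b'
    rw [asymMul_single, cellTheta_single, cellTheta_single, matBasis_mul,
      ← h.domCongr_asymCoeff b b', cellTheta, LinearEquiv.trans_apply,
      Module.Basis.repr_symm_apply]
    congr 1
    ext x : 1
    rw [castK_apply, Finsupp.domLCongr_apply, Finsupp.domLCongr_apply, Finsupp.domCongr_apply,
      Finsupp.domCongr_apply, Finsupp.equivMapDomain_apply, Finsupp.equivMapDomain_apply,
      castK_apply]
  have h2 : (asymMul β c).compr₂ (cellTheta E).toLinearMap
      = (LinearMap.mul K (Matrix (Fin n) (Fin n) (ScalarRing m))).compl₁₂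
        (cellTheta E).toLinearMap (cellTheta E).toLinearMap :=
    Finsupp.lhom_ext' fun b => LinearMap.ext_ring (Finsupp.lhom_ext' fun b' =>
      LinearMap.ext_ring (key b b'))
  exact LinearMap.congr_fun (LinearMap.congr_fun h2 x) y

/-- Every irreducible representation has a dual, as soon as a nonempty cell is labelled. -/
theorem IsLabelling.exists_isDual (h : IsLabelling i β c n m E) (hc : c.Nonempty) (s : Irr m) :
    ∃ t, IsDual s t := by
  obtain ⟨b₀, hb₀⟩ := hc
  -- Any matrix position would do. The element of the cell only supplies an index, as `n` could
  -- otherwise be zero.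
  let b := E.symm ((E ⟨b₀, hb₀⟩).1, (E ⟨b₀, hb₀⟩).1, s)
  obtain ⟨b', -, -, -, hb'⟩ := h.invol b
  exact ⟨_, by simpa [b] using hb'⟩

end Labelled

/-! ## The cell preorder -/

section Preorder

variable {A : Type*} [NonUnitalRing A] [Module K A] {ι : Type*} {β : Module.Basis ι K A}

theorem LRLe.refl (b : ι) : LRLe β b b := fun _ _ h => h

theorem LRLe.trans {b b' b'' : ι} (h : LRLe β b b') (h' : LRLe β b' b'') : LRLe β b b'' :=
  fun S hS hb => h S hS (h' S hS hb)

theorem lrLe_of_repr_mul_left {x : A} {b b' : ι} (h : β.repr (x * β b) b' ≠ 0) :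
    LRLe β b' b := fun S hS hb => by
  have h1 := (hS _ hb x).1
  rw [Module.Basis.mem_span_image] at h1
  exact Submodule.subset_span ⟨b', h1 (Finsupp.mem_support_iff.mpr h), rfl⟩

theorem lrLe_of_repr_mul_right {x : A} {b b' : ι} (h : β.repr (β b * x) b' ≠ 0) :
    LRLe β b' b := fun S hS hb => by
  have h1 := (hS _ hb x).2
  rw [Module.Basis.mem_span_image] at h1
  exact Submodule.subset_span ⟨b', h1 (Finsupp.mem_support_iff.mpr h), rfl⟩

theorem mem_twoCell_self (b : ι) : b ∈ twoCell β b := ⟨LRLe.refl b, LRLe.refl b⟩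

theorem nonempty_of_mem_twoCells {c : Set ι} (hc : c ∈ twoCells β) : c.Nonempty := by
  obtain ⟨b, rfl⟩ := hc
  exact ⟨b, mem_twoCell_self b⟩

theorem lrLe_of_mem_twoCells {c : Set ι} (hc : c ∈ twoCells β) {b b' : ι} (hb : b ∈ c)
    (hb' : b' ∈ c) : LRLe β b b' := by
  obtain ⟨b₀, rfl⟩ := hc
  exact hb.1.trans hb'.2

theorem mem_of_lrLe {c : Set ι} (hc : c ∈ twoCells β) {b b' : ι} (hb : b ∈ c)
    (h : LRLe β b' b) (h' : LRLe β b b') : b' ∈ c := by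
  obtain ⟨b₀, rfl⟩ := hc
  exact ⟨h.trans hb.1, hb.2.trans h'⟩

theorem twoCells_eq_of_mem {c c' : Set ι} (hc : c ∈ twoCells β) (hc' : c' ∈ twoCells β) {b : ι}
    (hb : b ∈ c) (hb' : b ∈ c') : c = c' :=
  Set.ext fun _ =>
    ⟨fun h => mem_of_lrLe hc' hb' (lrLe_of_mem_twoCells hc h hb) (lrLe_of_mem_twoCells hc hb h),
      fun h => mem_of_lrLe hc hb (lrLe_of_mem_twoCells hc' h hb') (lrLe_of_mem_twoCells hc' hb' h)⟩

variable [IsScalarTower K A A] [SMulCommClass K A A]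

/-- A set of basis elements which is closed downwards spans a two-sided ideal. -/
theorem isBasedIdeal_of_isLower {S : Set ι} (hS : ∀ b ∈ S, ∀ b', LRLe β b' b → b' ∈ S) :
    IsBasedIdeal β S := by
  intro x hx a
  induction hx using Submodule.span_induction with
  | mem x hx =>
    obtain ⟨b, hb, rfl⟩ := hx
    constructor
    · rw [Module.Basis.mem_span_image]
      exact fun b' hb' => hS b hb b' (lrLe_of_repr_mul_left (Finsupp.mem_support_iff.mp hb'))
    · rw [Module.Basis.mem_span_image]
      exact fun b' hb' => hS b hb b' (lrLe_of_repr_mul_right (Finsupp.mem_support_iff.mp hb'))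
  | zero => simp
  | add x y _ _ hx hy =>
    rw [mul_add, add_mul]
    exact ⟨add_mem hx.1 hy.1, add_mem hx.2 hy.2⟩
  | smul z x _ hx =>
    rw [mul_smul_comm, smul_mul_assoc]
    exact ⟨Submodule.smul_mem _ z hx.1, Submodule.smul_mem _ z hx.2⟩

end Preorder

/-! ## Cells as layers of based ideals -/

section Layer

variable {A : Type*} [NonUnitalRing A] [Module K A] {ι : Type*} {β : Module.Basis ι K A}
  {S c : Set ι}

variable (β) in
/-- The set `c` is complementary to the based ideal given by `S` in a based ideal. -/
structure IsLayer (S c : Set ι) : Prop where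
  below : IsBasedIdeal β S
  total : IsBasedIdeal β (S ∪ c)
  disjoint : Disjoint S c

variable [IsScalarTower K A A] [SMulCommClass K A A]

/-- Replacing `x` by its component along `c` changes it by an element of the ideal below, which
remains there after multiplication by `a` and is killed by the projection. -/
theorem IsLayer.cellProj_mul_left (h : IsLayer β S c) (a : A) {x : A}
    (hx : x ∈ Submodule.span K (β '' (S ∪ c))) :
    cellProj β c (a * x) = cellLeft β c a (cellProj β c x) := by
  rw [cellLeft_apply, ← sub_eq_zero, ← map_sub, ← mul_sub]
  exact cellProj_eq_zero β h.disjoint (h.below _ (sub_cellIncl_cellProj_mem β hx) a).1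

theorem IsLayer.cellProj_mul_right (h : IsLayer β S c) (a : A) {x : A}
    (hx : x ∈ Submodule.span K (β '' (S ∪ c))) :
    cellProj β c (x * a) = cellRight β c a (cellProj β c x) := by
  rw [cellRight_apply, ← sub_eq_zero, ← map_sub, ← sub_mul]
  exact cellProj_eq_zero β h.disjoint (h.below _ (sub_cellIncl_cellProj_mem β hx) a).2

theorem IsLayer.cellLeft_mul (h : IsLayer β S c) (a a' : A) (x : c →₀ K) :
    cellLeft β c (a * a') x = cellLeft β c a (cellLeft β c a' x) := by
  have hx := cellIncl_mem β x (Set.subset_union_right (s := S))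
  rw [cellLeft_apply, mul_assoc, h.cellProj_mul_left a (h.total _ hx a').1, cellLeft_apply β a']

theorem IsLayer.cellLeft_eq_zero (h : IsLayer β S c) {a : A}
    (ha : a ∈ Submodule.span K (β '' S)) : cellLeft β c a = 0 :=
  LinearMap.ext fun _ => cellProj_eq_zero β h.disjoint (h.below a ha _).2

end Layer

/-! ## Matrices of the actions on a labelled cell -/

section Action

variable {A : Type*} [NonUnitalRing A] [Module K A]
  {i : KInvolution K A} {ι : Type*} {β : Module.Basis ι K A} {c : Set ι} {n r : ℕ}
  {m : Fin r → ℕ} {E : c ≃ Fin n × Fin n × Irr m}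

theorem IsLabelling.unit_asymMul (h : IsLabelling i β c n m E) (x : c →₀ K) :
    asymMul β c ((cellTheta E).symm 1) x = x :=
  (cellTheta E).injective (by rw [h.cellTheta_asymMul, LinearEquiv.apply_symm_apply, one_mul])

theorem IsLabelling.asymMul_unit (h : IsLabelling i β c n m E) (x : c →₀ K) :
    asymMul β c x ((cellTheta E).symm 1) = x :=
  (cellTheta E).injective (by rw [h.cellTheta_asymMul, LinearEquiv.apply_symm_apply, mul_one])

variable [IsScalarTower K A A] [SMulCommClass K A A]

variable (β E) in
/-- The matrix by which `a` acts on the cell from the left. -/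
def leftMat : A →ₗ[K] Matrix (Fin n) (Fin n) (ScalarRing m) :=
  (cellTheta E).toLinearMap ∘ₗ (cellLeft β c).flip ((cellTheta E).symm 1)

variable (β E) in
/-- The matrix by which `a` acts on the cell from the right. -/
def rightMat : A →ₗ[K] Matrix (Fin n) (Fin n) (ScalarRing m) :=
  (cellTheta E).toLinearMap ∘ₗ (cellRight β c).flip ((cellTheta E).symm 1)

theorem leftMat_apply (a : A) :
    leftMat β E a = cellTheta E (cellLeft β c a ((cellTheta E).symm 1)) := rfl

theorem rightMat_apply (a : A) :
    rightMat β E a = cellTheta E (cellRight β c a ((cellTheta E).symm 1)) := rfl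

/-- Write `x` as the asymptotic product of the identity and `x`; the action of `a` commutes with
right multiplication by `x`, so only its value at the identity matters. -/
theorem IsLabelling.cellTheta_cellLeft (h : IsLabelling i β c n m E) (h₃ : PropertyP3 β)
    (hc : c ∈ twoCells β) (a : A) (x : c →₀ K) :
    cellTheta E (cellLeft β c a x) = leftMat β E a * cellTheta E x := by
  conv_lhs => rw [← h.unit_asymMul x]
  rw [cellLeft_asymMul h₃ hc, h.cellTheta_asymMul, leftMat_apply]

theorem IsLabelling.cellTheta_cellRight (h : IsLabelling i β c n m E) (h₃ : PropertyP3 β)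
    (hc : c ∈ twoCells β) (a : A) (x : c →₀ K) :
    cellTheta E (cellRight β c a x) = cellTheta E x * rightMat β E a := by
  conv_lhs => rw [← h.asymMul_unit x]
  rw [cellRight_asymMul h₃ hc, h.cellTheta_asymMul, rightMat_apply]

/-- The truncated left action respects products only because the terms discarded lie in the ideal
spanned by `S`; this is where the layer structure enters. -/
theorem IsLabelling.leftMat_mul (h : IsLabelling i β c n m E) (h₃ : PropertyP3 β)
    (hc : c ∈ twoCells β) {S : Set ι} (hS : IsLayer β S c) (a a' : A) :
    leftMat β E (a * a') = leftMat β E a * leftMat β E a' := by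
  rw [leftMat_apply, hS.cellLeft_mul, h.cellTheta_cellLeft h₃ hc, ← leftMat_apply]

theorem cellAlg_mul (x y : CellAlg β c) :
    (x * y : CellAlg β c) = cellLeft β c (cellIncl β c x) y := by
  have h : StructAlg.mulHom (cellCoeff β c) = (cellLeft β c).comp (cellIncl β c) := by
    refine Finsupp.lhom_ext' fun b => LinearMap.ext_ring (Finsupp.lhom_ext' fun b' =>
      LinearMap.ext_ring ?_)
    simp only [LinearMap.comp_apply, Finsupp.lsingle_apply]
    rw [mulHom_single, cellIncl_single, one_smul, cellLeft_apply, cellIncl_single, one_smul]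
    rfl
  exact LinearMap.congr_fun (LinearMap.congr_fun h x) y

/-- A labelled cell is a generalized matrix algebra over the representation ring. -/
theorem IsLabelling.isGenMatrixCell (h : IsLabelling i β c n m E) (h₃ : PropertyP3 β)
    (hc : c ∈ twoCells β) : IsGenMatrixCell i β c n m E := by
  have hdual := h.exists_isDual (nonempty_of_mem_twoCells hc)
  refine ⟨CharacterRing m, inferInstance, inferInstance, repEquiv m, dualInvolution hdual,
    rightMat β E (cellIncl β c ((cellTheta E).symm 1)), cellTheta E,
    fun s t hst => dualInvolution_repEquiv hdual hst, fun x y => ?_, fun b => ?_,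
    fun b b' hb => ?_⟩
  -- Let `w` be the element of the cell which corresponds to the identity matrix. The left matrix of
  -- `x` is the image of the product of `x` and `w`, which is also the right action of `w` on `x`;
  -- so it equals `Θ x` times the right matrix `Ψ` of `w`.
  · have h1 : ∀ x y : c →₀ K, cellTheta E (cellLeft β c (cellIncl β c x) y)
        = cellTheta E x * rightMat β E (cellIncl β c ((cellTheta E).symm 1)) * cellTheta E y := by
      intro x y
      rw [h.cellTheta_cellLeft h₃ hc]
      congr 1
      exact h.cellTheta_cellRight h₃ hc (cellIncl β c ((cellTheta E).symm 1)) x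
    exact (congrArg (cellTheta E) (cellAlg_mul x y)).trans (h1 x y)
  · exact (cellTheta_single E b).trans (matBasis_apply _)
  · obtain ⟨b'', hb'', h1, h2, h3⟩ := h.invol b
    have : b' = b'' := Subtype.ext (β.injective (hb.symm.trans hb''))
    subst this
    rw [dualInvolution_repEquiv hdual h3, ← h1, ← h2]
    exact (cellTheta_single E b').trans (matBasis_apply _)

end Action

/-! ## Compatibility with the involution -/

section Involution

/-- Extension of scalars of an involution. -/
def KInvolution.baseChange {R : Type*} [CommRing R] (σ : KInvolution ℤ R) :
    KInvolution K (K ⊗[ℤ] R) where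
  toLinearMap := σ.toLinearMap.baseChange K
  map_mul_rev' x y := by
    change σ.toLinearMap.baseChange K (x * y)
      = σ.toLinearMap.baseChange K y * σ.toLinearMap.baseChange K x
    induction x using TensorProduct.induction_on with
    | zero => simp
    | add x x' hx hx' => rw [add_mul, map_add, map_add, mul_add, hx, hx']
    | tmul z a =>
      induction y using TensorProduct.induction_on with
      | zero => simp
      | add y y' hy hy' => rw [mul_add, map_add, map_add, add_mul, hy, hy']
      | tmul z' a' =>
        simp only [Algebra.TensorProduct.tmul_mul_tmul, LinearMap.baseChange_tmul, mul_comm z' z]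
        exact congrArg (fun w => (z * z') ⊗ₜ[ℤ] w) (σ.map_mul_rev' a a')
  involutive' x := by
    change σ.toLinearMap.baseChange K (σ.toLinearMap.baseChange K x) = x
    induction x using TensorProduct.induction_on with
    | zero => simp
    | add x x' hx hx' => rw [map_add, map_add, hx, hx']
    | tmul z a =>
      simp only [LinearMap.baseChange_tmul]
      exact congrArg (fun w => z ⊗ₜ[ℤ] w) (σ.involutive' a)

theorem KInvolution.baseChange_tmul {R : Type*} [CommRing R] (σ : KInvolution ℤ R) (z : K)
    (a : R) : σ.baseChange (z ⊗ₜ[ℤ] a) = z ⊗ₜ[ℤ] σ a := rfl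

theorem sigmaTranspose_smul {k B : Type u} [CommRing k] [CommRing B] [Algebra k B]
    (σ : KInvolution k B) {n : ℕ} (z : k) (M : Matrix (Fin n) (Fin n) B) :
    sigmaTranspose σ (z • M) = z • sigmaTranspose σ M := by
  ext a b
  exact map_smul σ.toLinearMap _ _

variable {A : Type*} [NonUnitalRing A] [Module K A]
  {i : KInvolution K A} {ι : Type*} {β : Module.Basis ι K A} {c : Set ι} {n r : ℕ}
  {m : Fin r → ℕ} {E : c ≃ Fin n × Fin n × Irr m}

theorem PropertyP4.exists_mem_twoCells (h₄ : PropertyP4 i β) {c : Set ι} (hc : c ∈ twoCells β)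
    {b : ι} (hb : b ∈ c) : ∃ b' ∈ c, i (β b) = β b' := by
  obtain ⟨n, r, m, E, h⟩ := h₄ c hc
  obtain ⟨b', h', -⟩ := h.invol ⟨b, hb⟩
  exact ⟨b', b'.2, h'⟩

/-- For basis elements in `c` this is the labelling rule of P₄(a). The other basis elements are sent
by `i` into their own cells, so both sides vanish. -/
theorem IsLabelling.cellTheta_cellProj_involution (h : IsLabelling i β c n m E)
    (h₄ : PropertyP4 i β) (hc : c ∈ twoCells β) (hdual : ∀ s : Irr m, ∃ t, IsDual s t) (x : A) :
    cellTheta E (cellProj β c (i x))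
      = sigmaTranspose (dualInvolution hdual).baseChange (cellTheta E (cellProj β c x)) := by
  have hsingle : ∀ b : c, cellProj β c (β b) = Finsupp.single b 1 := fun b => by
    rw [← one_smul K (β b), ← cellIncl_single, cellProj_cellIncl]
  have hzero : ∀ b, b ∉ c → cellProj β c (β b) = 0 := fun b hb =>
    cellProj_eq_zero β (S := {b}) (Set.disjoint_singleton_left.mpr hb)
      (Submodule.subset_span ⟨b, rfl, rfl⟩)
  induction β.mem_span x using Submodule.span_induction with
  | zero =>
    rw [map_zero i.toLinearMap, map_zero, map_zero, sigmaTranspose_zero]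
  | add x y _ _ hx hy =>
    rw [map_add i.toLinearMap, map_add, map_add, hx, hy, map_add, map_add, sigmaTranspose_add]
  | smul z x _ hx =>
    rw [map_smul i.toLinearMap, map_smul, map_smul, hx, map_smul, map_smul, sigmaTranspose_smul]
  | mem x hx =>
    obtain ⟨b, rfl⟩ := hx
    by_cases hb : b ∈ c
    · obtain ⟨b', hb', h1, h2, h3⟩ := h.invol ⟨b, hb⟩
      rw [hb', hsingle b', hsingle ⟨b, hb⟩, cellTheta_single, cellTheta_single, matBasis_apply,
        matBasis_apply, sigmaTranspose_single, KInvolution.baseChange_tmul,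
        dualInvolution_repEquiv hdual h3, h1, h2]
    · obtain ⟨b', hb', h1⟩ := h₄.exists_mem_twoCells ⟨b, rfl⟩ (mem_twoCell_self b)
      have hb'c : b' ∉ c := fun hc' =>
        hb (twoCells_eq_of_mem hc ⟨b, rfl⟩ hc' hb' ▸ mem_twoCell_self b)
      rw [h1, hzero b' hb'c, hzero b hb, map_zero, sigmaTranspose_zero]

theorem involution_mem_span {T : Set ι} (hT : ∀ b ∈ T, ∃ b' ∈ T, i (β b) = β b') {x : A}
    (hx : x ∈ Submodule.span K (β '' T)) : i x ∈ Submodule.span K (β '' T) := by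
  have h : Submodule.span K (β '' T) ≤ (Submodule.span K (β '' T)).comap i.toLinearMap := by
    rw [Submodule.span_le]
    rintro _ ⟨b, hb, rfl⟩
    obtain ⟨b', hb', h⟩ := hT b hb
    exact Submodule.subset_span ⟨b', hb', h.symm⟩
  exact h hx

variable [IsScalarTower K A A] [SMulCommClass K A A]

/-- Let `w` lift the identity matrix. Projecting `i (i a * w) = i w * a` to the cell gives `rightMat
a` from the right-hand side and the `σ`-transpose of `leftMat (i a)` from the left-hand side, the
identity matrix being its own `σ`-transpose. -/
theorem IsLabelling.rightMat_eq (h : IsLabelling i β c n m E) (h₃ : PropertyP3 β)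
    (h₄ : PropertyP4 i β) (hc : c ∈ twoCells β) {S : Set ι} (hS : IsLayer β S c)
    (hdual : ∀ s : Irr m, ∃ t, IsDual s t) (a : A) :
    rightMat β E a = sigmaTranspose (dualInvolution hdual).baseChange (leftMat β E (i a)) := by
  set w : A := cellIncl β c ((cellTheta E).symm 1) with hw
  have hpw : cellTheta E (cellProj β c w) = 1 := by
    rw [hw, cellProj_cellIncl, LinearEquiv.apply_symm_apply]
  have h1 : sigmaTranspose (dualInvolution hdual).baseChange
      (1 : Matrix (Fin n) (Fin n) (ScalarRing m)) = 1 := by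
    ext p q
    rw [sigmaTranspose_apply, Matrix.one_apply, Matrix.one_apply,
      apply_ite (dualInvolution hdual).baseChange, KInvolution.map_one]
    simp only [eq_comm]
    congr 1
  have hmem : w ∈ Submodule.span K (β '' c) := cellIncl_mem β _ subset_rfl
  have hi : i w ∈ Submodule.span K (β '' (S ∪ c)) :=
    Submodule.span_mono (Set.image_mono Set.subset_union_right)
      (involution_mem_span (fun b hb => h₄.exists_mem_twoCells hc hb) hmem)
  have hii : i (i a * w) = i w * a :=
    (i.map_mul_rev' _ _).trans (congrArg (i w * ·) (i.involutive' a))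
  have h2 := h.cellTheta_cellProj_involution h₄ hc hdual (i a * w)
  rw [hii, hS.cellProj_mul_right a hi, h.cellTheta_cellRight h₃ hc,
    h.cellTheta_cellProj_involution h₄ hc hdual, hpw, h1, one_mul,
    hS.cellProj_mul_left _ (Submodule.span_mono (Set.image_mono Set.subset_union_right) hmem),
    h.cellTheta_cellLeft h₃ hc, hpw, mul_one] at h2
  exact h2

end Involution

/-! ## The identity element -/

section Unit

variable {A : Type*} [NonUnitalRing A] {X : Type*} {e : X → A}

theorem IsGeneralizedUnit.sum_mul (he : IsGeneralizedUnit e) [Fintype X] (a : A) :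
    (∑ x, e x) * a = a ∧ a * ∑ x, e x = a := by
  classical
  have hm : ∀ x y, e x * e y = if x = y then e x else 0 := fun x y => by
    split_ifs with h
    · rw [← h, he.2.1]
    · exact he.2.2.1 x y h
  have ha : a ∈ AddSubgroup.closure {a : A | ∃ (x y : X) (r : A), a = e x * r * e y} := by
    rw [he.2.2.2]
    trivial
  induction ha using AddSubgroup.closure_induction with
  | mem a ha =>
    obtain ⟨x, y, r, rfl⟩ := ha
    constructor
    · rw [← mul_assoc, ← mul_assoc, Finset.sum_mul]
      simp [hm]
    · rw [mul_assoc, Finset.mul_sum]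
      simp [hm]
  | zero => simp
  | add a b _ _ ha hb => rw [mul_add, add_mul, ha.1, ha.2, hb.1, hb.2]; exact ⟨rfl, rfl⟩
  | neg a _ ha => rw [mul_neg, neg_mul, ha.1, ha.2]; exact ⟨rfl, rfl⟩

theorem IsCompatible.mul_eq_or {ι : Type*} {β : ι → A} (he : IsGeneralizedUnit e)
    (hβ : IsCompatible e β) (x : X) (b : ι) : e x * β b = β b ∨ e x * β b = 0 := by
  obtain ⟨p, ⟨r, hr⟩, -⟩ := hβ.2 b
  rw [hr, ← mul_assoc, ← mul_assoc]
  by_cases h : x = p.1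
  · rw [h, he.2.1]
    exact Or.inl rfl
  · rw [he.2.2.1 _ _ h, zero_mul, zero_mul]
    exact Or.inr rfl

variable [Module K A] {ι : Type*} {β : Module.Basis ι K A} {c : Set ι}

theorem cellCoeff_eq_or {b : c} (hb : ∀ b' : ι, β b * β b' = β b' ∨ β b * β b' = 0) (b' : c) :
    cellCoeff β c b b' = Finsupp.single b' 1 ∨ cellCoeff β c b b' = 0 := by
  refine (hb b').imp (fun h => ?_) fun h => ?_
  · refine (congrArg (cellProj β c) h).trans ?_
    rw [← one_smul K (β b'), ← cellIncl_single, cellProj_cellIncl]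
  · exact (congrArg (cellProj β c) h).trans (map_zero _)

theorem asymCoeff_apply_eq_zero {b : c} (hb : ∀ b' : ι, β b * β b' = β b' ∨ β b * β b' = 0)
    {b' b'' : c} (h : b' ≠ b'') : asymCoeff β c b b' b'' = 0 := by
  have h0 : cellCoeff β c b b' b'' = 0 := by
    obtain h1 | h1 := cellCoeff_eq_or hb b'
    · rw [h1, Finsupp.single_eq_of_ne h.symm]
    · rw [h1, Finsupp.zero_apply]
  rw [asymCoeff, Finsupp.mapRange_apply, h0, mul_zero]
  simp

/-- In the asymptotic ring, `t_b` times the identity is `t_b`. As left multiplication by `b` fixes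
or kills every basis element, `t_b t_{b'}` has no component along `t_b` unless `b' = b`; thus `b`
must occur in the identity. -/
theorem IsLabelling.mem_support_unit {i : KInvolution K A} {n r : ℕ} {m : Fin r → ℕ}
    {E : c ≃ Fin n × Fin n × Irr m} (h : IsLabelling i β c n m E) {b : c}
    (hb : ∀ b' : ι, β b * β b' = β b' ∨ β b * β b' = 0) :
    b ∈ ((cellTheta E).symm 1).support := by
  classical
  rw [Finsupp.mem_support_iff]
  intro h0
  have h1 := congrArg (fun f => f b) (h.asymMul_unit (Finsupp.single b 1))
  simp only [Finsupp.single_eq_same] at h1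
  rw [linearMap_apply_eq_sum] at h1
  refine zero_ne_one (α := K) (Eq.trans (Eq.symm (Finset.sum_eq_zero fun b' _ => ?_)) h1)
  dsimp only
  by_cases hb' : b' = b
  · rw [hb', h0, zero_mul]
  · rw [asymMul_single, castK_apply, asymCoeff_apply_eq_zero hb hb', Int.cast_zero, mul_zero]

/-- An algebra with the properties `P₁` and `P₄` has an identity element. -/
theorem PropertyP4.exists_unit {i : KInvolution K A} (he : IsGeneralizedUnit e)
    (hβ : IsCompatible e β) (h₁ : (twoCells β).Finite) (h₄ : PropertyP4 i β) :
    ∃ u : A, ∀ a : A, u * a = a ∧ a * u = a := by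
  choose d hd using hβ.1
  have hinj : Function.Injective d := fun x y h => he.1 (by rw [← hd, ← hd, h])
  -- The idempotents `e x` lying in one cell inject into the finite support of the identity of its
  -- asymptotic ring.
  have hfin : (⋃ c ∈ twoCells β, d ⁻¹' c).Finite := by
    refine h₁.biUnion fun c hc => ?_
    obtain ⟨n, r, m, E, h⟩ := h₄ c hc
    refine (Set.Finite.preimage hinj.injOn
      (((cellTheta E).symm 1).support.finite_toSet.image Subtype.val)).subset fun x hx => ?_
    refine ⟨⟨d x, hx⟩, h.mem_support_unit fun b => ?_, rfl⟩
    rw [hd]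
    exact hβ.mul_eq_or he x b
  have : Finite X := Set.finite_univ_iff.mp (hfin.subset fun x _ =>
    Set.mem_biUnion ⟨d x, rfl⟩ (mem_twoCell_self (d x)))
  have := Fintype.ofFinite X
  exact ⟨∑ x, e x, he.sum_mul⟩

end Unit

/-! ## Affine cell ideals of quotients -/

section Quotient

variable {k B : Type u} [CommRing k] [CommRing B] [Algebra k B] {n : ℕ}
  {A : Type w} [Ring A] [Algebra k A]

/-- The involution of the quotient by a stable ideal. -/
def quotientInvolution (i : KInvolution k A) (I : Ideal A) [I.IsTwoSided]
    (hI : ∀ a ∈ I, i a ∈ I) : KInvolution k (A ⧸ I) where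
  toLinearMap := (Submodule.Quotient.restrictScalarsEquiv k I).toLinearMap ∘ₗ
    Submodule.mapQ (I.restrictScalars k) (I.restrictScalars k) i.toLinearMap hI ∘ₗ
    (Submodule.Quotient.restrictScalarsEquiv k I).symm.toLinearMap
  map_mul_rev' x y := by
    obtain ⟨a, rfl⟩ := Ideal.Quotient.mk_surjective x
    obtain ⟨b, rfl⟩ := Ideal.Quotient.mk_surjective y
    exact congrArg (Ideal.Quotient.mk I) (i.map_mul_rev' a b)
  involutive' x := by
    obtain ⟨a, rfl⟩ := Ideal.Quotient.mk_surjective x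
    exact congrArg (Ideal.Quotient.mk I) (i.involutive' a)

theorem quotientInvolution_mk (i : KInvolution k A) (I : Ideal A) [I.IsTwoSided]
    (hI : ∀ a ∈ I, i a ∈ I) (a : A) :
    quotientInvolution i I hI (Ideal.Quotient.mk I a) = Ideal.Quotient.mk I (i a) := rfl

/-- A criterion in terms of matrices for a layer of ideals to be an affine cell ideal. -/
theorem exists_isAffineCellIdeal_quotient [Algebra.FiniteType k B] (i : KInvolution k A)
    (σ : KInvolution k B) {I J : Ideal A} [I.IsTwoSided] (hJ : J.IsTwoSided)
    (hIJ : I ≤ J) (hIi : ∀ a ∈ I, i a ∈ I) (hJi : ∀ a ∈ J, i a ∈ J)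
    (φ : A →ₐ[k] Matrix (Fin n) (Fin n) B) (hφ : ∀ a ∈ I, φ a = 0)
    (p : A →ₗ[k] Matrix (Fin n) (Fin n) B) (hp : ∀ a ∈ J, p a = 0 ↔ a ∈ I)
    (hsurj : ∀ M, ∃ a ∈ J, p a = M)
    (hl : ∀ a, ∀ x ∈ J, p (a * x) = φ a * p x)
    (hr : ∀ a, ∀ x ∈ J, p (x * a) = p x * sigmaTranspose σ (φ (i a)))
    (hi : ∀ x ∈ J, p (i x) = sigmaTranspose σ (p x)) :
    ∃ j : KInvolution k (A ⧸ I),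
      (∀ a : A, j (Ideal.Quotient.mk I a) = Ideal.Quotient.mk I (i a)) ∧
      IsAffineCellIdeal k j (J.map (Ideal.Quotient.mk I)) := by
  have hmem : ∀ x, x ∈ J.map (Ideal.Quotient.mk I) ↔ ∃ a ∈ J, Ideal.Quotient.mk I a = x :=
    fun x => Ideal.mem_map_iff_of_surjective _ Ideal.Quotient.mk_surjective
  let q : (A ⧸ I) →ₗ[k] Matrix (Fin n) (Fin n) B :=
    Submodule.liftQ (I.restrictScalars k) p (fun a ha => (hp a (hIJ ha)).mpr ha) ∘ₗ
      (Submodule.Quotient.restrictScalarsEquiv k I).symm.toLinearMap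
  have hq : ∀ a, q (Ideal.Quotient.mk I a) = p a := fun a => rfl
  let θ₀ : J.map (Ideal.Quotient.mk I) →ₗ[k] Matrix (Fin n) (Fin n) B :=
    q ∘ₗ ((J.map (Ideal.Quotient.mk I)).subtype.restrictScalars k)
  have hθ₀ : ∀ x, θ₀ x = q x := fun x => rfl
  -- On `J` the kernel of `p` is `I`, and `J` already maps onto all matrices, so `p` induces a
  -- bijection on `J / I`.
  have hbij : Function.Bijective θ₀ := by
    refine ⟨(injective_iff_map_eq_zero θ₀).mpr fun ⟨x, hx⟩ h => ?_, fun M => ?_⟩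
    · obtain ⟨a, ha, rfl⟩ := (hmem x).mp hx
      exact Subtype.ext (Ideal.Quotient.eq_zero_iff_mem.mpr ((hp a ha).mp h))
    · obtain ⟨a, ha, rfl⟩ := hsurj M
      exact ⟨⟨_, (hmem _).mpr ⟨a, ha, rfl⟩⟩, rfl⟩
  refine ⟨quotientInvolution i I hIi, quotientInvolution_mk i I hIi,
    isAffineCellIdeal_of_matrix σ _ _ ?_ ?_ (Ideal.Quotient.liftₐ I φ hφ)
      (LinearEquiv.ofBijective θ₀ hbij) ?_ ?_ ?_⟩
  · refine ⟨fun {x} y hx => ?_⟩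
    obtain ⟨a, ha, rfl⟩ := (hmem x).mp hx
    obtain ⟨b, rfl⟩ := Ideal.Quotient.mk_surjective y
    exact (hmem _).mpr ⟨a * b, hJ.mul_mem_of_left b ha, map_mul _ _ _⟩
  · have hstable : ∀ x ∈ J.map (Ideal.Quotient.mk I),
        quotientInvolution i I hIi x ∈ J.map (Ideal.Quotient.mk I) := fun x hx => by
      obtain ⟨a, ha, rfl⟩ := (hmem x).mp hx
      exact (hmem _).mpr ⟨i a, hJi a ha, rfl⟩
    refine Set.Subset.antisymm (Set.image_subset_iff.mpr hstable) fun x hx => ?_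
    exact ⟨_, hstable x hx, (quotientInvolution i I hIi).involutive' x⟩
  · rintro a ⟨x, hx⟩ ⟨y, hy⟩ h
    obtain ⟨a, rfl⟩ := Ideal.Quotient.mk_surjective a
    obtain ⟨x, hx', rfl⟩ := (hmem x).mp hx
    obtain rfl : y = Ideal.Quotient.mk I (a * x) := h
    exact hl a x hx'
  · rintro a ⟨x, hx⟩ ⟨y, hy⟩ h
    obtain ⟨a, rfl⟩ := Ideal.Quotient.mk_surjective a
    obtain ⟨x, hx', rfl⟩ := (hmem x).mp hx
    obtain rfl : y = Ideal.Quotient.mk I (x * a) := h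
    exact hr a x hx'
  · rintro ⟨x, hx⟩ ⟨y, hy⟩ h
    obtain ⟨x, hx', rfl⟩ := (hmem x).mp hx
    obtain rfl : y = Ideal.Quotient.mk I (i x) := h
    exact hi x hx'

end Quotient

/-! ## The layer of a cell -/

section CellLayer

variable {A : Type*} [Ring A] [Algebra K A] {ι : Type*} {β : Module.Basis ι K A}

/-- The ideal spanned by a set of basis elements. -/
def basedIdeal {S : Set ι} (h : IsBasedIdeal β S) : Ideal A where
  carrier := Submodule.span K (β '' S)
  add_mem' := add_mem
  zero_mem' := zero_mem _
  smul_mem' a x hx := (h x hx a).1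

theorem mem_basedIdeal {S : Set ι} (h : IsBasedIdeal β S) {x : A} :
    x ∈ basedIdeal h ↔ x ∈ Submodule.span K (β '' S) := Iff.rfl

instance {S : Set ι} (h : IsBasedIdeal β S) : (basedIdeal h).IsTwoSided :=
  ⟨fun {x} y hx => (h x hx y).2⟩

variable {i : KInvolution K A} {S c : Set ι} {n r : ℕ} {m : Fin r → ℕ}
  {E : c ≃ Fin n × Fin n × Irr m}

/-- The algebra homomorphism by which `A` acts on a cell. -/
def IsLabelling.leftHom (h : IsLabelling i β c n m E) (h₃ : PropertyP3 β) (hc : c ∈ twoCells β)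
    (hS : IsLayer β S c) : A →ₐ[K] Matrix (Fin n) (Fin n) (ScalarRing m) :=
  AlgHom.ofLinearMap (leftMat β E)
    (by rw [leftMat_apply, cellLeft_apply, one_mul, cellProj_cellIncl,
      LinearEquiv.apply_symm_apply])
    (h.leftMat_mul h₃ hc hS)

theorem involution_mem_basedIdeal (h₄ : PropertyP4 i β) {T : Set ι}
    (hT : ∀ b ∈ T, twoCell β b ⊆ T) {x : A} (hx : x ∈ Submodule.span K (β '' T)) :
    i x ∈ Submodule.span K (β '' T) :=
  involution_mem_span (fun b hb => by
    obtain ⟨b', hb', h⟩ := h₄.exists_mem_twoCells ⟨b, rfl⟩ (mem_twoCell_self b)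
    exact ⟨b', hT b hb hb', h⟩) hx

/-- Finite generation over `ℤ` passes through `K`; it is what allows the same ring to serve in the
cell chain over `ℤ`. -/
instance : Algebra.FiniteType ℤ (ScalarRing m) := by
  have h1 : Algebra.FiniteType ℤ K := inferInstance
  have h2 : Algebra.FiniteType K (ScalarRing m) := inferInstance
  exact h1.trans h2

/-- The hypothesis `hst` makes `S` a union of 2-cells. As `i` preserves every cell, both ideals of
the layer are then stable under it. -/
theorem exists_isAffineCellIdeal_of_isLayer (h₃ : PropertyP3 β) (h₄ : PropertyP4 i β)
    (hc : c ∈ twoCells β) (hS : IsLayer β S c) (hst : ∀ b ∈ S, twoCell β b ⊆ S) :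
    (∃ j : KInvolution K (A ⧸ basedIdeal hS.below),
      (∀ a : A, j (Ideal.Quotient.mk _ a) = Ideal.Quotient.mk _ (i a)) ∧
      IsAffineCellIdeal K j ((basedIdeal hS.total).map (Ideal.Quotient.mk _))) ∧
    (∃ j : KInvolution ℤ (A ⧸ basedIdeal hS.below),
      (∀ a : A, j (Ideal.Quotient.mk _ a) = Ideal.Quotient.mk _ (i.toInt a)) ∧
      IsAffineCellIdeal ℤ j ((basedIdeal hS.total).map (Ideal.Quotient.mk _))) := by
  obtain ⟨n, r, m, E, h⟩ := h₄ c hc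
  have hdual := h.exists_isDual (nonempty_of_mem_twoCells hc)
  let σ := (dualInvolution hdual).baseChange
  let φ := h.leftHom h₃ hc hS
  let p : A →ₗ[K] Matrix (Fin n) (Fin n) (ScalarRing m) :=
    (cellTheta E).toLinearMap ∘ₗ cellProj β c
  have hIJ : basedIdeal hS.below ≤ basedIdeal hS.total := fun x hx =>
    Submodule.span_mono (Set.image_mono Set.subset_union_left) hx
  have hIi : ∀ a ∈ basedIdeal hS.below, i a ∈ basedIdeal hS.below := fun a ha =>
    involution_mem_basedIdeal h₄ hst ha
  have hJi : ∀ a ∈ basedIdeal hS.total, i a ∈ basedIdeal hS.total := fun a ha =>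
    involution_mem_basedIdeal h₄ (fun b hb => hb.elim
      (fun hb => (hst b hb).trans Set.subset_union_left)
      (fun hb => (twoCells_eq_of_mem hc ⟨b, rfl⟩ hb (mem_twoCell_self b)) ▸
        Set.subset_union_right)) ha
  have hφ : ∀ a ∈ basedIdeal hS.below, φ a = 0 := fun a ha => by
    change leftMat β E a = 0
    rw [leftMat_apply, hS.cellLeft_eq_zero ha, LinearMap.zero_apply, map_zero]
  have hp : ∀ a ∈ basedIdeal hS.total, p a = 0 ↔ a ∈ basedIdeal hS.below := fun a ha => by
    refine ⟨fun h0 => ?_, fun ha => ?_⟩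
    · have h1 : cellProj β c a = 0 := (cellTheta E).map_eq_zero_iff.mp h0
      have h2 := sub_cellIncl_cellProj_mem β ha
      rwa [h1, map_zero, sub_zero] at h2
    · change cellTheta E (cellProj β c a) = 0
      rw [cellProj_eq_zero β hS.disjoint ha, map_zero]
  have hsurj : ∀ M, ∃ a ∈ basedIdeal hS.total, p a = M := fun M =>
    ⟨cellIncl β c ((cellTheta E).symm M), cellIncl_mem β _ Set.subset_union_right, by
      change cellTheta E (cellProj β c _) = M
      rw [cellProj_cellIncl, LinearEquiv.apply_symm_apply]⟩
  have hl : ∀ a, ∀ x ∈ basedIdeal hS.total, p (a * x) = φ a * p x := fun a x hx => by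
    change cellTheta E (cellProj β c (a * x)) = _
    rw [hS.cellProj_mul_left a hx, h.cellTheta_cellLeft h₃ hc]
    rfl
  have hr : ∀ a, ∀ x ∈ basedIdeal hS.total,
      p (x * a) = p x * sigmaTranspose σ (φ (i a)) := fun a x hx => by
    change cellTheta E (cellProj β c (x * a)) = _
    rw [hS.cellProj_mul_right a hx, h.cellTheta_cellRight h₃ hc, h.rightMat_eq h₃ h₄ hc hS hdual]
    rfl
  have hi : ∀ x ∈ basedIdeal hS.total, p (i x) = sigmaTranspose σ (p x) := fun x _ =>
    h.cellTheta_cellProj_involution h₄ hc hdual x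
  -- The data over `ℤ` are those over `K` with part of the linearity forgotten.
  exact ⟨exists_isAffineCellIdeal_quotient i σ inferInstance hIJ hIi hJi φ hφ p hp hsurj hl hr hi,
    exists_isAffineCellIdeal_quotient i.toInt σ.toInt inferInstance hIJ hIi hJi
      (φ : A →+* Matrix (Fin n) (Fin n) (ScalarRing m)).toIntAlgHom hφ
      p.toAddMonoidHom.toIntLinearMap hp hsurj hl hr hi⟩

end CellLayer

/-! ## The cell chain -/

section Order

variable {A : Type*} [NonUnitalRing A] [Module K A] {ι : Type*} (β : Module.Basis ι K A)

/-- The type of the 2-cells. -/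
def Cell : Type _ := {c : Set ι // c ∈ twoCells β}

/-- Elements of one cell are equivalent, so the choice of representatives is immaterial; this gives
transitivity and antisymmetry. -/
instance : PartialOrder (Cell β) where
  le c c' := ∃ b ∈ c.1, ∃ b' ∈ c'.1, LRLe β b b'
  le_refl c := by
    obtain ⟨b, hb⟩ := nonempty_of_mem_twoCells c.2
    exact ⟨b, hb, b, hb, LRLe.refl b⟩
  le_trans c c' c'' := by
    rintro ⟨b, hb, b₁, hb₁, h⟩ ⟨b₂, hb₂, b₃, hb₃, h'⟩
    exact ⟨b, hb, b₃, hb₃, h.trans ((lrLe_of_mem_twoCells c'.2 hb₁ hb₂).trans h')⟩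
  le_antisymm c c' := by
    rintro ⟨b, hb, b₁, hb₁, h⟩ ⟨b₂, hb₂, b₃, hb₃, h'⟩
    refine Subtype.ext (twoCells_eq_of_mem c.2 c'.2 hb ?_)
    exact mem_of_lrLe c'.2 hb₁ h
      ((lrLe_of_mem_twoCells c'.2 hb₁ hb₂).trans (h'.trans (lrLe_of_mem_twoCells c.2 hb₃ hb)))

variable {β} in
/-- The 2-cells can be numbered increasingly. -/
theorem exists_numbering (h₁ : (twoCells β).Finite) :
    ∃ (f : ℕ) (c : Fin f → Set ι), Function.Injective c ∧ Set.range c = twoCells β ∧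
      ∀ j l : Fin f, ∀ b ∈ c j, ∀ b' ∈ c l, LRLe β b b' → j ≤ l := by
  -- The partial order on the cells is extended to a linear one; a finite linear order is isomorphic
  -- to some `Fin f`.
  have : Finite (LinearExtension (Cell β)) := h₁.to_subtype
  have := Fintype.ofFinite (LinearExtension (Cell β))
  let o := monoEquivOfFin (LinearExtension (Cell β)) rfl
  let cell : LinearExtension (Cell β) → Cell β := id
  refine ⟨_, fun l => (cell (o l)).1, fun l l' h => o.injective (Subtype.ext h), ?_,
    fun j l b hb b' hb' h => ?_⟩
  · ext s
    constructor
    · rintro ⟨l, rfl⟩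
      exact (cell (o l)).2
    · intro hs
      let z : Cell β := ⟨s, hs⟩
      exact ⟨o.symm (toLinearExtension z),
        congrArg (fun z => (cell z).1) (o.apply_symm_apply (toLinearExtension z))⟩
  · have hle : cell (o j) ≤ cell (o l) := ⟨b, hb, b', hb', h⟩
    have h' : toLinearExtension (cell (o j)) ≤ toLinearExtension (cell (o l)) :=
      OrderHom.monotone _ hle
    exact o.le_iff_le.mp h'

end Order

/-! ### From a numbering of the cells to a cell chain -/

section Chain

variable {A : Type*} [Ring A] [Algebra K A] {ι : Type*} {β : Module.Basis ι K A}
  {i : KInvolution K A}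

/-- An increasing numbering of the 2-cells gives a cell chain. -/
theorem isCellChain_of_numbering (h₃ : PropertyP3 β) (h₄ : PropertyP4 i β) {f : ℕ}
    {c : Fin f → Set ι} (hinj : Function.Injective c) (hrange : Set.range c = twoCells β)
    (hmono : ∀ j l : Fin f, ∀ b ∈ c j, ∀ b' ∈ c l, LRLe β b b' → j ≤ l) :
    IsCellChain K i (fun l => Submodule.span K (β '' c l)) ∧
    IsCellChain ℤ i.toInt (fun l => (Submodule.span K (β '' c l)).restrictScalars ℤ) := by
  have hc : ∀ l, c l ∈ twoCells β := fun l => hrange ▸ ⟨l, rfl⟩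
  have hcell : ∀ b, ∃ l, b ∈ c l := fun b => by
    obtain ⟨l, hl⟩ : twoCell β b ∈ Set.range c := hrange ▸ ⟨b, rfl⟩
    exact ⟨l, hl ▸ mem_twoCell_self b⟩
  have huniq : ∀ {b j l}, b ∈ c j → b ∈ c l → j = l := fun hj hl =>
    hinj (twoCells_eq_of_mem (hc _) (hc _) hj hl)
  -- `S l` is the union of the first `l` cells, so `S l.castSucc` lies strictly below `c l`.
  -- Monotonicity of the numbering makes it downward closed.
  let S : Fin (f + 1) → Set ι := fun l => ⋃ m : {m : Fin f // m.castSucc < l}, c m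
  have hmemS : ∀ {l b}, b ∈ S l ↔ ∃ m : Fin f, m.castSucc < l ∧ b ∈ c m := fun {l b} => by
    simp [S]
  have hlower : ∀ l, ∀ b ∈ S l, ∀ b', LRLe β b' b → b' ∈ S l := fun l b hb b' h => by
    obtain ⟨m, hm, hbm⟩ := hmemS.mp hb
    obtain ⟨m', hm'⟩ := hcell b'
    exact hmemS.mpr ⟨m', lt_of_le_of_lt (Fin.castSucc_le_castSucc_iff.mpr
      (hmono m' m b' hm' b hbm h)) hm, hm'⟩
  have hbased : ∀ l, IsBasedIdeal β (S l) := fun l => isBasedIdeal_of_isLower (hlower l)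
  have hst : ∀ l, ∀ b ∈ S l, twoCell β b ⊆ S l := fun l b hb b' hb' => hlower l b hb b' hb'.1
  have hsucc : ∀ l : Fin f, S l.succ = S l.castSucc ∪ c l := fun l => by
    ext b
    rw [Set.mem_union, hmemS, hmemS]
    constructor
    · rintro ⟨m, hm, hb⟩
      obtain h | rfl := (Fin.castSucc_lt_succ_iff.mp hm).lt_or_eq
      · exact Or.inl ⟨m, Fin.castSucc_lt_castSucc_iff.mpr h, hb⟩
      · exact Or.inr hb
    · rintro (⟨m, hm, hb⟩ | hb)
      · exact ⟨m, hm.trans (Fin.castSucc_lt_succ), hb⟩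
      · exact ⟨l, Fin.castSucc_lt_succ, hb⟩
  have hlayer : ∀ l : Fin f, IsLayer β (S l.castSucc) (c l) := fun l =>
    ⟨hbased _, hsucc l ▸ hbased _, Set.disjoint_left.mpr fun b hb hb' => by
      obtain ⟨m, hm, hbm⟩ := hmemS.mp hb
      exact (Fin.castSucc_lt_castSucc_iff.mp hm).ne (huniq hbm hb')⟩
  -- The layer is formed with `S l.castSucc ∪ c l` and the chain with `S l.succ`; the equality of
  -- sets is lifted to the ideals, for rewriting below.
  have hideal : ∀ l : Fin f, basedIdeal (hbased l.succ) = basedIdeal (hlayer l).total := fun l => by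
    ext x
    rw [mem_basedIdeal, mem_basedIdeal, hsucc]
  have hsup : ∀ l, (basedIdeal (hbased l)).restrictScalars K
      = ⨆ m : {m : Fin f // m.castSucc < l}, Submodule.span K (β '' c m) := fun l => by
    rw [← Submodule.span_iUnion, ← Set.image_iUnion]
    rfl
  have hint : DirectSum.IsInternal fun l => Submodule.span K (β '' c l) := by
    rw [DirectSum.isInternal_submodule_iff_iSupIndep_and_iSup_eq_top]
    constructor
    · rw [iSupIndep_def]
      intro l
      have h : ⨆ (j) (_ : j ≠ l), Submodule.span K (β '' c j)
          ≤ Submodule.span K (β '' (c l)ᶜ) := iSup₂_le fun j hj =>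
        Submodule.span_mono (Set.image_mono fun b hb hb' => hj (huniq hb hb'))
      exact (β.linearIndependent.disjoint_span_image disjoint_compl_right).mono_right h
    · rw [← Submodule.span_iUnion, ← Set.image_iUnion,
        Set.eq_univ_of_forall fun b => Set.mem_iUnion.mpr (hcell b), Set.image_univ, β.span_eq]
  have hmap : ∀ l, ∀ x, x ∈ Submodule.span K (β '' c l) → i x ∈ Submodule.span K (β '' c l) :=
    fun l x hx => involution_mem_span (fun b hb => h₄.exists_mem_twoCells (hc l) hb) hx
  constructor
  · refine ⟨hint, fun l => le_antisymm ?_ fun x hx => ⟨i x, hmap l x hx, i.involutive' x⟩,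
      fun l => basedIdeal (hbased l), inferInstance, hsup, fun l => ?_⟩
    · rintro _ ⟨x, hx, rfl⟩
      exact hmap l x hx
    · have h := (exists_isAffineCellIdeal_of_isLayer h₃ h₄ (hc l) (hlayer l) (hst _)).1
      rw [← hideal l] at h
      exact h
  · refine ⟨hint, fun l => le_antisymm ?_ fun x hx => ⟨i x, hmap l x hx, i.involutive' x⟩,
      fun l => basedIdeal (hbased l), inferInstance, fun l => ?_, fun l => ?_⟩
    · rintro _ ⟨x, hx, rfl⟩
      exact hmap l x hx
    · rw [← Submodule.restrictScalars_iSup, ← hsup]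
      rfl
    · have h := (exists_isAffineCellIdeal_of_isLayer h₃ h₄ (hc l) (hlayer l) (hst _)).2
      rw [← hideal l] at h
      exact h

end Chain

end CellTheory

end

/-! ### The main theorem -/

open CellTheory
theorem theorem3p4
    {A : Type*} [NonUnitalRing A] [Module K A] [IsScalarTower K A A] [SMulCommClass K A A]
    (i : KInvolution K A)
    {X : Type*} (e : X → A) (he : IsGeneralizedUnit e)
    {ι : Type*} (β : Module.Basis ι K A) (hβ : IsCompatible e β)
    (h₁ : PropertyP1 β e) (h₂ : PropertyP2 β) (h₃ : PropertyP3 β) (h₄ : PropertyP4 i β) :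
    (∃ (u : A) (hu : ∀ a : A, u * a = a ∧ a * u = a),
      letI : Ring A := ringOfUnit u hu
      letI : Algebra K A := algebraOfUnit K u hu
      IsAffineCellular ℤ (A := A) i.toInt ∧
      IsAffineCellular K (A := A) i ∧
      ∃ (f : ℕ) (c : Fin f → Set ι),
        Function.Injective c ∧ Set.range c = twoCells β ∧
        (∀ j l : Fin f, ∀ b ∈ c j, ∀ b' ∈ c l, LRLe β b b' → j ≤ l) ∧
        IsCellChain K (A := A) i (fun l => Submodule.span K (β '' c l))) ∧
    ∀ c ∈ twoCells β, ∀ (n r : ℕ) (m : Fin r → ℕ) (E : c ≃ Fin n × Fin n × Irr m),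
      IsLabelling i β c n m E → IsGenMatrixCell i β c n m E := by
  refine ⟨?_, fun c hc n r m E h => h.isGenMatrixCell h₃ hc⟩
  obtain ⟨u, hu⟩ := h₄.exists_unit he hβ h₁.finite_cells
  obtain ⟨f, c, hinj, hrange, hmono⟩ := exists_numbering h₁.finite_cells
  let _ : Ring A := ringOfUnit u hu
  let _ : Algebra K A := algebraOfUnit K u hu
  obtain ⟨hK, hZ⟩ := isCellChain_of_numbering (A := A) (i := i) h₃ h₄ hinj hrange hmono
  exact ⟨u, hu, ⟨f, _, hZ⟩, ⟨f, _, hK⟩, f, c, hinj, hrange, hmono, hK⟩
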